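/- Let $N\ge 0$ be an integer and let $q,c_0,c_1,c_2,c_3,c_4\in\mathbb{C}$ satisfy $$q^{2N+3}c_0c_1c_2c_3c_4=1,$$ together with $q\neq0$, $c_i\neq 0$, $q^k\neq1$ for $1\le k\le N$; $c_1c_2,\ c_2c_3,\ c_0c_3,\ c_0c_4,\ c_2c_4,\ qc_1c_2c_3,\ qc_0c_3c_4,\ qc_1c_2c_4\notin\{q^{-2},\dots,q^{-2N}\}$; $c_0,\dots,c_4\notin\{q^{-1},\dots,q^{-N}\}$. Half-integer powers are read multiplicatively: fix square roots $r=\sqrt q$, $s_i=\sqrt{c_i}$ with $r^{2N+3}s_0s_1s_2s_3s_4=1$, and take the square root of a monomial in $q,c_0,\dots,c_4$ to be the same monomial in $r,s_0,\dots,s_4$. Write $(a;q)_k=\prod_{\ell=0}^{k-1}(1-aq^\ell)$. For $0\le n,x\le N$ put $$p_n(x;c_1,c_2,c_3;N)=\Omega(n;c_1,c_2,c_3;N)\;{}_4\phi_3\!\left(\begin{matrix}q^{-n},\,c_2c_3q^{n+1},\,q^{-x},\,c_1c_2q^{x+1}\\ qc_2,\,c_1c_2c_3q^{N+2},\,q^{-N}\end{matrix};q;q\right),$$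 $$\Omega(n;c_1,c_2,c_3;N)=\frac{(q;q)_N}{(q;q)_n(q;q)_{N-n}}\,\frac{(1-c_2c_3q^{2n+1})(qc_2;q)_n(c_1c_2c_3q^{N+2};q)_n(qc_1;q)_{N-n}}{(qc_2)^{n-N/2}(c_2c_3q^{n+1};q)_{N+1}(qc_3;q)_n},$$ and $p_n(x;c_1,c_2,c_3;N)=0$ if $n$ or $x$ lies outside $\{0,\dots,N\}$ (in particular if $N<0$). Put $\omega_n(c)=(-1)^nc^{n/2}q^{n(n+1)/2}$. For integers $x,y$ and nonnegative integers $i,j$ with $i+j\le N$ the Griffiths polynomial of $q$-Racah type is $$\mathcal G_{i,j}(x,y)=\sum_{a=0}^{\min(N-j,N-y)}\omega_a\!\Big(\frac{c_1c_2c_3}{c_4}\Big)\,p_i(a;c_1,c_2,c_3;N-j)\,p_j(y;c_3,c_0,c_4;N-a)\,p_a(x;c_4,c_2,c_1;N-y).$$ Let $\lambda(x;c)=-(1-q^{-x})(1-cq^{x+1})$. In the following definitions $n$ and $N$ are integers, and a superscript or subscript $\pm$ stands for $\pm1$: $$\Phi^+(n;c_1,c_2,c_3;N)=\frac{-c_2q^{n-N}(1-q^n)(1-c_1q^{N-n+1})(1-c_2c_3q^{n+N+1})(1-c_3q^n)}{(1-c_2c_3q^{2n})(1-c_2c_3q^{2n+1})},$$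 $$\Phi^-(n;c_1,c_2,c_3;N)=\frac{(1-q^{n-N})(1-c_1c_2c_3q^{n+N+2})(1-c_2q^{n+1})(1-c_2c_3q^{n+1})}{(1-c_2c_3q^{2n+1})(1-c_2c_3q^{2n+2})},\qquad \Phi^0=-\Phi^+-\Phi^-,$$ $$\Phi_+^+(n;c_1,c_2,c_3;N)=-\sqrt{qc_2}\,c_2q^{2n-N-1}\frac{(1-q^n)(1-c_1q^{N-n+1})(1-c_1q^{N+2-n})(1-c_3q^n)}{(1-c_2c_3q^{2n})(1-c_2c_3q^{2n+1})},$$ $$\Phi_+^-(n;c_1,c_2,c_3;N)=-\frac{(1-c_1c_2c_3q^{n+N+2})(1-c_1c_2c_3q^{n+N+3})(1-c_2q^{n+1})(1-c_2c_3q^{n+1})}{c_3q^{N+1}\sqrt{qc_2}\,(1-c_2c_3q^{2n+1})(1-c_2c_3q^{2n+2})},$$ $$\Phi_+^0=-\Phi_+^+-\Phi_+^--\frac{(1-c_1c_2q^{N+2})(1-c_1c_2c_3q^{N+2})}{c_3q^{N+1}\sqrt{qc_2}},$$ $$\Phi_-^+(n;c_1,c_2,c_3;N)=-\sqrt{qc_2}\,\frac{(1-q^n)(1-c_3q^n)(1-c_2c_3q^{n+N})(1-c_2c_3q^{n+N+1})}{q^N(1-c_2c_3q^{2n})(1-c_2c_3q^{2n+1})},$$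 $$\Phi_-^-(n;c_1,c_2,c_3;N)=-c_3\sqrt{qc_2}\,q^N\frac{(1-q^{n-N})(1-q^{n-N+1})(1-c_2q^{n+1})(1-c_2c_3q^{n+1})}{(1-c_2c_3q^{2n+1})(1-c_2c_3q^{2n+2})},$$ $$\Phi_-^0=-\Phi_-^+-\Phi_-^--\sqrt{qc_2}\,(1-c_3q^N)(q^{-N}-1),$$ $$F^-_x(c_1,c_2)=\frac{c_1c_2q^{x+1}(1-c_2q^{x+1})(1-c_1c_2q^{x+1})}{(1-c_1c_2q^{2x+1})(1-c_1c_2q^{2x+2})},\qquad F^+_x(c_1,c_2)=\frac{c_1c_2^2q^{x+1}(1-c_1q^x)(1-q^x)}{(1-c_1c_2q^{2x})(1-c_1c_2q^{2x+1})}.$$ For $\varepsilon\in\{-1,0,1\}$ define $A^{\varepsilon,\varepsilon'}_{i,j}=A^{\varepsilon,\varepsilon'}_{i,j}(c_1,c_2,c_3,c_4;N)$ by $$A^{\varepsilon,\pm}_{i,j}=-c_3q^{N+1}F^\pm_j(c_4,c_0)\,\Phi^\varepsilon_\pm(i;c_1,c_2,c_3;N-j),$$ $$A^{\varepsilon,0}_{i,j}=c_3q^{N+1}\big(F^+_j(c_4,c_0)+F^-_j(c_4,c_0)\big)\Phi^\varepsilon(i;c_1,c_2,c_3;N-j)\qquad(\varepsilon=\pm1),$$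 $$A^{0,0}_{i,j}=-\frac{(1-c_3q^{N+1-j})\sqrt{qc_2}}{1-c_1c_2q^{N+2-j}}\sum_{\varepsilon}A^{\varepsilon,+}_{i,j}-\frac{1-c_1c_2q^{N+1-j}}{(1-c_3q^{N-j})\sqrt{qc_2}}\sum_{\varepsilon}A^{\varepsilon,-}_{i,j}-\sum_{\varepsilon=\pm1}A^{\varepsilon,0}_{i,j}.$$ When the arguments $c_1,\dots,c_4$ are permuted (with one of them possibly replaced by $c_0$), the role of $c_0$ is taken by the parameter that is left over. At parameter values where some of these formulas read $0/0$, common factors are cancelled first (using $q^{2N+3}c_0c_1c_2c_3c_4=1$), that is, the continuous extension is meant. Then for all nonnegative integers $i,j,x,y$ with $i+j\le N$ and $x+y\le N$: $$\lambda(j;c_0c_4)\,\mathcal G_{i,j}(x,y)=\sum_{\varepsilon,\varepsilon'\in\{-1,0,1\}}A^{\varepsilon,\varepsilon'}_{x,y}(c_1,c_2,c_4,c_3;N)\,\mathcal G_{i,j}(x-\varepsilon,y-\varepsilon'),$$ $$\lambda(i;c_2c_3)\,\mathcal G_{i,j}(x,y)=\sum_{\varepsilon,\varepsilon'\in\{-1,0,1\}}\frac{\omega_{-\varepsilon}(q^{2x}c_1c_2c_4/c_3)}{\omega_{-\varepsilon'}(q^{2y}c_1c_0c_3/c_4)}\,A^{\varepsilon',\varepsilon}_{y,x}(c_1,c_0,c_3,c_4;N)\,\mathcal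 G_{i,j}(x-\varepsilon,y-\varepsilon').$$ -/

import Mathlib

noncomputable section

namespace QGriffiths

/- Square roots.  The formulas contain half-integer powers of `q` and of the parameters
`c₀,…,c₄`.  They are read multiplicatively: square roots `r` of `q` and `sᵢ` of `cᵢ` are fixed, and
the square root of a monomial in `q` and the `cᵢ` is the same monomial in `r` and the `sᵢ`.  The
univariate functions take the single square root that they need as an argument `h`. -/

/-- The `q`-Pochhammer symbol `(a;q)_k`. -/
def qPoch (a q : ℂ) (k : ℕ) : ℂ := ∏ l ∈ Finset.range k, (1 - a * q ^ l)

/-- The `q`-binomial coefficient `[N, n]_q`, used for `n ≤ N` only. -/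
def qBinom (q : ℂ) (N n : ℕ) : ℂ := qPoch q q N / (qPoch q q n * qPoch q q (N - n))

/-- The quotient `(1 - c q^m) / (1 - c q^k)` as a rational function of `c` in lowest terms:
for `m = k` it is the constant `1`, so that no artificial pole remains. -/
def redQuot (q c : ℂ) (m k : ℤ) : ℂ :=
  if m = k then 1 else (1 - c * q ^ m) / (1 - c * q ^ k)

theorem redQuot_eq {q c : ℂ} {m k : ℤ} (h : 1 - c * q ^ k ≠ 0) :
    redQuot q c m k = (1 - c * q ^ m) / (1 - c * q ^ k) := by
  unfold redQuot
  split_ifs with hm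
  · subst hm; exact (div_self h).symm
  · rfl

/-- The normalization `Ω(n;c₁,c₂,c₃;N)` for `0 ≤ n ≤ N`, where `h` is the square root of `q c₂`:
`[N,n]_q (1-c₂c₃q^{2n+1}) (qc₂;q)_n (c₁c₂c₃q^{N+2};q)_n (qc₁;q)_{N-n}
  / ((qc₂)^{n-N/2} (c₂c₃q^{n+1};q)_{N+1} (qc₃;q)_n)`.
The factor `1 - c₂c₃q^{2n+1}` is the factor with `l = n` of `(c₂c₃q^{n+1};q)_{N+1}`; it is
cancelled. -/
def Omega (q h c1 c2 c3 : ℂ) (N n : ℕ) : ℂ :=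
  qBinom q N n *
    (qPoch (q * c2) q n * qPoch (c1 * c2 * c3 * q ^ (N + 2)) q n * qPoch (q * c1) q (N - n)) /
    ((q * c2) ^ n / h ^ N *
      (∏ l ∈ (Finset.range (N + 1)).erase n, (1 - c2 * c3 * q ^ (n + 1) * q ^ l)) *
      qPoch (q * c3) q n)

/-- The terminating series `₄φ₃(q^{-n}, a₂, a₃, a₄; b₁, b₂, b₃; q; q)`: as `(q^{-n};q)_k = 0` for
`k > n`, the sum stops at `k = n`. -/
def phi43 (q : ℂ) (n : ℕ) (a2 a3 a4 b1 b2 b3 : ℂ) : ℂ :=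
  ∑ k ∈ Finset.range (n + 1),
    (qPoch (q ^ (-(n : ℤ))) q k * qPoch a2 q k * qPoch a3 q k * qPoch a4 q k) /
      (qPoch b1 q k * qPoch b2 q k * qPoch b3 q k) * (q ^ k / qPoch q q k)

/-- The normalized `q`-Racah polynomial `p_n(x;c₁,c₂,c₃;N)`, with `h` the square root of `q c₂`.
It is zero unless `0 ≤ n ≤ N` and `0 ≤ x ≤ N`. -/
def racah (q h c1 c2 c3 : ℂ) (N n x : ℤ) : ℂ :=
  if 0 ≤ n ∧ n ≤ N ∧ 0 ≤ x ∧ x ≤ N then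
    Omega q h c1 c2 c3 N.toNat n.toNat *
      phi43 q n.toNat (c2 * c3 * q ^ (n + 1)) (q ^ (-x)) (c1 * c2 * q ^ (x + 1))
        (q * c2) (c1 * c2 * c3 * q ^ (N + 2)) (q ^ (-N))
  else 0

/-- `ω_n(c) = (-1)^n c^{n/2} q^{n(n+1)/2}`, with `h` the square root of `c`. -/
def omega (q h : ℂ) (n : ℤ) : ℂ := (-1) ^ n * h ^ n * q ^ (n * (n + 1) / 2)

/-- The Griffiths polynomial of `q`-Racah type `G_{i,j}(x,y;c₁,c₂,c₃,c₄;N)`, where `q = r²` and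
`cᵢ = sᵢ²`:
`∑_a ω_a(c₁c₂c₃/c₄) p_i(a;c₁,c₂,c₃;N-j) p_j(y;c₃,c₀,c₄;N-a) p_a(x;c₄,c₂,c₁;N-y)`,
with `0 ≤ a ≤ min(N-j,N-y)`. -/
def griffiths (r s0 s1 s2 s3 s4 : ℂ) (N i j x y : ℤ) : ℂ :=
  ∑ a ∈ Finset.Icc (0 : ℤ) (min (N - j) (N - y)),
    omega (r ^ 2) (s1 * s2 * s3 / s4) a *
      racah (r ^ 2) (r * s2) (s1 ^ 2) (s2 ^ 2) (s3 ^ 2) (N - j) i a *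
      racah (r ^ 2) (r * s0) (s3 ^ 2) (s0 ^ 2) (s4 ^ 2) (N - a) j y *
      racah (r ^ 2) (r * s2) (s4 ^ 2) (s2 ^ 2) (s1 ^ 2) (N - y) a x

/-- `λ(x;c) = -(1-q^{-x})(1-c q^{x+1})`. -/
def eigen (q c : ℂ) (x : ℤ) : ℂ := -(1 - q ^ (-x)) * (1 - c * q ^ (x + 1))

/- In the coefficients below the factors of the numerators that can cancel a factor of the
denominator are paired with it in `redQuot`. -/

/-- `Φ^ε(n;c₁,c₂,c₃;N)` for `ε ∈ {-1,0,1}`. -/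
def Phi (q c1 c2 c3 : ℂ) (N ε n : ℤ) : ℂ :=
  let P := -c2 * q ^ (n - N) * (1 - q ^ n) * (1 - c1 * q ^ (N - n + 1)) * (1 - c3 * q ^ n) /
    (1 - c2 * c3 * q ^ (2 * n)) * redQuot q (c2 * c3) (n + N + 1) (2 * n + 1)
  let M := (1 - q ^ (n - N)) * (1 - c1 * c2 * c3 * q ^ (n + N + 2)) * (1 - c2 * q ^ (n + 1)) /
    (1 - c2 * c3 * q ^ (2 * n + 2)) * redQuot q (c2 * c3) (n + 1) (2 * n + 1)
  if ε = 1 then P else if ε = -1 then M else -P - M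

/-- `Φ_-^ε(n;c₁,c₂,c₃;N)` for `ε ∈ {-1,0,1}`, with `h` the square root of `q c₂`
(there is no dependence on `c₁`). -/
def PhiMinus (q h c2 c3 : ℂ) (N ε n : ℤ) : ℂ :=
  let P := -h * ((1 - q ^ n) * (1 - c3 * q ^ n) * (1 - c2 * c3 * q ^ (n + N))) /
    (q ^ N * (1 - c2 * c3 * q ^ (2 * n))) * redQuot q (c2 * c3) (n + N + 1) (2 * n + 1)
  let M := -c3 * h * q ^ N * ((1 - q ^ (n - N)) * (1 - q ^ (n - N + 1)) * (1 - c2 * q ^ (n + 1))) /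
    (1 - c2 * c3 * q ^ (2 * n + 2)) * redQuot q (c2 * c3) (n + 1) (2 * n + 1)
  if ε = 1 then P else if ε = -1 then M
  else -P - M - h * (1 - c3 * q ^ N) * (q ^ (-N) - 1)

/-- `Φ_+^ε(n;c₁,c₂,c₃;N)` for `ε ∈ {-1,0,1}`, with `h` the square root of `q c₂`. -/
def PhiPlus (q h c1 c2 c3 : ℂ) (N ε n : ℤ) : ℂ :=
  let P := -h * c2 * q ^ (2 * n - N - 1) *
    ((1 - q ^ n) * (1 - c1 * q ^ (N - n + 1)) * (1 - c1 * q ^ (N + 2 - n)) * (1 - c3 * q ^ n)) /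
    ((1 - c2 * c3 * q ^ (2 * n)) * (1 - c2 * c3 * q ^ (2 * n + 1)))
  let M := -((1 - c1 * c2 * c3 * q ^ (n + N + 2)) * (1 - c1 * c2 * c3 * q ^ (n + N + 3)) *
    (1 - c2 * q ^ (n + 1))) /
    (c3 * q ^ (N + 1) * h * (1 - c2 * c3 * q ^ (2 * n + 2))) *
    redQuot q (c2 * c3) (n + 1) (2 * n + 1)
  if ε = 1 then P else if ε = -1 then M
  else -P - M - (1 - c1 * c2 * q ^ (N + 2)) * (1 - c1 * c2 * c3 * q ^ (N + 2)) /
    (c3 * q ^ (N + 1) * h)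

/-- `F^-_x(c₁,c₂)`. -/
def FMinus (q c1 c2 : ℂ) (x : ℤ) : ℂ :=
  c1 * c2 * q ^ (x + 1) * (1 - c2 * q ^ (x + 1)) / (1 - c1 * c2 * q ^ (2 * x + 2)) *
    redQuot q (c1 * c2) (x + 1) (2 * x + 1)

/-- `F^+_x(c₁,c₂)`. -/
def FPlus (q c1 c2 : ℂ) (x : ℤ) : ℂ :=
  c1 * c2 ^ 2 * q ^ (x + 1) * ((1 - c1 * q ^ x) * (1 - q ^ x)) /
    ((1 - c1 * c2 * q ^ (2 * x)) * (1 - c1 * c2 * q ^ (2 * x + 1)))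

/-- The coefficients `A^{ε,ε'}_{i,j}(c₁,c₂,c₃,c₄;N)` as displayed in the literature, with `h` the
square root of `q c₂`.  The difference equations use the variant `coeffA`. -/
def coeffADisplayed (q h c0 c1 c2 c3 c4 : ℂ) (N ε ε' i j : ℤ) : ℂ :=
  let plus := fun e : ℤ => -c3 * q ^ (N + 1) * FPlus q c4 c0 j * PhiPlus q h c1 c2 c3 (N - j) e i
  let minus := fun e : ℤ => -c3 * q ^ (N + 1) * FMinus q c4 c0 j * PhiMinus q h c2 c3 (N - j) e i
  let zero := fun e : ℤ =>
    c3 * q ^ (N + 1) * (FPlus q c4 c0 j + FMinus q c4 c0 j) * Phi q c1 c2 c3 (N - j) e i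
  if ε' = 1 then plus ε
  else if ε' = -1 then minus ε
  else if ε = 0 then
    -((1 - c3 * q ^ (N + 1 - j)) * h / (1 - c1 * c2 * q ^ (N + 2 - j))) *
        (plus 1 + plus 0 + plus (-1))
      - (1 - c1 * c2 * q ^ (N + 1 - j)) / ((1 - c3 * q ^ (N - j)) * h) *
        (minus 1 + minus 0 + minus (-1))
      - (zero 1 + zero (-1))
  else zero ε

/-- `F^+_j(c₄,c₀)` without its denominator factor `1 - c₀c₄q^{2j+1}`, and multiplied by
`-c₁c₂c₃q^{2(N-j)+2}`.  As `q^{2N+3}c₀c₁c₂c₃c₄ = 1`, that factor satisfies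
`-c₁c₂c₃q^{2(N-j)+2} (1 - c₀c₄q^{2j+1}) = 1 - c₁c₂c₃q^{2(N-j)+2}`, so that `F^+_j(c₄,c₀)` equals
`FPlusNum / (1 - c₁c₂c₃q^{2(N-j)+2})`. -/
def FPlusNum (q c0 c1 c2 c3 c4 : ℂ) (N j : ℤ) : ℂ :=
  -(c1 * c2 * c3) * q ^ (2 * (N - j) + 2) *
    (c4 * c0 ^ 2 * q ^ (j + 1) * ((1 - c4 * q ^ j) * (1 - q ^ j)) / (1 - c0 * c4 * q ^ (2 * j)))

/-- The coefficients `A^{ε,ε'}_{i,j}(c₁,c₂,c₃,c₄;N)`, `q^{2N+3}c₀c₁c₂c₃c₄ = 1`, with all common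
factors of numerators and denominators cancelled (including those that are common only by virtue of
the relation between the parameters).  It agrees with `coeffADisplayed` wherever the denominators
in the latter do not vanish, see `coeffA_eq_displayed`, and extends it continuously to the points
where the displayed formula reads `0/0`. -/
def coeffA (q h c0 c1 c2 c3 c4 : ℂ) (N ε ε' i j : ℤ) : ℂ :=
  let K := c1 * c2 * c3
  let L := N - j
  let B := FPlusNum q c0 c1 c2 c3 c4 N j
  let plusP := -c3 * q ^ (N + 1) * FPlus q c4 c0 j * PhiPlus q h c1 c2 c3 L 1 i
  let plusM := c3 * q ^ (N + 1) * B *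
    ((1 - K * q ^ (i + L + 3)) * (1 - c2 * q ^ (i + 1)) /
      (c3 * q ^ (L + 1) * h * (1 - c2 * c3 * q ^ (2 * i + 2)))) *
    redQuot q (c2 * c3) (i + 1) (2 * i + 1) * redQuot q K (i + L + 2) (2 * L + 2)
  let zero := fun e : ℤ =>
    c3 * q ^ (N + 1) * (FPlus q c4 c0 j + FMinus q c4 c0 j) * Phi q c1 c2 c3 L e i
  if ε' = 1 then
    if ε = 1 then plusP
    else if ε = -1 then plusM
    else -plusP - plusM + c3 * q ^ (N + 1) * B *
      ((1 - c1 * c2 * q ^ (L + 2)) / (c3 * q ^ (L + 1) * h)) * redQuot q K (L + 2) (2 * L + 2)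
  else if ε' = -1 then
    -c3 * q ^ (N + 1) * FMinus q c4 c0 j * PhiMinus q h c2 c3 L ε i
  else if ε = 0 then
    -(1 - c3 * q ^ (L + 1)) * q ^ j * B * redQuot q K (L + 2) (2 * L + 2)
      - c3 * (1 - q ^ L) * (q ^ (j + 1) - c1 * c2 * q ^ (N + 2)) * FMinus q c4 c0 j
      - (zero 1 + zero (-1))
  else zero ε

theorem FPlus_eq {q c0 c1 c2 c3 c4 : ℂ} {N j : ℤ} (hq : q ≠ 0)
    (hc : q ^ (2 * N + 3) * (c0 * c1 * c2 * c3 * c4) = 1)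
    (h1 : 1 - c4 * c0 * q ^ (2 * j + 1) ≠ 0) :
    1 - c1 * c2 * c3 * q ^ (2 * (N - j) + 2) ≠ 0 ∧
    FPlus q c4 c0 j =
      FPlusNum q c0 c1 c2 c3 c4 N j / (1 - c1 * c2 * c3 * q ^ (2 * (N - j) + 2)) := by
  have e : q ^ (2 * N + 3) = q ^ (2 * (N - j) + 2) * q ^ (2 * j + 1) := by
    rw [← zpow_add₀ hq]; congr 1; ring
  rw [e] at hc
  have key : 1 - c1 * c2 * c3 * q ^ (2 * (N - j) + 2) =
      -(c1 * c2 * c3) * q ^ (2 * (N - j) + 2) * (1 - c4 * c0 * q ^ (2 * j + 1)) := by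
    linear_combination (-1 : ℂ) * hc
  have hK : -(c1 * c2 * c3) * q ^ (2 * (N - j) + 2) ≠ 0 := by
    intro h0
    have : (1 : ℂ) = 0 := by
      rw [← hc]
      linear_combination (-(c0 * c4 * q ^ (2 * j + 1))) * h0
    exact one_ne_zero this
  refine ⟨by rw [key]; exact mul_ne_zero hK h1, ?_⟩
  rw [key]
  unfold FPlus FPlusNum
  rw [mul_div_mul_left _ _ hK, mul_comm c0 c4, div_div]

/-- `coeffA` is the displayed coefficient wherever the denominators of the latter that are not
already in lowest terms do not vanish. -/
theorem coeffA_eq_displayed {q h c0 c1 c2 c3 c4 : ℂ} {N ε ε' i j : ℤ} (hq : q ≠ 0) (h3 : c3 ≠ 0)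
    (hh : h ^ 2 = q * c2) (hc : q ^ (2 * N + 3) * (c0 * c1 * c2 * c3 * c4) = 1)
    (hε : ε = -1 ∨ ε = 0 ∨ ε = 1)
    (h1 : 1 - c4 * c0 * q ^ (2 * j + 1) ≠ 0) (h2 : 1 - c1 * c2 * q ^ (N + 2 - j) ≠ 0)
    (h4 : 1 - c3 * q ^ (N - j) ≠ 0) :
    coeffA q h c0 c1 c2 c3 c4 N ε ε' i j = coeffADisplayed q h c0 c1 c2 c3 c4 N ε ε' i j := by
  obtain ⟨hX, hF⟩ := FPlus_eq hq hc h1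
  have hh0 : h ≠ 0 := by
    rintro rfl
    have h2' : c2 = 0 := by
      have : q * c2 = 0 := by rw [← hh]; ring
      exact (mul_eq_zero.mp this).resolve_left hq
    rw [h2'] at hc
    simp at hc
  have e2 : N + 2 - j = N - j + 2 := by ring
  have e1 : N + 1 - j = N - j + 1 := by ring
  have eN : q ^ (N + 1) = q ^ (N - j + 1) * q ^ j := by
    rw [← zpow_add₀ hq]; congr 1; ring
  have eN2 : q ^ (N + 2) = q ^ (N - j + 1) * q ^ (j + 1) := by
    rw [← zpow_add₀ hq]; congr 1; ring
  have eL : q ^ (N - j + 1) = q ^ (N - j) * q := zpow_add_one₀ hq _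
  have ej : q ^ (j + 1) = q ^ j * q := zpow_add_one₀ hq _
  have hL : q ^ (N - j) ≠ 0 := zpow_ne_zero _ hq
  rw [e2] at h2
  unfold coeffA coeffADisplayed
  simp only [redQuot_eq hX, hF]
  by_cases hp : ε' = 1
  · rcases hε with rfl | rfl | rfl
    · simp [hp, PhiPlus]; ring
    · simp [hp, PhiPlus]; ring
    · simp [hp, PhiPlus]
  by_cases hm : ε' = -1
  · simp [hm]
  by_cases hz : ε = 0
  · simp only [hp, hm, hz, if_true, if_false, e1, e2]
    have sP : ∀ a : ℂ, a * PhiPlus q h c1 c2 c3 (N - j) 1 i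
        + a * PhiPlus q h c1 c2 c3 (N - j) 0 i + a * PhiPlus q h c1 c2 c3 (N - j) (-1) i =
        -a * ((1 - c1 * c2 * q ^ (N - j + 2)) * (1 - c1 * c2 * c3 * q ^ (N - j + 2)) /
          (c3 * q ^ (N - j + 1) * h)) := by
      intro a; simp [PhiPlus]; ring
    have sM : ∀ a : ℂ, a * PhiMinus q h c2 c3 (N - j) 1 i
        + a * PhiMinus q h c2 c3 (N - j) 0 i + a * PhiMinus q h c2 c3 (N - j) (-1) i =
        -a * (h * (1 - c3 * q ^ (N - j)) * (q ^ (-(N - j)) - 1)) := by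
      intro a; simp [PhiMinus]; ring
    rw [sP, sM, zpow_neg, eN, eN2, ej, eL]
    congr 1
    congr 1
    · field_simp
    · field_simp
  · simp [hp, hm, hz]

/-- The conditions on the parameters under which the Griffiths polynomials are considered. -/
structure Admissible (q c0 c1 c2 c3 c4 : ℂ) (N : ℕ) : Prop where
  q_ne : q ≠ 0
  c_ne : ∀ c ∈ ({c0, c1, c2, c3, c4} : Set ℂ), c ≠ 0
  q_pow : ∀ k ∈ Finset.Icc 1 N, q ^ k ≠ 1
  pair : ∀ c ∈ ({c1 * c2, c2 * c3, c0 * c3, c0 * c4, c2 * c4,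
      q * c1 * c2 * c3, q * c0 * c3 * c4, q * c1 * c2 * c4} : Set ℂ),
    ∀ k ∈ Finset.Icc 2 (2 * N), c ≠ q ^ (-(k : ℤ))
  single : ∀ c ∈ ({c0, c1, c2, c3, c4} : Set ℂ), ∀ k ∈ Finset.Icc 1 N, c ≠ q ^ (-(k : ℤ))

end QGriffiths

end

/-! The identities are proved for generic parameters (no forbidden power of `q` at all) and then
extended by continuity.

Univariate input. In the basis `(q^{-x};q)_k (cq^{x+1};q)_k` the three-term operators with
coefficients `Φ`, `Φ_+`, `Φ_-` are bidiagonal. Combined with the ratio of consecutive coefficients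
of the series this gives a difference equation in `x` (`racah_diff`) and two contiguity relations
between the bounds `N` and `N+1` (`racah_plus`, `racah_minus`). The series is symmetric under
exchange of degree and variable together with `c₁ ↔ c₃`. The normalization `Ω` makes the
`Φ`-operator symmetric and makes `Φ_+` and `Φ_-` adjoint to each other up to a constant, so the same
statements hold in the degree (`racah_rec`, `racah_dual_plus`, `racah_dual_minus`).

First equation. For fixed `a`, the factor `p_j(y;c₃,c₀,c₄;N-a)` is an eigenfunction of a difference
operator in `y`, but shifting `y` also changes the bound of `p_a(x;c₄,c₂,c₁;N-y)`. The coefficients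
`A` contain the contiguity coefficients that repair this: summing over the shifts of `x` returns
`p_a(x;c₄,c₂,c₁;N-y)` times a factor which, by the relation between the parameters, is exactly the
coefficient of the operator in `y` (`coeffA_op`). The equation therefore holds for each summand `a`
separately.

Second equation. Here `λ(i;c₂c₃)` comes from the difference equation of `p_i(a;c₁,c₂,c₃;N-j)` in the
summation variable. `coeffA_op`, applied to `p_j`, whose bound contains `a`, turns its coefficients
into shifts of `y`. Shifting the summation index then leaves an operator acting on the degree `a` of
`p_a(x;c₄,c₂,c₁;N-y)`, and this must be exchanged for an operator in `x` (`coeffA_exchange_plus`,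
`coeffA_exchange_zero`, `coeffA_exchange_minus`). The exchange works by bispectrality. Let `ξ(x) =
q^{-x} + c₂c₄q^{x+1}` and let `T` be a contiguity or difference operator in `x`. Both sides are a
multiple of the `q`-commutator `ξT - qTξ` plus a simple correction. On the degree, `ξ` acts by the
recurrence and `T` by scalars. On the variable, `ξ(x) - qξ(x-1) = (1-q²)q^{-x}` and `ξ(x) - qξ(x+1)
= (1-q²)c₂c₄q^{x+1}` are the monomials that the factors `ω` produce.

Extension. With common factors cancelled, both sides are continuous at admissible parameters. A
curve of exponentials with rationally independent rates passes through the given point, stays on the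
relation, and is generic outside a countable set of times, which has dense complement. -/

noncomputable section

namespace QGriffiths

/-! ### Generic parameters. -/

/-- No power `q^k`, `k ∈ ℤ`, is inverse to `c`. -/
def NotPow (q c : ℂ) : Prop := ∀ k : ℤ, 1 - c * q ^ k ≠ 0

/-- Genericity of the parameters of a univariate `q`-Racah polynomial. -/
structure Generic3 (q c1 c2 c3 : ℂ) : Prop where
  q_ne : q ≠ 0
  q_pow : ∀ k : ℤ, k ≠ 0 → 1 - q ^ k ≠ 0
  c1_ne : c1 ≠ 0
  c2_ne : c2 ≠ 0
  c3_ne : c3 ≠ 0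
  n1 : NotPow q c1
  n2 : NotPow q c2
  n3 : NotPow q c3
  n12 : NotPow q (c1 * c2)
  n23 : NotPow q (c2 * c3)
  n123 : NotPow q (c1 * c2 * c3)

theorem Generic3.swap {q c1 c2 c3 : ℂ} (g : Generic3 q c1 c2 c3) : Generic3 q c3 c2 c1 where
  q_ne := g.q_ne
  q_pow := g.q_pow
  c1_ne := g.c3_ne
  c2_ne := g.c2_ne
  c3_ne := g.c1_ne
  n1 := g.n3
  n2 := g.n2
  n3 := g.n1
  n12 := by rw [mul_comm]; exact g.n23
  n23 := by rw [mul_comm]; exact g.n12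
  n123 := by rw [show c3 * c2 * c1 = c1 * c2 * c3 by ring]; exact g.n123

theorem NotPow.ne {q c : ℂ} (h : NotPow q c) (k : ℤ) {t : ℂ} (ht : t = c * q ^ k) :
    1 - t ≠ 0 := ht ▸ h k

theorem one_sub_ne {q : ℂ} (h : ∀ k : ℤ, k ≠ 0 → 1 - q ^ k ≠ 0) (k : ℤ) (hk : k ≠ 0) {t : ℂ}
    (ht : t = q ^ k) : 1 - t ≠ 0 := ht ▸ h k hk

/-! ### The basis, the terminating series, and triangular operators. -/

theorem qPoch_zero (a q : ℂ) : qPoch a q 0 = 1 := by simp [qPoch]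

theorem qPoch_succ (a q : ℂ) (k : ℕ) : qPoch a q (k + 1) = qPoch a q k * (1 - a * q ^ k) := by
  simp [qPoch, Finset.prod_range_succ]

theorem qPoch_succ' (a q : ℂ) (k : ℕ) : qPoch a q (k + 1) = (1 - a) * qPoch (a * q) q k := by
  rw [qPoch, Finset.prod_range_succ', qPoch, mul_comm]
  simp [pow_succ', mul_assoc]

/-- The basis `(q^{-x};q)_k (cq^{x+1};q)_k` of the polynomials in `q^{-x} + c q^{x+1}`. -/
def rBasis (q c : ℂ) (k : ℕ) (x : ℤ) : ℂ :=
  qPoch (q ^ (-x)) q k * qPoch (c * q ^ (x + 1)) q k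

theorem rBasis_zero (q c : ℂ) (x : ℤ) : rBasis q c 0 x = 1 := by simp [rBasis, qPoch_zero]

theorem rBasis_succ {q : ℂ} (hq : q ≠ 0) (c : ℂ) (k : ℕ) (x : ℤ) :
    rBasis q c (k + 1) x =
      rBasis q c k x * ((1 - q ^ k / q ^ x) * (1 - c * q * q ^ x * q ^ k)) := by
  simp only [rBasis, qPoch_succ, zpow_neg, zpow_add_one₀ hq]
  ring

/-- Lowering `x` multiplies the base `q^{-x}` by `q` and divides the base `cq^{x+1}` by `q`. The
prefactor `1 - q^x` supplies the missing first factor of the former Pochhammer symbol, so everything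
becomes a multiple of the basis element of index `k` at `x`. -/
theorem rBasis_sub_one {q : ℂ} (hq : q ≠ 0) (c : ℂ) (k : ℕ) (x : ℤ) :
    (1 - q ^ x) * rBasis q c (k + 1) (x - 1) =
      -q ^ x * (rBasis q c k x * ((1 - c * q ^ x) * (1 - q ^ k / q ^ x) *
        (1 - q * q ^ k / q ^ x))) := by
  have h1 : (1 - q ^ (-x)) * qPoch (q ^ (-x) * q) q (k + 1) =
      qPoch (q ^ (-x)) q k * (1 - q ^ (-x) * q ^ k) * (1 - q ^ (-x) * q ^ (k + 1)) := by
    rw [← qPoch_succ', qPoch_succ, qPoch_succ]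
  have e1 : q ^ (-(x - 1)) = q ^ (-x) * q := by rw [neg_sub, sub_eq_neg_add, zpow_add_one₀ hq]
  have e2 : q ^ (x - 1 + 1) = q ^ x := by simp
  rw [rBasis, rBasis, e1, e2, qPoch_succ' (c * q ^ x), zpow_add_one₀ hq]
  have h2 : 1 - q ^ x = -q ^ x * (1 - q ^ (-x)) := by
    rw [zpow_neg]; field_simp; ring
  rw [h2]
  rw [show ∀ u v w z : ℂ, u * v * (w * z) = u * z * (v * w) by intros; ring, h1, zpow_neg,
    mul_assoc c]
  ring

/-- Mirror image of `rBasis_sub_one`: now the second Pochhammer symbol lacks its first factor, and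
`1 - cq^{x+1}` supplies it. -/
theorem rBasis_add_one {q : ℂ} (hq : q ≠ 0) (c : ℂ) (k : ℕ) (x : ℤ) :
    (1 - c * q * q ^ x) * rBasis q c (k + 1) (x + 1) =
      rBasis q c k x * ((1 - 1 / (q * q ^ x)) * (1 - c * q * q ^ x * q ^ k) *
        (1 - c * q ^ 2 * q ^ x * q ^ k)) := by
  have h1 : (1 - c * q ^ (x + 1)) * qPoch (c * q ^ (x + 1) * q) q (k + 1) =
      qPoch (c * q ^ (x + 1)) q k * (1 - c * q ^ (x + 1) * q ^ k) *
        (1 - c * q ^ (x + 1) * q ^ (k + 1)) := by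
    rw [← qPoch_succ', qPoch_succ, qPoch_succ]
  have e1 : q ^ (-(x + 1)) * q = q ^ (-x) := by
    rw [← zpow_add_one₀ hq]; congr 1; ring
  rw [rBasis, rBasis, qPoch_succ' (q ^ (-(x + 1))), e1]
  rw [show c * q ^ (x + 1 + 1) = c * q ^ (x + 1) * q by rw [zpow_add_one₀ hq (x + 1)]; ring]
  rw [show 1 - c * q * q ^ x = 1 - c * q ^ (x + 1) by rw [zpow_add_one₀ hq]; ring]
  rw [show ∀ u v w z : ℂ, u * (v * w * z) = u * z * (v * w) by intros; ring, h1, zpow_neg,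
    zpow_add_one₀ hq]
  field_simp
  ring

theorem rBasis_eq_zero {q : ℂ} (hq : q ≠ 0) (c : ℂ) {k : ℕ} {x : ℤ} (hx : 0 ≤ x) (h : x < k) :
    rBasis q c k x = 0 := by
  obtain ⟨n, rfl⟩ := Int.eq_ofNat_of_zero_le hx
  have : qPoch (q ^ (-(n : ℤ))) q k = 0 := by
    apply Finset.prod_eq_zero (Finset.mem_range.2 (by exact_mod_cast h : n < k))
    simp [hq]
  rw [rBasis, this, zero_mul]

/-- The coefficient of `rBasis` in the expansion of the series defining `q`-Racah polynomials. -/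
def rCoeff (q c1 c2 c3 : ℂ) (N a : ℤ) (k : ℕ) : ℂ :=
  rBasis q (c1 * c2) k a * q ^ k / (qPoch (q * c2) q k * qPoch (c1 * c2 * c3 * q ^ (N + 2)) q k *
    qPoch (q ^ (-N)) q k * qPoch q q k)

theorem rCoeff_succ {q c1 c2 c3 : ℂ} (g : Generic3 q c1 c2 c3) {N : ℤ} {a k : ℕ} (hk : k ≤ a)
    (ha : a ≤ N) :
    rCoeff q c1 c2 c3 N a (k + 1) * ((1 - c2 * q * q ^ k) *
      (1 - c1 * c2 * c3 * q ^ 2 * q ^ N * q ^ k) * (1 - q ^ k / q ^ N) * (1 - q * q ^ k)) =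
      rCoeff q c1 c2 c3 N a k *
        ((1 - q ^ k / q ^ (a : ℤ)) * (1 - c1 * c2 * q * q ^ (a : ℤ) * q ^ k) * q) := by
  have hq := g.q_ne
  -- At `k = N` the lower parameter `q^{-N}` gives a zero denominator; then `k = a = N`, and both
  -- sides contain a vanishing factor.
  rcases eq_or_ne (k : ℤ) N with rfl | hkN
  · obtain rfl : k = a := by omega
    simp [hq]
  have f1 : 1 - c2 * q * q ^ k ≠ 0 := g.n2.ne (k + 1) (by rw [zpow_add_one₀ hq, zpow_natCast]; ring)
  have f2 : 1 - c1 * c2 * c3 * q ^ 2 * q ^ N * q ^ k ≠ 0 :=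
    g.n123.ne (2 + N + k) (by rw [zpow_add₀ hq, zpow_add₀ hq, zpow_natCast, zpow_ofNat]; ring)
  have f3 : 1 - q * q ^ k ≠ 0 :=
    one_sub_ne g.q_pow (k + 1) (by omega) (by rw [zpow_add_one₀ hq, zpow_natCast]; ring)
  have f4 : 1 - q ^ k / q ^ N ≠ 0 :=
    one_sub_ne g.q_pow (k - N) (by omega) (by rw [zpow_sub₀ hq, zpow_natCast])
  have e : rCoeff q c1 c2 c3 N a (k + 1) = rCoeff q c1 c2 c3 N a k *
      ((1 - q ^ k / q ^ (a : ℤ)) * (1 - c1 * c2 * q * q ^ (a : ℤ) * q ^ k) * q /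
      ((1 - c2 * q * q ^ k) * (1 - c1 * c2 * c3 * q ^ 2 * q ^ N * q ^ k) * (1 - q ^ k / q ^ N) *
        (1 - q * q ^ k))) := by
    rw [rCoeff, rCoeff, rBasis_succ hq, div_mul_div_comm]
    simp only [qPoch_succ]
    rw [zpow_add₀ hq, zpow_neg, zpow_ofNat]
    congr 1
    · ring
    · ring
  rw [e, mul_assoc, div_mul_cancel₀ _ (mul_ne_zero (mul_ne_zero (mul_ne_zero f1 f2) f4) f3)]

/-- The terminating series in the definition of `racah`, with upper parameters `q^{-a}`,
`c₁c₂q^{a+1}`, `q^{-x}`, `c₂c₃q^{x+1}`. -/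
def rSeries (q c1 c2 c3 : ℂ) (N : ℤ) (a : ℕ) (x : ℤ) : ℂ :=
  ∑ k ∈ Finset.range (a + 1), rCoeff q c1 c2 c3 N a k * rBasis q (c2 * c3) k x

theorem rSeries_eq_phi43 (q c1 c2 c3 : ℂ) (N : ℤ) (a : ℕ) (x : ℤ) :
    rSeries q c1 c2 c3 N a x = phi43 q a (c2 * c1 * q ^ ((a : ℤ) + 1)) (q ^ (-x))
      (c3 * c2 * q ^ (x + 1)) (q * c2) (c3 * c2 * c1 * q ^ (N + 2)) (q ^ (-N)) := by
  refine Finset.sum_congr rfl fun k _ => ?_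
  rw [rCoeff, rBasis, rBasis, mul_comm c2 c1, mul_comm c3 c2,
    show c2 * c3 * c1 = c1 * c2 * c3 by ring, div_mul_div_comm, div_mul_eq_mul_div]
  congr 1 <;> ring

/-- Self-duality of the series: each term is symmetric, and both truncations may be replaced by the
common range up to `a + x` because the terms beyond them vanish. -/
theorem rSeries_comm {q : ℂ} (hq : q ≠ 0) (c1 c2 c3 : ℂ) (N : ℤ) (a x : ℕ) :
    rSeries q c1 c2 c3 N a x = rSeries q c3 c2 c1 N x a := by
  have key : ∀ (c1 c2 c3 : ℂ) (a x : ℕ), rSeries q c1 c2 c3 N a x =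
      ∑ k ∈ Finset.range (a + x + 1), rCoeff q c1 c2 c3 N a k * rBasis q (c2 * c3) k x := by
    intro c1 c2 c3 a x
    refine Finset.sum_subset (fun k hk => ?_) fun k _ hk => ?_
    · simp only [Finset.mem_range] at *; omega
    · simp only [Finset.mem_range] at hk
      rw [rCoeff, rBasis_eq_zero hq (c1 * c2) (Int.natCast_nonneg a) (by omega)]
      simp
  rw [key, key, add_comm x a]
  refine Finset.sum_congr rfl fun k _ => ?_
  rw [rCoeff, rCoeff, mul_comm c3 c2, mul_comm c2 c1, show c2 * c3 * c1 = c1 * c2 * c3 by ring]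
  ring

/-- Action of a difference operator that is triangular on `rBasis` on a terminating series. -/
theorem rSeries_op {q c1 c2 c3 : ℂ} (hq : q ≠ 0) {N N' x : ℤ} {a : ℕ} {Φ : ℤ → ℂ} {f : ℂ}
    (β γ : ℕ → ℂ)
    (h0 : Φ 1 + Φ 0 + Φ (-1) = β 0)
    (h : ∀ k, Φ 1 * rBasis q (c2 * c3) (k + 1) (x - 1) + Φ 0 * rBasis q (c2 * c3) (k + 1) x +
      Φ (-1) * rBasis q (c2 * c3) (k + 1) (x + 1) =
      β (k + 1) * rBasis q (c2 * c3) (k + 1) x + γ k * rBasis q (c2 * c3) k x)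
    (hF : ∀ k ≤ a, (rCoeff q c1 c2 c3 N a k * β k + rCoeff q c1 c2 c3 N a (k + 1) * γ k) *
      rBasis q (c2 * c3) k x = f * rCoeff q c1 c2 c3 N' a k * rBasis q (c2 * c3) k x) :
    Φ 1 * rSeries q c1 c2 c3 N a (x - 1) + Φ 0 * rSeries q c1 c2 c3 N a x +
      Φ (-1) * rSeries q c1 c2 c3 N a (x + 1) = f * rSeries q c1 c2 c3 N' a x := by
  have e : f * rSeries q c1 c2 c3 N' a x =
      ∑ k ∈ Finset.range (a + 1), rCoeff q c1 c2 c3 N a k * rBasis q (c2 * c3) k x * β k +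
      ∑ k ∈ Finset.range (a + 1), rCoeff q c1 c2 c3 N a (k + 1) * rBasis q (c2 * c3) k x *
        γ k := by
    rw [← Finset.sum_add_distrib, rSeries, Finset.mul_sum]
    refine Finset.sum_congr rfl fun k hk => ?_
    linear_combination -hF k (by simp at hk; omega)
  -- The coefficient one beyond the degree vanishes, so the index shift caused by the lower diagonal
  -- `γ` loses nothing at the top.
  have ea : rCoeff q c1 c2 c3 N a (a + 1) = 0 := by
    rw [rCoeff, rBasis_eq_zero hq _ (Int.natCast_nonneg a) (by push_cast; omega)]; simp
  have e2 : ∑ k ∈ Finset.range (a + 1), rCoeff q c1 c2 c3 N a k * rBasis q (c2 * c3) k x * β k =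
      ∑ k ∈ Finset.range a, rCoeff q c1 c2 c3 N a (k + 1) * rBasis q (c2 * c3) (k + 1) x *
        β (k + 1) + rCoeff q c1 c2 c3 N a 0 * β 0 := by
    rw [Finset.sum_range_succ', rBasis_zero, mul_one]
  rw [e, e2, Finset.sum_range_succ (fun k => _ * _ * γ k), ea]
  simp only [rSeries]
  rw [Finset.sum_range_succ', Finset.sum_range_succ' (n := a), Finset.sum_range_succ' (n := a)]
  simp only [rBasis_zero]
  have e3 : ∀ k, rCoeff q c1 c2 c3 N a (k + 1) * rBasis q (c2 * c3) (k + 1) x * β (k + 1) =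
      Φ 1 * (rCoeff q c1 c2 c3 N a (k + 1) * rBasis q (c2 * c3) (k + 1) (x - 1)) +
      Φ 0 * (rCoeff q c1 c2 c3 N a (k + 1) * rBasis q (c2 * c3) (k + 1) x) +
      Φ (-1) * (rCoeff q c1 c2 c3 N a (k + 1) * rBasis q (c2 * c3) (k + 1) (x + 1)) -
      rCoeff q c1 c2 c3 N a (k + 1) * rBasis q (c2 * c3) k x * γ k := by
    intro k
    linear_combination (-rCoeff q c1 c2 c3 N a (k + 1)) * h k
  simp only [e3, Finset.sum_sub_distrib, Finset.sum_add_distrib, ← Finset.mul_sum]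
  linear_combination (rCoeff q c1 c2 c3 N a 0) * h0

/-! ### Difference and contiguity equations of the series. -/

theorem Generic3.h_ne {q h c1 c2 c3 : ℂ} (g : Generic3 q c1 c2 c3) (hh : h ^ 2 = q * c2) :
    h ≠ 0 := by
  rintro rfl
  exact mul_ne_zero g.q_ne g.c2_ne (by rw [← hh]; ring)

/-- This closed form and its analogues below isolate the factor `1 - q^x` (upper coefficient) or `1
- c₂c₃q^{x+1}` (lower coefficient) that `rBasis_sub_one` and `rBasis_add_one` consume. -/
theorem Phi_one {q c1 c2 c3 : ℂ} (g : Generic3 q c1 c2 c3) (N x : ℤ) :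
    Phi q c1 c2 c3 N 1 x = -c2 * (q ^ x / q ^ N) * (1 - c1 * (q ^ N / q ^ x * q)) *
      (1 - c3 * q ^ x) * (1 - c2 * c3 * (q ^ x * q ^ N * q)) /
      ((1 - c2 * c3 * (q ^ x * q ^ x)) * (1 - c2 * c3 * (q ^ x * q ^ x * q))) * (1 - q ^ x) := by
  have hq := g.q_ne
  simp only [Phi, redQuot_eq (g.n23 _), if_true, two_mul, zpow_add₀ hq, zpow_sub₀ hq, zpow_one]
  field_simp

theorem Phi_neg_one {q c1 c2 c3 : ℂ} (g : Generic3 q c1 c2 c3) (N x : ℤ) :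
    Phi q c1 c2 c3 N (-1) x = (1 - q ^ x / q ^ N) *
      (1 - c1 * c2 * c3 * (q ^ x * q ^ N * q ^ 2)) * (1 - c2 * (q ^ x * q)) /
      ((1 - c2 * c3 * (q ^ x * q ^ x * q)) * (1 - c2 * c3 * (q ^ x * q ^ x * q ^ 2))) *
      (1 - c2 * c3 * q * q ^ x) := by
  have hq := g.q_ne
  simp only [Phi, redQuot_eq (g.n23 _), two_mul, zpow_add₀ hq, zpow_sub₀ hq, zpow_ofNat]
  norm_num
  field_simp

theorem Phi_zero (q c1 c2 c3 : ℂ) (N x : ℤ) :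
    Phi q c1 c2 c3 N 0 x = -Phi q c1 c2 c3 N 1 x - Phi q c1 c2 c3 N (-1) x - 0 := by
  simp [Phi]

theorem PhiPlus_one {q h c1 c2 c3 : ℂ} (g : Generic3 q c1 c2 c3) (hh : h ^ 2 = q * c2) (N x : ℤ) :
    PhiPlus q h c1 c2 c3 N 1 x = -c2 ^ 2 * (q ^ x * q ^ x / q ^ N) *
      (1 - c1 * (q ^ N / q ^ x * q)) * (1 - c1 * (q ^ N / q ^ x * q ^ 2)) * (1 - c3 * q ^ x) /
      (h * ((1 - c2 * c3 * (q ^ x * q ^ x)) * (1 - c2 * c3 * (q ^ x * q ^ x * q)))) *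
      (1 - q ^ x) := by
  have hq := g.q_ne
  have hh0 := g.h_ne hh
  simp only [PhiPlus, if_true, two_mul, zpow_add₀ hq, zpow_sub₀ hq, zpow_ofNat]
  field_simp
  rw [hh]
  ring

theorem PhiPlus_neg_one {q h c1 c2 c3 : ℂ} (g : Generic3 q c1 c2 c3) (hh : h ^ 2 = q * c2) (N x : ℤ) :
    PhiPlus q h c1 c2 c3 N (-1) x = -((1 - c1 * c2 * c3 * (q ^ x * q ^ N * q ^ 2)) *
      (1 - c1 * c2 * c3 * (q ^ x * q ^ N * q ^ 3)) * (1 - c2 * (q ^ x * q))) /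
      (c3 * (q ^ N * q) * h * ((1 - c2 * c3 * (q ^ x * q ^ x * q)) *
        (1 - c2 * c3 * (q ^ x * q ^ x * q ^ 2)))) * (1 - c2 * c3 * q * q ^ x) := by
  have hq := g.q_ne
  simp only [PhiPlus, redQuot_eq (g.n23 _), two_mul, zpow_add₀ hq, zpow_ofNat]
  norm_num
  field_simp

theorem PhiPlus_zero {q : ℂ} (hq : q ≠ 0) (h c1 c2 c3 : ℂ) (N x : ℤ) :
    PhiPlus q h c1 c2 c3 N 0 x = -PhiPlus q h c1 c2 c3 N 1 x -
      PhiPlus q h c1 c2 c3 N (-1) x - (1 - c1 * c2 * q ^ 2 * q ^ N) *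
        (1 - c1 * c2 * c3 * q ^ 2 * q ^ N) / (c3 * q * q ^ N * h) := by
  simp only [PhiPlus, zpow_add₀ hq N, zpow_ofNat]
  norm_num
  ring

theorem PhiMinus_one {q h c1 c2 c3 : ℂ} (g : Generic3 q c1 c2 c3) (N x : ℤ) :
    PhiMinus q h c2 c3 (N + 1) 1 x = -h * ((1 - c3 * q ^ x) *
      (1 - c2 * c3 * (q ^ x * (q ^ N * q))) * (1 - c2 * c3 * (q ^ x * (q ^ N * q) * q))) /
      (q ^ N * q * ((1 - c2 * c3 * (q ^ x * q ^ x)) * (1 - c2 * c3 * (q ^ x * q ^ x * q)))) *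
      (1 - q ^ x) := by
  have hq := g.q_ne
  simp only [PhiMinus, redQuot_eq (g.n23 _), if_true, two_mul, zpow_add₀ hq, zpow_one]
  field_simp

theorem PhiMinus_neg_one {q h c1 c2 c3 : ℂ} (g : Generic3 q c1 c2 c3) (N x : ℤ) :
    PhiMinus q h c2 c3 (N + 1) (-1) x = -c3 * h * (q ^ N * q) *
      ((1 - q ^ x / (q ^ N * q)) * (1 - q ^ x / q ^ N) * (1 - c2 * (q ^ x * q))) /
      ((1 - c2 * c3 * (q ^ x * q ^ x * q)) * (1 - c2 * c3 * (q ^ x * q ^ x * q ^ 2))) *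
      (1 - c2 * c3 * q * q ^ x) := by
  have hq := g.q_ne
  rw [PhiMinus, show x - (N + 1) + 1 = x - N by ring]
  simp only [redQuot_eq (g.n23 _), two_mul, zpow_add₀ hq, zpow_sub₀ hq, zpow_ofNat]
  norm_num
  field_simp

theorem PhiMinus_zero {q : ℂ} (hq : q ≠ 0) (h c2 c3 : ℂ) (N x : ℤ) :
    PhiMinus q h c2 c3 (N + 1) 0 x = -PhiMinus q h c2 c3 (N + 1) 1 x -
      PhiMinus q h c2 c3 (N + 1) (-1) x - h * (1 - c3 * q * q ^ N) * (1 / (q * q ^ N) - 1) := by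
  simp only [PhiMinus, zpow_neg, zpow_add_one₀ hq N]
  norm_num
  ring

/-- A second-order difference operator acts triangularly on `rBasis` if its coefficients satisfy a
rational identity. -/
theorem rBasis_op {q c p m κ β γ : ℂ} (hq : q ≠ 0) {k : ℕ} {x : ℤ} {Φ : ℤ → ℂ}
    (h1 : Φ 1 = p * (1 - q ^ x)) (h2 : Φ (-1) = m * (1 - c * q * q ^ x))
    (h0 : Φ 0 = -Φ 1 - Φ (-1) - κ)
    (h : p * (-q ^ x * ((1 - c * q ^ x) * (1 - q * q ^ k / q ^ x))) * (1 - q ^ k / q ^ x) +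
      m * ((1 - 1 / (q * q ^ x)) * (1 - c * q ^ 2 * q ^ x * q ^ k)) * (1 - c * q * q ^ x * q ^ k) -
      (p * (1 - q ^ x) + m * (1 - c * q * q ^ x)) *
        ((1 - q ^ k / q ^ x) * (1 - c * q * q ^ x * q ^ k)) =
      (β + κ) * ((1 - q ^ k / q ^ x) * (1 - c * q * q ^ x * q ^ k)) + γ) :
    Φ 1 * rBasis q c (k + 1) (x - 1) + Φ 0 * rBasis q c (k + 1) x +
      Φ (-1) * rBasis q c (k + 1) (x + 1) =
      β * rBasis q c (k + 1) x + γ * rBasis q c k x := by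
  rw [h0, h1, h2, rBasis_succ hq c k x]
  linear_combination p * rBasis_sub_one hq c k x + m * rBasis_add_one hq c k x +
    rBasis q c k x * h

/-- The difference equation of the terminating series. -/
theorem rSeries_diff {q c1 c2 c3 : ℂ} (g : Generic3 q c1 c2 c3) {N : ℤ} {a : ℕ} (x : ℤ)
    (ha : a ≤ N) :
    Phi q c1 c2 c3 N 1 x * rSeries q c1 c2 c3 N a (x - 1) +
      Phi q c1 c2 c3 N 0 x * rSeries q c1 c2 c3 N a x +
      Phi q c1 c2 c3 N (-1) x * rSeries q c1 c2 c3 N a (x + 1) =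
      eigen q (c1 * c2) a * rSeries q c1 c2 c3 N a x := by
  have hq := g.q_ne
  have hx : q ^ x ≠ 0 := zpow_ne_zero _ hq
  have hW : q ^ N ≠ 0 := zpow_ne_zero _ hq
  have hA : q ^ (a : ℤ) ≠ 0 := zpow_ne_zero _ hq
  have d0 : 1 - c2 * c3 * (q ^ x * q ^ x) ≠ 0 := g.n23.ne (x + x) (by rw [zpow_add₀ hq])
  have d1 : 1 - c2 * c3 * (q ^ x * q ^ x * q) ≠ 0 :=
    g.n23.ne (x + x + 1) (by rw [zpow_add_one₀ hq, zpow_add₀ hq])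
  have d2 : 1 - c2 * c3 * (q ^ x * q ^ x * q ^ 2) ≠ 0 :=
    g.n23.ne (x + x + 2) (by rw [zpow_add₀ hq, zpow_add₀ hq, zpow_ofNat])
  have e1 := Phi_one g N x
  have e2 := Phi_neg_one g N x
  have e0 := Phi_zero q c1 c2 c3 N x
  -- The diagonal entry `β k` is the eigenvalue at degree `k`.
  refine rSeries_op (Φ := fun e => Phi q c1 c2 c3 N e x) hq (fun k => -(1 - 1 / q ^ k) * (1 - c1 * c2 * q * q ^ k))
    (fun k => (1 - q ^ k / q ^ N) * (1 - c1 * c2 * c3 * q ^ 2 * q ^ N * q ^ k) *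
      (1 - c2 * q * q ^ k) * (1 - 1 / (q * q ^ k))) ?_ (fun k => ?_) (fun k hk => ?_)
  · simp only [e0]; simp; ring
  · refine rBasis_op (Φ := fun e => Phi q c1 c2 c3 N e x) hq e1 e2 e0 ?_
    have hQ : q ^ k ≠ 0 := pow_ne_zero _ hq
    rw [pow_succ q k]
    generalize q ^ x = X at *
    generalize q ^ N = W at *
    generalize q ^ k = Q at *
    clear e0 e1 e2
    -- Named denominators stay nonvanishing atoms while fractions are cleared; they are expanded
    -- only for the final polynomial identity.
    generalize hD0 : 1 - c2 * c3 * (X * X) = D0 at *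
    generalize hD1 : 1 - c2 * c3 * (X * X * q) = D1 at *
    generalize hD2 : 1 - c2 * c3 * (X * X * q ^ 2) = D2 at *
    field_simp
    subst hD0 hD1 hD2
    ring
  · have hQ : q ^ k ≠ 0 := pow_ne_zero _ hq
    have hs := rCoeff_succ g hk ha
    rw [eigen, zpow_neg, zpow_add_one₀ hq]
    congr 1
    generalize rCoeff q c1 c2 c3 N a (k + 1) = U at *
    generalize rCoeff q c1 c2 c3 N a k = V at *
    generalize q ^ x = X at *
    generalize q ^ N = W at *
    generalize q ^ k = Q at *
    generalize q ^ (a : ℤ) = A at *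
    -- The difference of the eigenvalues at degrees `k` and `a` factors into the numerator of the
    -- term ratio, divided by `q^{k+1}`.
    have : V * (-(1 - 1 / Q) * (1 - c1 * c2 * q * Q)) +
        V * ((1 - Q / A) * (1 - c1 * c2 * q * A * Q) * q) * (-1 / (q * Q)) =
        -(1 - A⁻¹) * (1 - c1 * c2 * (A * q)) * V := by
      field_simp
      ring
    rw [← this, ← hs]
    field_simp
    ring

theorem qPoch_ne_zero {a q : ℂ} {k : ℕ} (h : ∀ l < k, 1 - a * q ^ l ≠ 0) : qPoch a q k ≠ 0 :=
  Finset.prod_ne_zero_iff.2 fun l hl => h l (Finset.mem_range.1 hl)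

theorem qPoch_shift (a q : ℂ) (k : ℕ) :
    (1 - a) * qPoch (a * q) q k = qPoch a q k * (1 - a * q ^ k) := by
  rw [← qPoch_succ', qPoch_succ]

/-- Change of the degree bound in the coefficients of the series. -/
theorem rCoeff_bound_succ {q c1 c2 c3 : ℂ} (g : Generic3 q c1 c2 c3) {N : ℤ} (a : ℤ) {k : ℕ}
    (hk : k ≤ N) :
    rCoeff q c1 c2 c3 N a k * ((1 - c1 * c2 * c3 * q ^ 2 * q ^ N) * (1 - q ^ k / (q * q ^ N))) =
      rCoeff q c1 c2 c3 (N + 1) a k *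
        ((1 - c1 * c2 * c3 * q ^ 2 * q ^ N * q ^ k) * (1 - 1 / (q * q ^ N))) := by
  have hq := g.q_ne
  have n1 : qPoch (c1 * c2 * c3 * q ^ (N + 2)) q k ≠ 0 := qPoch_ne_zero fun l _ =>
    g.n123.ne (N + 2 + l) (by rw [zpow_add₀ hq (N + 2), zpow_natCast]; ring)
  have n2 : qPoch (c1 * c2 * c3 * q ^ (N + 1 + 2)) q k ≠ 0 := qPoch_ne_zero fun l _ =>
    g.n123.ne (N + 1 + 2 + l) (by rw [zpow_add₀ hq (N + 1 + 2), zpow_natCast]; ring)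
  have n3 : qPoch (q ^ (-N)) q k ≠ 0 := qPoch_ne_zero fun l hl =>
    one_sub_ne g.q_pow (-N + l) (by omega) (by rw [zpow_add₀ hq, zpow_natCast])
  have n4 : qPoch (q ^ (-(N + 1))) q k ≠ 0 := qPoch_ne_zero fun l hl =>
    one_sub_ne g.q_pow (-(N + 1) + l) (by omega) (by rw [zpow_add₀ hq (-(N + 1)), zpow_natCast])
  have h1 := qPoch_shift (c1 * c2 * c3 * q ^ (N + 2)) q k
  have h2 := qPoch_shift (q ^ (-(N + 1))) q k
  rw [show c1 * c2 * c3 * q ^ (N + 2) * q = c1 * c2 * c3 * q ^ (N + 1 + 2) by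
    rw [mul_assoc, ← zpow_add_one₀ hq]; ring_nf] at h1
  rw [show q ^ (-(N + 1)) * q = q ^ (-N) by rw [← zpow_add_one₀ hq]; ring_nf] at h2
  have m1 : 1 - c1 * c2 * c3 * q ^ (N + 2) ≠ 0 := g.n123 _
  have m2 : 1 - q ^ (-(N + 1)) ≠ 0 := g.q_pow _ (by omega)
  have m3 : 1 - c1 * c2 * c3 * q ^ (N + 2) * q ^ k ≠ 0 :=
    g.n123.ne (N + 2 + k) (by rw [zpow_add₀ hq (N + 2), zpow_natCast]; ring)
  have m4 : 1 - q ^ (-(N + 1)) * q ^ k ≠ 0 :=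
    one_sub_ne g.q_pow (-(N + 1) + k) (by omega) (by rw [zpow_add₀ hq (-(N + 1)), zpow_natCast])
  have E1 : c1 * c2 * c3 * q ^ 2 * q ^ N = c1 * c2 * c3 * q ^ (N + 2) := by
    rw [zpow_add₀ hq, zpow_ofNat]; ring
  have E2 : q ^ k / (q * q ^ N) = q ^ (-(N + 1)) * q ^ k := by
    rw [zpow_neg, zpow_add_one₀ hq]; field_simp
  have E3 : 1 / (q * q ^ N) = q ^ (-(N + 1)) := by
    rw [zpow_neg, zpow_add_one₀ hq]; field_simp
  rw [E1, E2, E3, rCoeff, rCoeff]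
  have r1 : qPoch (c1 * c2 * c3 * q ^ (N + 1 + 2)) q k =
      qPoch (c1 * c2 * c3 * q ^ (N + 2)) q k * (1 - c1 * c2 * c3 * q ^ (N + 2) * q ^ k) /
        (1 - c1 * c2 * c3 * q ^ (N + 2)) := by rw [eq_div_iff m1, ← h1]; ring
  have r2 : qPoch (q ^ (-N)) q k =
      qPoch (q ^ (-(N + 1))) q k * (1 - q ^ (-(N + 1)) * q ^ k) /
        (1 - q ^ (-(N + 1))) := by rw [eq_div_iff m2, ← h2]; ring
  rw [r1, r2]
  generalize 1 - c1 * c2 * c3 * q ^ (N + 2) * q ^ k = d1 at *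
  generalize 1 - q ^ (-(N + 1)) * q ^ k = d2 at *
  generalize 1 - c1 * c2 * c3 * q ^ (N + 2) = d3 at *
  generalize 1 - q ^ (-(N + 1)) = d4 at *
  field_simp

/-- Contiguity relation of the terminating series raising the degree bound. -/
theorem rSeries_plus {q h c1 c2 c3 : ℂ} (g : Generic3 q c1 c2 c3) (hh : h ^ 2 = q * c2)
    {N : ℤ} {a : ℕ} {x : ℤ} (ha : a ≤ N + 1) (hx0 : 0 ≤ x) (hxN : x ≤ N) :
    PhiPlus q h c1 c2 c3 N 1 x * rSeries q c1 c2 c3 (N + 1) a (x - 1) +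
      PhiPlus q h c1 c2 c3 N 0 x * rSeries q c1 c2 c3 (N + 1) a x +
      PhiPlus q h c1 c2 c3 N (-1) x * rSeries q c1 c2 c3 (N + 1) a (x + 1) =
      -((1 - q * q ^ N / q ^ (a : ℤ)) * (1 - c1 * c2 * q ^ 2 * q ^ (a : ℤ) * q ^ N) *
        (1 - c1 * c2 * c3 * q ^ 2 * q ^ N)) / (c3 * q * q ^ N * h * (1 - q * q ^ N)) *
        rSeries q c1 c2 c3 N a x := by
  have hq := g.q_ne
  have hc3 := g.c3_ne
  have hx : q ^ x ≠ 0 := zpow_ne_zero _ hq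
  have hW : q ^ N ≠ 0 := zpow_ne_zero _ hq
  have hA : q ^ (a : ℤ) ≠ 0 := zpow_ne_zero _ hq
  have d0 : 1 - c2 * c3 * (q ^ x * q ^ x) ≠ 0 := g.n23.ne (x + x) (by rw [zpow_add₀ hq])
  have d1 : 1 - c2 * c3 * (q ^ x * q ^ x * q) ≠ 0 :=
    g.n23.ne (x + x + 1) (by rw [zpow_add_one₀ hq, zpow_add₀ hq])
  have d2 : 1 - c2 * c3 * (q ^ x * q ^ x * q ^ 2) ≠ 0 :=
    g.n23.ne (x + x + 2) (by rw [zpow_add₀ hq, zpow_add₀ hq, zpow_ofNat])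
  have e1 := PhiPlus_one g hh N x
  have e2 := PhiPlus_neg_one g hh N x
  have e0 := PhiPlus_zero hq h c1 c2 c3 N x
  refine rSeries_op (Φ := fun e => PhiPlus q h c1 c2 c3 N e x) hq
    (fun k => -((1 - c1 * c2 * q ^ 2 * q ^ N * q ^ k) *
      (1 - c1 * c2 * c3 * q ^ 2 * q ^ N * q ^ k)) / (q ^ k * c3 * q * q ^ N * h))
    (fun k => -((1 - 1 / (q * q ^ k)) * (1 - c1 * c2 * c3 * q ^ 2 * q ^ N * q ^ k) *
      (1 - c1 * c2 * c3 * q ^ 3 * q ^ N * q ^ k) * (1 - c2 * q * q ^ k)) / (c3 * q * q ^ N * h))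
    ?_ (fun k => ?_) (fun k hk => ?_)
  · simp only [e0]
    field_simp
    ring
  · refine rBasis_op (Φ := fun e => PhiPlus q h c1 c2 c3 N e x) hq e1 e2 e0 ?_
    have hQ : q ^ k ≠ 0 := pow_ne_zero _ hq
    rw [pow_succ q k]
    generalize q ^ x = X at *
    generalize q ^ N = W at *
    generalize q ^ k = Q at *
    clear e0 e1 e2 hh
    generalize hD0 : 1 - c2 * c3 * (X * X) = D0 at *
    generalize hD1 : 1 - c2 * c3 * (X * X * q) = D1 at *
    generalize hD2 : 1 - c2 * c3 * (X * X * q ^ 2) = D2 at *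
    field_simp
    subst hD0 hD1 hD2
    ring
  -- For `k = N + 1` the coefficients with bound `N` are meaningless, but the basis element vanishes
  -- on `0 ≤ x ≤ N`. This is where the range of `x` enters.
  · rcases eq_or_ne (k : ℤ) (N + 1) with hkN | hkN
    · rw [rBasis_eq_zero hq _ hx0 (by omega)]; simp
    congr 1
    have hQ : q ^ k ≠ 0 := pow_ne_zero _ hq
    have hs := rCoeff_succ g hk ha
    have hb := rCoeff_bound_succ g a (N := N) (k := k) (by omega)
    have m1 : 1 - q ^ k / (q * q ^ N) ≠ 0 := one_sub_ne g.q_pow (k - (1 + N)) (by omega)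
      (by rw [zpow_sub₀ hq, zpow_natCast, zpow_add₀ hq, zpow_one])
    have m2 : 1 - q * q ^ N ≠ 0 := one_sub_ne g.q_pow (1 + N) (by omega)
      (by rw [zpow_add₀ hq, zpow_one])
    rw [zpow_add_one₀ hq] at hs
    refine mul_right_cancel₀ m1 ?_
    clear d0 d1 d2 e0 e1 e2
    generalize rCoeff q c1 c2 c3 (N + 1) a (k + 1) = U at *
    generalize rCoeff q c1 c2 c3 (N + 1) a k = V at *
    generalize rCoeff q c1 c2 c3 N a k = V' at *
    generalize q ^ x = X at *
    generalize q ^ N = W at *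
    generalize q ^ k = Q at *
    generalize q ^ (a : ℤ) = A at *
    -- The multiple of `hs` removes the coefficient of index `k + 1`, and that of `hb` trades the
    -- bound `N` for `N + 1`.
    linear_combination (norm := skip)
      (1 - c1 * c2 * c3 * q ^ 2 * Q * W) / (q * Q * c3 * q * W * h) * hs +
      (1 - q * W / A) * (1 - c1 * c2 * A * q ^ 2 * W) / (c3 * q * W * h * (1 - q * W)) * hb
    clear hs hb hh
    field_simp
    ring

/-- Contiguity relation of the terminating series lowering the degree bound. -/
theorem rSeries_minus {q h c1 c2 c3 : ℂ} (g : Generic3 q c1 c2 c3) {N : ℤ} {a : ℕ} (x : ℤ)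
    (ha : a ≤ N) :
    PhiMinus q h c2 c3 (N + 1) 1 x * rSeries q c1 c2 c3 N a (x - 1) +
      PhiMinus q h c2 c3 (N + 1) 0 x * rSeries q c1 c2 c3 N a x +
      PhiMinus q h c2 c3 (N + 1) (-1) x * rSeries q c1 c2 c3 N a (x + 1) =
      h * ((1 - c3 * q * q ^ N / q ^ (a : ℤ)) * (1 - c1 * c2 * c3 * q ^ 2 * q ^ (a : ℤ) * q ^ N) *
        (1 - 1 / (q * q ^ N))) / (1 - c1 * c2 * c3 * q ^ 2 * q ^ N) *
        rSeries q c1 c2 c3 (N + 1) a x := by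
  have hq := g.q_ne
  have hx : q ^ x ≠ 0 := zpow_ne_zero _ hq
  have hW : q ^ N ≠ 0 := zpow_ne_zero _ hq
  have hA : q ^ (a : ℤ) ≠ 0 := zpow_ne_zero _ hq
  have d0 : 1 - c2 * c3 * (q ^ x * q ^ x) ≠ 0 := g.n23.ne (x + x) (by rw [zpow_add₀ hq])
  have d1 : 1 - c2 * c3 * (q ^ x * q ^ x * q) ≠ 0 :=
    g.n23.ne (x + x + 1) (by rw [zpow_add_one₀ hq, zpow_add₀ hq])
  have d2 : 1 - c2 * c3 * (q ^ x * q ^ x * q ^ 2) ≠ 0 :=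
    g.n23.ne (x + x + 2) (by rw [zpow_add₀ hq, zpow_add₀ hq, zpow_ofNat])
  have e1 := PhiMinus_one (h := h) g N x
  have e2 := PhiMinus_neg_one (h := h) g N x
  have e0 := PhiMinus_zero hq h c2 c3 N x
  refine rSeries_op (Φ := fun e => PhiMinus q h c2 c3 (N + 1) e x) hq
    (fun k => -h * ((q ^ k / (q * q ^ N) - 1) * (1 - c3 * q * q ^ N / q ^ k)))
    (fun k => -c3 * h * q * q ^ N * ((1 - q ^ k / (q * q ^ N)) * (1 - q ^ k / q ^ N) *
      (1 - c2 * q * q ^ k) * (1 - 1 / (q * q ^ k)))) ?_ (fun k => ?_) (fun k hk => ?_)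
  · simp only [e0]
    ring
  · refine rBasis_op (Φ := fun e => PhiMinus q h c2 c3 (N + 1) e x) hq e1 e2 e0 ?_
    have hQ : q ^ k ≠ 0 := pow_ne_zero _ hq
    rw [pow_succ q k]
    generalize q ^ x = X at *
    generalize q ^ N = W at *
    generalize q ^ k = Q at *
    clear e0 e1 e2
    generalize hD0 : 1 - c2 * c3 * (X * X) = D0 at *
    generalize hD1 : 1 - c2 * c3 * (X * X * q) = D1 at *
    generalize hD2 : 1 - c2 * c3 * (X * X * q ^ 2) = D2 at *
    field_simp
    subst hD0 hD1 hD2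
    ring
  · congr 1
    have hQ : q ^ k ≠ 0 := pow_ne_zero _ hq
    have hs := rCoeff_succ g hk ha
    have hb := rCoeff_bound_succ g a (N := N) (k := k) (by omega)
    have m1 : 1 - c1 * c2 * c3 * q ^ 2 * q ^ N * q ^ k ≠ 0 :=
      g.n123.ne (2 + N + k) (by rw [zpow_add₀ hq, zpow_add₀ hq, zpow_natCast, zpow_ofNat]; ring)
    have m2 : 1 - c1 * c2 * c3 * q ^ 2 * q ^ N ≠ 0 :=
      g.n123.ne (2 + N) (by rw [zpow_add₀ hq, zpow_ofNat]; ring)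
    refine mul_right_cancel₀ m1 ?_
    clear d0 d1 d2 e0 e1 e2
    generalize rCoeff q c1 c2 c3 (N + 1) a k = V' at *
    generalize rCoeff q c1 c2 c3 N a (k + 1) = U at *
    generalize rCoeff q c1 c2 c3 N a k = V at *
    generalize q ^ x = X at *
    generalize q ^ N = W at *
    generalize q ^ k = Q at *
    generalize q ^ (a : ℤ) = A at *
    -- As in `rSeries_plus`: `hs` eliminates index `k + 1`, and `hb` changes the bound.
    linear_combination (norm := skip)
      c3 * h * q * W * (1 - Q / (q * W)) / (q * Q) * hs +
      h * ((1 - c3 * q * W / A) * (1 - c1 * c2 * c3 * q ^ 2 * A * W)) /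
        (1 - c1 * c2 * c3 * q ^ 2 * W) * hb
    clear hs hb
    generalize hD : 1 - c1 * c2 * c3 * q ^ 2 * W = D at *
    field_simp
    subst hD
    ring

/-! ### The normalization and adjointness. -/

/-- For generic parameters the cancelled factor `1 - c₂c₃q^{2n+1}` can be restored; with a full
Pochhammer symbol in the denominator, ratios of `Ω` reduce to shifts of such symbols. -/
theorem Omega_eq {q h c1 c2 c3 : ℂ} (g : Generic3 q c1 c2 c3) {N n : ℕ} (hn : n ≤ N) :
    Omega q h c1 c2 c3 N n = qBinom q N n *
      (qPoch (q * c2) q n * qPoch (c1 * c2 * c3 * q ^ (N + 2)) q n * qPoch (q * c1) q (N - n)) *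
      (1 - c2 * c3 * q ^ (n + 1) * q ^ n) /
      ((q * c2) ^ n / h ^ N * qPoch (c2 * c3 * q ^ (n + 1)) q (N + 1) * qPoch (q * c3) q n) := by
  have hm : 1 - c2 * c3 * q ^ (n + 1) * q ^ n ≠ 0 :=
    g.n23.ne (n + 1 + n : ℕ) (by rw [zpow_natCast]; ring)
  rw [Omega, qPoch.eq_1 (c2 * c3 * q ^ (n + 1)), ← Finset.mul_prod_erase _ _
    (Finset.mem_range.2 (by omega : n < N + 1))]
  generalize 1 - c2 * c3 * q ^ (n + 1) * q ^ n = m at *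
  rw [show ∀ u v w : ℂ, u * (m * v) * w = (u * v * w) * m by intros; ring]
  exact (mul_div_mul_right _ _ hm).symm

theorem qPoch_q_ne_zero {q : ℂ} (h : ∀ k : ℤ, k ≠ 0 → 1 - q ^ k ≠ 0) (k : ℕ) :
    qPoch q q k ≠ 0 := qPoch_ne_zero fun l _ =>
  one_sub_ne h (l + 1 : ℕ) (by positivity) (by rw [zpow_natCast, pow_succ'])

theorem NotPow.qPoch_ne_zero {q c : ℂ} (hc : NotPow q c) (m k : ℕ) :
    qPoch (c * q ^ m) q k ≠ 0 := QGriffiths.qPoch_ne_zero fun l _ =>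
  hc.ne (m + l : ℕ) (by rw [zpow_natCast]; ring)

theorem NotPow.qPoch_ne_zero' {q c : ℂ} (hc : NotPow q c) (k : ℕ) :
    qPoch (q * c) q k ≠ 0 := by
  simpa [mul_comm] using hc.qPoch_ne_zero 1 k

/-- The ratios of `Ω` in the bound (here) and in the degree (`Omega_succ`) carry all the adjointness
relations below. They are cross-multiplied so that no quotient appears. -/
theorem Omega_bound_succ {q h c1 c2 c3 : ℂ} (g : Generic3 q c1 c2 c3) (hh : h ^ 2 = q * c2)
    {N n : ℕ} (hn : n ≤ N) :
    Omega q h c1 c2 c3 (N + 1) n * ((1 - q * q ^ N / q ^ n) * (1 - c1 * c2 * c3 * q ^ 2 * q ^ N) *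
      (1 - c2 * c3 * q ^ 2 * q ^ n * q ^ N)) =
    Omega q h c1 c2 c3 N n * (h * (1 - q * q ^ N) * (1 - c1 * c2 * c3 * q ^ 2 * q ^ N * q ^ n) *
      (1 - c1 * q * q ^ N / q ^ n)) := by
  have hq := g.q_ne
  have hc2 := g.c2_ne
  have eN : N + 1 - n = (N - n) + 1 := by omega
  have e1 : q * q ^ N / q ^ n = q * q ^ (N - n) := by
    rw [mul_div_assoc, pow_sub₀ _ hq hn, div_eq_mul_inv]
  have e2 : c1 * q * q ^ N / q ^ n = q * c1 * q ^ (N - n) := by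
    rw [mul_assoc, mul_div_assoc, e1]; ring
  have m1 : 1 - q * q ^ (N - n) ≠ 0 := one_sub_ne g.q_pow (N - n + 1 : ℕ) (by positivity)
    (by rw [zpow_natCast, pow_succ'])
  have m2 : 1 - c1 * c2 * c3 * q ^ (N + 2) ≠ 0 :=
    g.n123.ne (N + 2 : ℕ) (by rw [zpow_natCast])
  have s1 := qPoch_shift (c1 * c2 * c3 * q ^ (N + 2)) q n
  rw [show c1 * c2 * c3 * q ^ (N + 2) * q = c1 * c2 * c3 * q ^ (N + 1 + 2) by ring] at s1
  have n1 := qPoch_q_ne_zero g.q_pow n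
  have n2 := qPoch_q_ne_zero g.q_pow (N - n)
  have n3 := g.n3.qPoch_ne_zero' n
  have n4 := g.n23.qPoch_ne_zero (n + 1) (N + 1)
  have m3 : 1 - c2 * c3 * q ^ (n + 1) * q ^ (N + 1) ≠ 0 :=
    g.n23.ne (n + 1 + (N + 1) : ℕ) (by rw [zpow_natCast]; ring)
  rw [Omega_eq g hn, Omega_eq g (by omega : n ≤ N + 1), qBinom, qBinom, eN, qPoch_succ _ _ (N - n),
    qPoch_succ _ _ (N - n), qPoch_succ q q N, qPoch_succ _ _ (N + 1), e1, e2,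
    show c1 * c2 * c3 * q ^ 2 * q ^ N = c1 * c2 * c3 * q ^ (N + 2) by ring,
    show c2 * c3 * q ^ 2 * q ^ n * q ^ N = c2 * c3 * q ^ (n + 1) * q ^ (N + 1) by ring,
    pow_succ h N]
  generalize 1 - q * q ^ (N - n) = M1 at *
  generalize 1 - c1 * c2 * c3 * q ^ (N + 2) = M2 at *
  generalize 1 - c2 * c3 * q ^ (n + 1) * q ^ (N + 1) = M3 at *
  rw [mul_comm, ← eq_div_iff m2] at s1
  rw [s1]
  generalize qPoch (c1 * c2 * c3 * q ^ (N + 2)) q n = T at *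
  generalize qPoch (c2 * c3 * q ^ (n + 1)) q (N + 1) = T' at *
  field_simp

theorem Omega_succ {q h c1 c2 c3 : ℂ} (g : Generic3 q c1 c2 c3) (hh : h ^ 2 = q * c2)
    {N n : ℕ} (hn : n + 1 ≤ N) :
    Omega q h c1 c2 c3 N (n + 1) * ((1 - q * q ^ n) * (1 - c1 * q ^ N / q ^ n) * (q * c2) *
      (1 - c3 * q * q ^ n) * (1 - c2 * c3 * q * q ^ n * q ^ n) *
      (1 - c2 * c3 * q ^ 2 * q ^ n * q ^ N)) =
    Omega q h c1 c2 c3 N n * ((1 - q ^ N / q ^ n) * (1 - c2 * q * q ^ n) *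
      (1 - c1 * c2 * c3 * q ^ 2 * q ^ N * q ^ n) * (1 - c2 * c3 * q ^ 3 * q ^ n * q ^ n) *
      (1 - c2 * c3 * q * q ^ n)) := by
  have hq := g.q_ne
  have hc2 := g.c2_ne
  obtain ⟨d, rfl⟩ := Nat.exists_eq_add_of_le hn
  have e0 : n + 1 + d - n = d + 1 := by omega
  have e0' : n + 1 + d - (n + 1) = d := by omega
  have e1 : q ^ (n + 1 + d) / q ^ n = q * q ^ d := by
    rw [pow_add, pow_succ]; field_simp
  have n1 := qPoch_q_ne_zero g.q_pow n
  have n2 := qPoch_q_ne_zero g.q_pow d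
  have n3 := g.n3.qPoch_ne_zero' n
  have n4 := g.n23.qPoch_ne_zero (n + 1) (n + 1 + d + 1)
  have n5 := g.n23.qPoch_ne_zero (n + 1 + 1) (n + 1 + d + 1)
  have s1 := qPoch_shift (c2 * c3 * q ^ (n + 1)) q (n + 1 + d + 1)
  rw [show c2 * c3 * q ^ (n + 1) * q = c2 * c3 * q ^ (n + 1 + 1) by ring] at s1
  have m1 : 1 - q * q ^ n ≠ 0 := one_sub_ne g.q_pow (n + 1 : ℕ) (by positivity)
    (by rw [zpow_natCast, pow_succ'])
  have m2 : 1 - q * q ^ d ≠ 0 := one_sub_ne g.q_pow (d + 1 : ℕ) (by positivity)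
    (by rw [zpow_natCast, pow_succ'])
  have m3 : 1 - q * c3 * q ^ n ≠ 0 := g.n3.ne (n + 1 : ℕ) (by rw [zpow_natCast]; ring)
  rw [Omega_eq g hn, Omega_eq g (by omega : n ≤ n + 1 + d), qBinom, qBinom, e0, e0',
    qPoch_succ _ _ d, qPoch_succ _ _ d, qPoch_succ _ _ n, qPoch_succ _ _ n, qPoch_succ _ _ n,
    qPoch_succ _ _ n, mul_div_assoc c1, e1, pow_succ (q * c2) n,
    show c3 * q * q ^ n = q * c3 * q ^ n by ring]
  generalize 1 - q * q ^ n = M1 at *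
  generalize 1 - q * q ^ d = M2 at *
  generalize 1 - q * c3 * q ^ n = M3 at *
  have m4 : 1 - c2 * c3 * q ^ (n + 1) ≠ 0 := g.n23.ne (n + 1 : ℕ) (by rw [zpow_natCast])
  have m5 : 1 - c2 * c3 * q ^ (n + 1) * q ^ (n + 1 + d + 1) ≠ 0 :=
    g.n23.ne (n + 1 + (n + 1 + d + 1) : ℕ) (by rw [zpow_natCast]; ring)
  rw [mul_comm, ← eq_div_iff m4] at s1
  rw [s1, show c2 * c3 * q * q ^ n = c2 * c3 * q ^ (n + 1) by ring,
    show c2 * c3 * q ^ 2 * q ^ n * q ^ (n + 1 + d) =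
      c2 * c3 * q ^ (n + 1) * q ^ (n + 1 + d + 1) by ring]
  generalize 1 - c2 * c3 * q ^ (n + 1) = M4 at *
  generalize 1 - c2 * c3 * q ^ (n + 1) * q ^ (n + 1 + d + 1) = M5 at *
  generalize qPoch (c2 * c3 * q ^ (n + 1)) q (n + 1 + d + 1) = T at *
  generalize qPoch (q * c3) q n = T3 at *
  field_simp
  ring

/-- The normalization makes the operator with coefficients `Phi` symmetric. -/
theorem Omega_mul_Phi {q h c1 c2 c3 : ℂ} (g : Generic3 q c1 c2 c3) (hh : h ^ 2 = q * c2)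
    {N n : ℕ} (hn : n + 1 ≤ N) :
    Omega q h c1 c2 c3 N n * Phi q c1 c2 c3 N (-1) n =
      Omega q h c1 c2 c3 N (n + 1) * Phi q c1 c2 c3 N 1 (n + 1) := by
  have hq := g.q_ne
  have hs := Omega_succ g hh hn
  have hW : q ^ N ≠ 0 := pow_ne_zero _ hq
  have hA : q ^ n ≠ 0 := pow_ne_zero _ hq
  have d1 : 1 - c2 * c3 * q * q ^ n * q ^ n ≠ 0 :=
    g.n23.ne (n + 1 + n : ℕ) (by rw [zpow_natCast]; ring)
  have d3 : 1 - c2 * c3 * q ^ 3 * q ^ n * q ^ n ≠ 0 :=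
    g.n23.ne (n + 3 + n : ℕ) (by rw [zpow_natCast]; ring)
  rw [Phi_one g, Phi_neg_one g, zpow_add_one₀ hq, zpow_natCast, zpow_natCast,
    show c2 * c3 * (q ^ n * q ^ n * q) = c2 * c3 * q * q ^ n * q ^ n by ring,
    show c2 * c3 * (q ^ n * q ^ n * q ^ 2) = c2 * c3 * q ^ 2 * q ^ n * q ^ n by ring,
    show c2 * c3 * (q ^ n * q * (q ^ n * q)) = c2 * c3 * q ^ 2 * q ^ n * q ^ n by ring,
    show c2 * c3 * (q ^ n * q * (q ^ n * q) * q) = c2 * c3 * q ^ 3 * q ^ n * q ^ n by ring]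
  generalize Omega q h c1 c2 c3 N (n + 1) = O' at *
  generalize Omega q h c1 c2 c3 N n = O at *
  generalize q ^ n = A at *
  generalize q ^ N = W at *
  generalize hD1 : 1 - c2 * c3 * q * A * A = D1 at *
  generalize hD2 : 1 - c2 * c3 * q ^ 2 * A * A = D2 at *
  generalize hD3 : 1 - c2 * c3 * q ^ 3 * A * A = D3 at *
  linear_combination (norm := skip) A / (W * D2 * D3 * D1) * hs
  clear hs
  field_simp
  ring

/-- Diagonal part of the adjointness of `Φ_+` and `Φ_-`. Both coefficients are defined as
complements of other terms, yet their ratio is a product of linear factors, the same ones that occur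
in `Omega_bound_succ`. -/
theorem PhiPlus_zero_mul {q h c1 c2 c3 : ℂ} (g : Generic3 q c1 c2 c3) (hh : h ^ 2 = q * c2)
    (N x : ℤ) :
    PhiPlus q h c1 c2 c3 N 0 x * (c3 * (1 - q * q ^ N / q ^ x) *
      (1 - c2 * c3 * q ^ 2 * q ^ x * q ^ N)) =
    PhiMinus q h c2 c3 (N + 1) 0 x * ((1 - c1 * c2 * c3 * q ^ 2 * q ^ N * q ^ x) *
      (1 - c1 * q * q ^ N / q ^ x)) := by
  have hq := g.q_ne
  have hc3 := g.c3_ne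
  have hh0 := g.h_ne hh
  have hx : q ^ x ≠ 0 := zpow_ne_zero _ hq
  have hW : q ^ N ≠ 0 := zpow_ne_zero _ hq
  have d0 : 1 - c2 * c3 * (q ^ x * q ^ x) ≠ 0 := g.n23.ne (x + x) (by rw [zpow_add₀ hq])
  have d1 : 1 - c2 * c3 * (q ^ x * q ^ x * q) ≠ 0 :=
    g.n23.ne (x + x + 1) (by rw [zpow_add_one₀ hq, zpow_add₀ hq])
  have d2 : 1 - c2 * c3 * (q ^ x * q ^ x * q ^ 2) ≠ 0 :=
    g.n23.ne (x + x + 2) (by rw [zpow_add₀ hq, zpow_add₀ hq, zpow_ofNat])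
  rw [PhiPlus_zero hq, PhiMinus_zero hq, PhiPlus_one g hh, PhiPlus_neg_one g hh,
    PhiMinus_one (h := h) g, PhiMinus_neg_one (h := h) g]
  generalize q ^ x = X at *
  generalize q ^ N = W at *
  generalize hD0 : 1 - c2 * c3 * (X * X) = D0 at *
  generalize hD1 : 1 - c2 * c3 * (X * X * q) = D1 at *
  generalize hD2 : 1 - c2 * c3 * (X * X * q ^ 2) = D2 at *
  field_simp
  rw [hh]
  subst hD0 hD1 hD2
  ring

/-- Together with the next two lemmas: with weights `Ω(·;N)` and `Ω(·;N+1)` the matrices of `Φ_+`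
and `Φ_-` are transposes of each other, up to factors that do not depend on `n`. -/
theorem Omega_mul_PhiPlus_zero {q h c1 c2 c3 : ℂ} (g : Generic3 q c1 c2 c3) (hh : h ^ 2 = q * c2)
    {N n : ℕ} (hn : n ≤ N) :
    Omega q h c1 c2 c3 N n * PhiPlus q h c1 c2 c3 N 0 n * (c3 * h * (1 - q * q ^ N)) =
    Omega q h c1 c2 c3 (N + 1) n * PhiMinus q h c2 c3 (N + 1) 0 n *
      (1 - c1 * c2 * c3 * q ^ 2 * q ^ N) := by
  have hq := g.q_ne
  have hb := Omega_bound_succ g hh hn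
  have hz := PhiPlus_zero_mul g hh N n
  have m1 : 1 - q * q ^ N / q ^ n ≠ 0 := one_sub_ne g.q_pow (1 + N - n) (by omega)
    (by rw [zpow_sub₀ hq, zpow_add₀ hq]; simp)
  have m2 : 1 - c2 * c3 * q ^ 2 * q ^ n * q ^ N ≠ 0 :=
    g.n23.ne (2 + n + N : ℕ) (by rw [zpow_natCast]; ring)
  simp only [zpow_natCast] at hz
  refine mul_right_cancel₀ (mul_ne_zero m1 m2) ?_
  linear_combination Omega q h c1 c2 c3 N n * (h * (1 - q * q ^ N)) * hz -
    PhiMinus q h c2 c3 (N + 1) 0 n * hb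

theorem Omega_mul_PhiPlus_neg_one {q h c1 c2 c3 : ℂ} (g : Generic3 q c1 c2 c3)
    (hh : h ^ 2 = q * c2) {N n : ℕ} (hn : n ≤ N) :
    Omega q h c1 c2 c3 N n * PhiPlus q h c1 c2 c3 N (-1) n * (c3 * h * (1 - q * q ^ N)) =
    Omega q h c1 c2 c3 (N + 1) (n + 1) * PhiMinus q h c2 c3 (N + 1) 1 (n + 1) *
      (1 - c1 * c2 * c3 * q ^ 2 * q ^ N) := by
  have hq := g.q_ne
  have hc3 := g.c3_ne
  have hh0 := g.h_ne hh
  have hb := Omega_bound_succ g hh hn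
  have hs := Omega_succ g hh (by omega : n + 1 ≤ N + 1)
  have m1 : 1 - q * q ^ N / q ^ n ≠ 0 := one_sub_ne g.q_pow (1 + N - n) (by omega)
    (by rw [zpow_sub₀ hq, zpow_add₀ hq]; simp)
  have m2 : 1 - c2 * c3 * q ^ 2 * q ^ n * q ^ N ≠ 0 :=
    g.n23.ne (2 + n + N : ℕ) (by rw [zpow_natCast]; ring)
  have m3 : 1 - c1 * (q ^ N * q) / q ^ n ≠ 0 := g.n1.ne (N + 1 - n)
    (by rw [zpow_sub₀ hq, zpow_add₀ hq]; simp; ring)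
  have d1 : 1 - c2 * c3 * q * q ^ n * q ^ n ≠ 0 :=
    g.n23.ne (n + 1 + n : ℕ) (by rw [zpow_natCast]; ring)
  have d3 : 1 - c2 * c3 * q ^ 3 * q ^ n * q ^ n ≠ 0 :=
    g.n23.ne (n + 3 + n : ℕ) (by rw [zpow_natCast]; ring)
  rw [PhiMinus_one (h := h) g, PhiPlus_neg_one g hh, zpow_add_one₀ hq, zpow_natCast, zpow_natCast,
    show c2 * c3 * (q ^ n * q ^ n * q) = c2 * c3 * q * q ^ n * q ^ n by ring,
    show c2 * c3 * (q ^ n * q ^ n * q ^ 2) = c2 * c3 * q ^ 2 * q ^ n * q ^ n by ring,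
    show c2 * c3 * (q ^ n * q * (q ^ n * q)) = c2 * c3 * q ^ 2 * q ^ n * q ^ n by ring,
    show c2 * c3 * (q ^ n * q * (q ^ n * q) * q) = c2 * c3 * q ^ 3 * q ^ n * q ^ n by ring]
  rw [pow_succ q N] at hs
  refine mul_right_cancel₀ (mul_ne_zero m1 m3) ?_
  generalize Omega q h c1 c2 c3 (N + 1) (n + 1) = O2 at *
  generalize Omega q h c1 c2 c3 (N + 1) n = O1 at *
  generalize Omega q h c1 c2 c3 N n = O at *
  generalize q ^ n = A at *
  generalize q ^ N = W at *
  generalize hD1 : 1 - c2 * c3 * q * A * A = D1 at *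
  generalize hD2 : 1 - c2 * c3 * q ^ 2 * A * A = D2 at *
  generalize hD3 : 1 - c2 * c3 * q ^ 3 * A * A = D3 at *
  generalize hM1 : 1 - q * W / A = M1 at *
  generalize hM2 : 1 - c2 * c3 * q ^ 2 * A * W = M2 at *
  generalize hM3 : 1 - c1 * (W * q) / A = M3 at *
  have hM3' : 1 - c1 * q * W / A = M3 := by rw [← hM3]; ring
  rw [hM3'] at hb
  linear_combination (norm := skip)
    h * M2 * M1 * (1 - c1 * c2 * c3 * q ^ 2 * W) / (W * q * D2 * D3 * D1 * q * c2) * hs +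
      h * M1 * (1 - c2 * q * A) * (1 - c1 * c2 * c3 * q ^ 3 * W * A) * (1 - c2 * c3 * q * A) /
        (W * q * D2 * D1 * q * c2) * hb
  clear hs hb hM3'
  field_simp
  subst hD1 hD2 hD3 hM1 hM2 hM3
  -- The identity mixes powers of `h` with `c₂`; eliminating `c₂ = h²/q` leaves a polynomial
  -- identity in independent quantities.
  obtain rfl : c2 = h ^ 2 / q := by rw [hh]; field_simp
  field_simp
  ring

theorem Omega_mul_PhiPlus_one {q h c1 c2 c3 : ℂ} (g : Generic3 q c1 c2 c3)
    (hh : h ^ 2 = q * c2) {N n : ℕ} (hn : n + 1 ≤ N) :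
    Omega q h c1 c2 c3 N (n + 1) * PhiPlus q h c1 c2 c3 N 1 (n + 1) *
      (c3 * h * (1 - q * q ^ N)) =
    Omega q h c1 c2 c3 (N + 1) n * PhiMinus q h c2 c3 (N + 1) (-1) n *
      (1 - c1 * c2 * c3 * q ^ 2 * q ^ N) := by
  have hq := g.q_ne
  have hh0 := g.h_ne hh
  have hb := Omega_bound_succ g hh (by omega : n ≤ N)
  have hs := Omega_succ g hh hn
  have hW : q ^ N ≠ 0 := pow_ne_zero _ hq
  have hA : q ^ n ≠ 0 := pow_ne_zero _ hq
  have m2 : 1 - c2 * c3 * q ^ 2 * q ^ n * q ^ N ≠ 0 :=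
    g.n23.ne (2 + n + N : ℕ) (by rw [zpow_natCast]; ring)
  have d1 : 1 - c2 * c3 * q * q ^ n * q ^ n ≠ 0 :=
    g.n23.ne (n + 1 + n : ℕ) (by rw [zpow_natCast]; ring)
  have d3 : 1 - c2 * c3 * q ^ 3 * q ^ n * q ^ n ≠ 0 :=
    g.n23.ne (n + 3 + n : ℕ) (by rw [zpow_natCast]; ring)
  rw [PhiMinus_neg_one (h := h) g, PhiPlus_one g hh, zpow_add_one₀ hq, zpow_natCast, zpow_natCast,
    show c2 * c3 * (q ^ n * q ^ n * q) = c2 * c3 * q * q ^ n * q ^ n by ring,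
    show c2 * c3 * (q ^ n * q ^ n * q ^ 2) = c2 * c3 * q ^ 2 * q ^ n * q ^ n by ring,
    show c2 * c3 * (q ^ n * q * (q ^ n * q)) = c2 * c3 * q ^ 2 * q ^ n * q ^ n by ring,
    show c2 * c3 * (q ^ n * q * (q ^ n * q) * q) = c2 * c3 * q ^ 3 * q ^ n * q ^ n by ring]
  generalize Omega q h c1 c2 c3 (N + 1) n = O1 at *
  generalize Omega q h c1 c2 c3 N (n + 1) = O2 at *
  generalize Omega q h c1 c2 c3 N n = O at *
  generalize q ^ n = A at *
  generalize q ^ N = W at *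
  generalize hD1 : 1 - c2 * c3 * q * A * A = D1 at *
  generalize hD2 : 1 - c2 * c3 * q ^ 2 * A * A = D2 at *
  generalize hD3 : 1 - c2 * c3 * q ^ 3 * A * A = D3 at *
  generalize hM2 : 1 - c2 * c3 * q ^ 2 * A * W = M2 at *
  linear_combination (norm := skip)
    -(c2 * q * A ^ 2 * (1 - c1 * q * W / A) * c3 * (1 - q * W) / (W * D2 * D3 * D1 * M2)) * hs +
      c2 * q * A ^ 2 * c3 * (1 - W / A) * (1 - c2 * q * A) * (1 - c2 * c3 * q * A) /
        (W * D2 * D1 * M2 * h) * hb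
  clear hs hb
  field_simp
  rw [hh]
  subst hD1 hD2 hD3 hM2
  ring

/-! ### Relations of the `q`-Racah polynomials in the variable and in the degree. -/

theorem racah_eq {q h c1 c2 c3 : ℂ} {N a : ℕ} {x : ℤ} (ha : a ≤ N) (hx : 0 ≤ x) (hxN : x ≤ N) :
    racah q h c1 c2 c3 N a x = Omega q h c1 c2 c3 N a * rSeries q c3 c2 c1 N a x := by
  rw [racah, if_pos ⟨by omega, by omega, hx, hxN⟩, rSeries_eq_phi43]
  rfl

theorem racah_eq_zero {q h c1 c2 c3 : ℂ} {N a x : ℤ} (H : ¬(0 ≤ a ∧ a ≤ N ∧ 0 ≤ x ∧ x ≤ N)) :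
    racah q h c1 c2 c3 N a x = 0 := if_neg H

/-- Outside its range the polynomial is zero by convention while the series need not be. The two may
still be interchanged under a coefficient that vanishes there, and the boundary lemmas below provide
such coefficients. -/
theorem mul_racah_eq {q h c1 c2 c3 t : ℂ} {N a : ℕ} {x : ℤ} (ha : a ≤ N)
    (ht : ¬(0 ≤ x ∧ x ≤ N) → t = 0) :
    t * racah q h c1 c2 c3 N a x = t * (Omega q h c1 c2 c3 N a * rSeries q c3 c2 c1 N a x) := by
  by_cases hx : 0 ≤ x ∧ x ≤ N
  · rw [racah_eq ha hx.1 hx.2]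
  · rw [ht hx, zero_mul, zero_mul]

theorem Phi_one_zero (q c1 c2 c3 : ℂ) (N : ℤ) : Phi q c1 c2 c3 N 1 0 = 0 := by simp [Phi]

theorem PhiPlus_one_zero (q h c1 c2 c3 : ℂ) (N : ℤ) : PhiPlus q h c1 c2 c3 N 1 0 = 0 := by
  simp [PhiPlus]

theorem PhiMinus_one_zero (q h c2 c3 : ℂ) (N : ℤ) : PhiMinus q h c2 c3 N 1 0 = 0 := by
  simp [PhiMinus]

theorem Phi_neg_one_self (q c1 c2 c3 : ℂ) (N : ℤ) : Phi q c1 c2 c3 N (-1) N = 0 := by simp [Phi]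

theorem PhiMinus_neg_one_self (q h c2 c3 : ℂ) (N : ℤ) : PhiMinus q h c2 c3 N (-1) N = 0 := by
  simp [PhiMinus]

theorem PhiMinus_neg_one_pred (q h c2 c3 : ℂ) (N : ℤ) :
    PhiMinus q h c2 c3 (N + 1) (-1) N = 0 := by
  simp [PhiMinus]

/-- At `x = N + 1` the polynomial of bound `N` is cut off to zero, so the diagonal coefficient has
to vanish as well: `Φ_-^+` cancels the additive constant there, and `Φ_-^-` is zero. -/
theorem PhiMinus_zero_self {q h c1 c2 c3 : ℂ} (g : Generic3 q c1 c2 c3) (N : ℤ) :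
    PhiMinus q h c2 c3 (N + 1) 0 (N + 1) = 0 := by
  have hq := g.q_ne
  have hW : q ^ N ≠ 0 := zpow_ne_zero _ hq
  have d0 := g.n23.ne (N + 1 + (N + 1)) (t := c2 * c3 * (q ^ N * q * (q ^ N * q)))
    (by rw [zpow_add₀ hq, zpow_add_one₀ hq])
  have d1 := g.n23.ne (N + 1 + (N + 1) + 1) (t := c2 * c3 * (q ^ N * q * (q ^ N * q) * q))
    (by rw [zpow_add_one₀ hq (N + 1 + (N + 1)), zpow_add₀ hq, zpow_add_one₀ hq])
  rw [PhiMinus_zero hq, PhiMinus_neg_one_self, PhiMinus_one (h := h) g, zpow_add_one₀ hq]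
  generalize q ^ N = W at *
  generalize 1 - c2 * c3 * (W * q * (W * q)) = D0 at *
  generalize 1 - c2 * c3 * (W * q * (W * q) * q) = D1 at *
  field_simp
  ring

/-- The factor in the contiguity relation `racah_plus`. -/
def fPlus (q c1 c2 c3 : ℂ) (N a : ℤ) : ℂ :=
  -((1 - c1 * c2 * c3 * q ^ (N + 2 + a)) * (1 - c1 * q ^ (N + 1 - a))) / (c1 * q ^ (N + 1))

/-- The factor in the contiguity relation `racah_minus`. -/
def fMinus (q c : ℂ) (N a : ℤ) : ℂ := eigen q c a - eigen q c N

theorem fMinus_eq {q : ℂ} (hq : q ≠ 0) (c : ℂ) (N a : ℤ) :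
    fMinus q c (N + 1) a = -((1 - q * q ^ N / q ^ a) * (1 - c * q ^ 2 * q ^ a * q ^ N)) /
      (q * q ^ N) := by
  simp only [fMinus, eigen, zpow_neg, zpow_add_one₀ hq]
  field_simp
  ring

theorem fPlus_eq {q : ℂ} (hq : q ≠ 0) (c1 c2 c3 : ℂ) (N a : ℤ) :
    fPlus q c1 c2 c3 N a = -((1 - c1 * c2 * c3 * q ^ 2 * q ^ N * q ^ a) *
      (1 - c1 * q * q ^ N / q ^ a)) / (c1 * q * q ^ N) := by
  simp only [fPlus, zpow_add₀ hq, zpow_sub₀ hq, zpow_ofNat]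
  ring

/-- The difference equation of the `q`-Racah polynomials. -/
theorem racah_diff {q h c1 c2 c3 : ℂ} (g : Generic3 q c1 c2 c3) {N a x : ℤ} (hx : 0 ≤ x)
    (hxN : x ≤ N) :
    Phi q c3 c2 c1 N 1 x * racah q h c1 c2 c3 N a (x - 1) +
      Phi q c3 c2 c1 N 0 x * racah q h c1 c2 c3 N a x +
      Phi q c3 c2 c1 N (-1) x * racah q h c1 c2 c3 N a (x + 1) =
      eigen q (c2 * c3) a * racah q h c1 c2 c3 N a x := by
  by_cases ha : 0 ≤ a ∧ a ≤ N
  · lift N to ℕ using by omega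
    lift a to ℕ using ha.1
    have ha' : a ≤ N := by omega
    rw [mul_racah_eq ha', racah_eq ha' hx hxN, mul_racah_eq ha', mul_comm c2 c3]
    · linear_combination Omega q h c1 c2 c3 N a * rSeries_diff g.swap x ha.2
    · intro hx'
      obtain rfl : x = N := by omega
      exact Phi_neg_one_self ..
    · intro hx'
      obtain rfl : x = 0 := by omega
      exact Phi_one_zero ..
  · simp only [racah_eq_zero (fun H => ha ⟨H.1, H.2.1⟩)]
    ring

/-- The contiguity relation raising the degree bound. -/
theorem racah_plus {q h c1 c2 c3 : ℂ} (g : Generic3 q c1 c2 c3) (hh : h ^ 2 = q * c2)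
    {N x : ℤ} (a : ℤ) (hx : 0 ≤ x) (hxN : x ≤ N) :
    PhiPlus q h c3 c2 c1 N 1 x * racah q h c1 c2 c3 (N + 1) a (x - 1) +
      PhiPlus q h c3 c2 c1 N 0 x * racah q h c1 c2 c3 (N + 1) a x +
      PhiPlus q h c3 c2 c1 N (-1) x * racah q h c1 c2 c3 (N + 1) a (x + 1) =
      fPlus q c1 c2 c3 N a * racah q h c1 c2 c3 N a x := by
  by_cases ha : 0 ≤ a ∧ a ≤ N + 1
  · have hq := g.q_ne
    lift N to ℕ using by omega
    lift a to ℕ using ha.1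
    have ha' : a ≤ N + 1 := by omega
    have key := rSeries_plus g.swap hh ha.2 hx hxN
    rw [show (N : ℤ) + 1 = (N + 1 : ℕ) by push_cast; rfl, mul_racah_eq ha',
      racah_eq ha' hx (by push_cast; omega), racah_eq ha' (by omega) (by push_cast; omega)]
    · push_cast
      -- In top degree `N + 1` the right-hand polynomial is zero by convention, and the series
      -- identity agrees since it carries the factor `1 - q^{N+1-a}`.
      rcases eq_or_ne a (N + 1) with rfl | hne
      · rw [racah_eq_zero (N := (N : ℤ)) (by push_cast; omega)]
        rw [show q * q ^ (N : ℤ) / q ^ ((N + 1 : ℕ) : ℤ) = 1 by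
          push_cast; rw [zpow_add_one₀ hq, mul_comm, div_self]
          exact mul_ne_zero (zpow_ne_zero _ hq) hq] at key
        linear_combination Omega q h c1 c2 c3 (N + 1) (N + 1) * key
      · have haN : a ≤ N := by omega
        have hb := Omega_bound_succ g hh haN
        rw [racah_eq haN hx hxN, fPlus_eq hq]
        have m1 : 1 - q * q ^ (N : ℤ) ≠ 0 := one_sub_ne g.q_pow ((N : ℤ) + 1) (by omega)
          (by rw [zpow_add_one₀ hq, mul_comm])
        have hh0 := g.h_ne hh
        have hc1 := g.c1_ne
        have hW : q ^ (N : ℤ) ≠ 0 := zpow_ne_zero _ hq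
        have hA : q ^ (a : ℤ) ≠ 0 := zpow_ne_zero _ hq
        rw [← zpow_natCast q N, ← zpow_natCast q a] at hb
        rw [show ∀ s t u v w z r : ℂ, s * (v * u) + t * (v * w) + r * (v * z) =
          v * (s * u + t * w + r * z) by intros; ring, key]
        generalize Omega q h c1 c2 c3 (N + 1) a = O1 at *
        generalize Omega q h c1 c2 c3 N a = O at *
        generalize rSeries q c3 c2 c1 N a x = S at *
        generalize q ^ (N : ℤ) = W at *
        generalize q ^ (a : ℤ) = A at *
        generalize hM : 1 - q * W = M at *
        linear_combination (norm := skip) -(S / (c1 * q * W * h * M)) * hb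
        clear hb key
        field_simp
        ring
    · intro hx'
      obtain rfl : x = 0 := by push_cast at hx'; omega
      exact PhiPlus_one_zero ..
  · rw [racah_eq_zero (fun H => ha ⟨H.1, H.2.1⟩), racah_eq_zero (fun H => ha ⟨H.1, H.2.1⟩),
      racah_eq_zero (fun H => ha ⟨H.1, H.2.1⟩), racah_eq_zero (fun H => ha ⟨H.1, by omega⟩)]
    ring

/-- The contiguity relation lowering the degree bound. -/
theorem racah_minus {q h c1 c2 c3 : ℂ} (g : Generic3 q c1 c2 c3) (hh : h ^ 2 = q * c2)
    {N x : ℤ} (a : ℤ) (hx : 0 ≤ x) (hxN : x ≤ N + 1) :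
    PhiMinus q h c2 c1 (N + 1) 1 x * racah q h c1 c2 c3 N a (x - 1) +
      PhiMinus q h c2 c1 (N + 1) 0 x * racah q h c1 c2 c3 N a x +
      PhiMinus q h c2 c1 (N + 1) (-1) x * racah q h c1 c2 c3 N a (x + 1) =
      fMinus q (c2 * c3) (N + 1) a * racah q h c1 c2 c3 (N + 1) a x := by
  by_cases ha : 0 ≤ a ∧ a ≤ N
  · have hq := g.q_ne
    lift N to ℕ using by omega
    lift a to ℕ using ha.1
    have ha' : a ≤ N := by omega
    have key := rSeries_minus (h := h) g.swap x ha.2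
    rw [mul_racah_eq ha', mul_racah_eq ha', mul_racah_eq ha',
      show racah q h c1 c2 c3 ((N : ℤ) + 1) = racah q h c1 c2 c3 (N + 1 : ℕ) by push_cast; rfl,
      racah_eq (by omega) hx (by push_cast; omega)]
    · push_cast
      have hb := Omega_bound_succ g hh ha'
      have m1 : 1 - c1 * c2 * c3 * q ^ 2 * q ^ (N : ℤ) ≠ 0 := g.n123.ne (2 + N)
        (by rw [zpow_add₀ hq, zpow_ofNat]; ring)
      have hW : q ^ (N : ℤ) ≠ 0 := zpow_ne_zero _ hq
      have hA : q ^ (a : ℤ) ≠ 0 := zpow_ne_zero _ hq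
      rw [fMinus_eq hq]
      rw [← zpow_natCast q N, ← zpow_natCast q a] at hb
      rw [show ∀ s t u v w z r : ℂ, s * (v * u) + t * (v * w) + r * (v * z) =
        v * (s * u + t * w + r * z) by intros; ring, key,
        show c3 * c2 * c1 * q ^ 2 * q ^ (N : ℤ) = c1 * c2 * c3 * q ^ 2 * q ^ (N : ℤ) by ring]
      generalize Omega q h c1 c2 c3 (N + 1) a = O1 at *
      generalize Omega q h c1 c2 c3 N a = O at *
      generalize rSeries q c3 c2 c1 ((N : ℤ) + 1) a x = S at *
      generalize q ^ (N : ℤ) = W at *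
      generalize q ^ (a : ℤ) = A at *
      generalize hM : 1 - c1 * c2 * c3 * q ^ 2 * W = M at *
      linear_combination (norm := skip) (S / (q * W * M)) * hb
      clear hb key
      field_simp
      ring
    · intro hx'
      obtain rfl | rfl : x = N ∨ x = N + 1 := by omega
      · exact PhiMinus_neg_one_pred ..
      · exact PhiMinus_neg_one_self ..
    · intro hx'
      obtain rfl : x = N + 1 := by omega
      exact PhiMinus_zero_self g.swap N
    · intro hx'
      obtain rfl : x = 0 := by omega
      exact PhiMinus_one_zero ..
  · rw [racah_eq_zero (fun H => ha ⟨H.1, H.2.1⟩), racah_eq_zero (fun H => ha ⟨H.1, H.2.1⟩),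
      racah_eq_zero (fun H => ha ⟨H.1, H.2.1⟩)]
    rcases eq_or_ne a (N + 1) with rfl | hne
    · simp [fMinus]
    · rw [racah_eq_zero (N := N + 1) (fun H => ha ⟨H.1, by omega⟩)]
      ring

/-- The three-term recurrence relation of the `q`-Racah polynomials. -/
theorem racah_rec {q h c1 c2 c3 : ℂ} (g : Generic3 q c1 c2 c3) (hh : h ^ 2 = q * c2)
    {N a : ℤ} (x : ℤ) (ha : 0 ≤ a) (haN : a ≤ N + 1) :
    Phi q c1 c2 c3 N (-1) (a - 1) * racah q h c1 c2 c3 N (a - 1) x +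
      Phi q c1 c2 c3 N 0 a * racah q h c1 c2 c3 N a x +
      Phi q c1 c2 c3 N 1 (a + 1) * racah q h c1 c2 c3 N (a + 1) x =
      eigen q (c1 * c2) x * racah q h c1 c2 c3 N a x := by
  by_cases hx : 0 ≤ x ∧ x ≤ N
  · rcases eq_or_ne a (N + 1) with rfl | hne
    · rw [racah_eq_zero (a := N + 1) (by omega), racah_eq_zero (a := N + 1 + 1) (by omega),
        add_sub_cancel_right, Phi_neg_one_self]
      ring
    lift N to ℕ using by omega
    lift a to ℕ using ha
    lift x to ℕ using hx.1
    have haN' : a ≤ N := by omega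
    -- After duality the degree is the variable of the series, and `Omega_mul_Phi` transposes the
    -- operator so that each coefficient moves to the neighbouring degree.
    have key := rSeries_diff g (a := x) a hx.2
    have e1 : Phi q c1 c2 c3 N (-1) (a - 1) * racah q h c1 c2 c3 N (a - 1) x =
        Omega q h c1 c2 c3 N a * (Phi q c1 c2 c3 N 1 a * rSeries q c1 c2 c3 N x (a - 1)) := by
      rcases a with _ | b
      · simp [Phi_one_zero, racah_eq_zero (a := (-1 : ℤ))]
      · have e : ((b + 1 : ℕ) : ℤ) - 1 = b := by push_cast; ring
        rw [e, racah_eq (by omega) hx.1 hx.2, rSeries_comm g.q_ne c3 c2 c1]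
        push_cast
        linear_combination rSeries q c1 c2 c3 N x b * Omega_mul_Phi g hh haN'
    have e2 : Phi q c1 c2 c3 N 1 (a + 1) * racah q h c1 c2 c3 N (a + 1) x =
        Omega q h c1 c2 c3 N a * (Phi q c1 c2 c3 N (-1) a * rSeries q c1 c2 c3 N x (a + 1)) := by
      rcases haN'.eq_or_lt with rfl | hlt
      · rw [racah_eq_zero (by omega), Phi_neg_one_self]
        ring
      · have e : (a : ℤ) + 1 = (a + 1 : ℕ) := by push_cast; ring
        rw [e, racah_eq (by omega) hx.1 hx.2, rSeries_comm g.q_ne c3 c2 c1]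
        push_cast
        linear_combination -rSeries q c1 c2 c3 N x (a + 1) * Omega_mul_Phi g hh hlt
    rw [e1, e2, racah_eq haN' hx.1 hx.2, rSeries_comm g.q_ne c3 c2 c1]
    linear_combination Omega q h c1 c2 c3 N a * key
  · simp only [racah_eq_zero (fun H => hx ⟨H.2.2.1, H.2.2.2⟩)]
    ring

/-- The contiguity relation in the degree variable, lowering the degree bound. -/
theorem racah_dual_minus {q h c1 c2 c3 : ℂ} (g : Generic3 q c1 c2 c3) (hh : h ^ 2 = q * c2)
    {N a x : ℤ} (ha : 0 ≤ a) (haN : a ≤ N) (hx : 0 ≤ x) (hxN : x ≤ N + 1) :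
    PhiMinus q h c2 c3 (N + 1) (-1) (a - 1) * racah q h c1 c2 c3 (N + 1) (a - 1) x +
      PhiMinus q h c2 c3 (N + 1) 0 a * racah q h c1 c2 c3 (N + 1) a x +
      PhiMinus q h c2 c3 (N + 1) 1 (a + 1) * racah q h c1 c2 c3 (N + 1) (a + 1) x =
      fMinus q (c1 * c2) (N + 1) x * racah q h c1 c2 c3 N a x := by
  have hq := g.q_ne
  lift N to ℕ using by omega
  lift a to ℕ using ha
  lift x to ℕ using hx
  have haN' : a ≤ N := by omega
  have hR : ∀ b : ℕ, b ≤ N + 1 → racah q h c1 c2 c3 ((N : ℤ) + 1) b x =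
      Omega q h c1 c2 c3 (N + 1) b * rSeries q c1 c2 c3 ((N : ℤ) + 1) x b := by
    intro b hb
    rw [show (N : ℤ) + 1 = (N + 1 : ℕ) by push_cast; rfl, racah_eq hb (by omega) (by omega),
      rSeries_comm hq c3 c2 c1]
  have key := rSeries_plus g hh (a := x) hxN (Int.natCast_nonneg a) haN
  have m1 : 1 - c1 * c2 * c3 * q ^ 2 * q ^ (N : ℤ) ≠ 0 := g.n123.ne (2 + N)
    (by rw [zpow_add₀ hq, zpow_ofNat]; ring)
  have m2 : 1 - q * q ^ (N : ℤ) ≠ 0 := one_sub_ne g.q_pow ((N : ℤ) + 1) (by omega)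
    (by rw [zpow_add_one₀ hq, mul_comm])
  have hh0 := g.h_ne hh
  have hc3 := g.c3_ne
  have e0 := Omega_mul_PhiPlus_zero g hh haN'
  have e2 := Omega_mul_PhiPlus_neg_one g hh haN'
  have e1 : PhiMinus q h c2 c3 (N + 1) (-1) (a - 1) * racah q h c1 c2 c3 (N + 1) (a - 1) x *
      (1 - c1 * c2 * c3 * q ^ 2 * q ^ (N : ℤ)) =
      Omega q h c1 c2 c3 N a * PhiPlus q h c1 c2 c3 N 1 a * (c3 * h * (1 - q * q ^ (N : ℤ))) *
        rSeries q c1 c2 c3 (N + 1) x (a - 1) := by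
    rcases a with _ | b
    · simp [PhiPlus_one_zero, racah_eq_zero (a := (-1 : ℤ))]
    · have e : ((b + 1 : ℕ) : ℤ) - 1 = b := by push_cast; ring
      rw [e, hR b (by omega), zpow_natCast]
      push_cast
      linear_combination -rSeries q c1 c2 c3 (N + 1) x b * Omega_mul_PhiPlus_one g hh haN'
  -- At `x = N + 1` the left polynomial is zero by convention while the series is not; the factor `1
  -- - q^{N+1-x}`, which also divides the scalar of the contiguity relation, vanishes there.
  have hL : racah q h c1 c2 c3 N a x * (1 - q * q ^ (N : ℤ) / q ^ (x : ℤ)) =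
      Omega q h c1 c2 c3 N a * rSeries q c1 c2 c3 N x a *
        (1 - q * q ^ (N : ℤ) / q ^ (x : ℤ)) := by
    rcases eq_or_ne x (N + 1) with rfl | hne
    · rw [show q * q ^ (N : ℤ) / q ^ ((N + 1 : ℕ) : ℤ) = 1 by
        push_cast; rw [zpow_add_one₀ hq, mul_comm, div_self]
        exact mul_ne_zero (zpow_ne_zero _ hq) hq]
      ring
    · rw [racah_eq haN' (by omega) (by omega), rSeries_comm hq c3 c2 c1]
  have eN : (a : ℤ) + 1 = (a + 1 : ℕ) := by push_cast; rfl
  refine mul_right_cancel₀ m1 ?_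
  rw [fMinus_eq hq, eN, hR (a+1) (by omega), hR a (by omega), ← eN]
  rw [← zpow_natCast q N] at e0 e2
  generalize racah q h c1 c2 c3 N a x = P at *
  generalize racah q h c1 c2 c3 (N + 1) (a - 1) x = P' at *
  generalize Omega q h c1 c2 c3 (N + 1) (a + 1) = O2 at *
  generalize Omega q h c1 c2 c3 (N + 1) a = O1 at *
  generalize Omega q h c1 c2 c3 N a = O at *
  have key2 := congrArg (fun t => O * (c3 * h * (1 - q * q ^ (N : ℤ))) * t) key
  have hk : O * (c3 * h * (1 - q * q ^ (N : ℤ))) * (-((1 - q * q ^ (N : ℤ) / q ^ (x : ℤ)) *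
      (1 - c1 * c2 * q ^ 2 * q ^ (x : ℤ) * q ^ (N : ℤ)) *
      (1 - c1 * c2 * c3 * q ^ 2 * q ^ (N : ℤ))) / (c3 * q * q ^ (N : ℤ) * h *
        (1 - q * q ^ (N : ℤ))) * rSeries q c1 c2 c3 N x a) =
      O * rSeries q c1 c2 c3 N x a * (1 - q * q ^ (N : ℤ) / q ^ (x : ℤ)) *
      (-((1 - c1 * c2 * q ^ 2 * q ^ (x : ℤ) * q ^ (N : ℤ)) *
      (1 - c1 * c2 * c3 * q ^ 2 * q ^ (N : ℤ))) / (q * q ^ (N : ℤ))) := by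
    generalize q ^ (N : ℤ) = W at *
    generalize q ^ (x : ℤ) = X at *
    generalize 1 - q * W = M at *
    generalize rSeries q c1 c2 c3 N x a = S at *
    clear key key2 e0 e1 e2 hL hR
    field_simp
  rw [hk, ← hL] at key2
  linear_combination e1 - rSeries q c1 c2 c3 (N + 1) x a * e0 -
    rSeries q c1 c2 c3 (N + 1) x (a + 1) * e2 + key2

/-- The contiguity relation in the degree variable, raising the degree bound. -/
theorem racah_dual_plus {q h c1 c2 c3 : ℂ} (g : Generic3 q c1 c2 c3) (hh : h ^ 2 = q * c2)
    {N a x : ℤ} (ha : 0 ≤ a) (haN : a ≤ N + 1) (hx : 0 ≤ x) (hxN : x ≤ N) :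
    PhiPlus q h c1 c2 c3 N (-1) (a - 1) * racah q h c1 c2 c3 N (a - 1) x +
      PhiPlus q h c1 c2 c3 N 0 a * racah q h c1 c2 c3 N a x +
      PhiPlus q h c1 c2 c3 N 1 (a + 1) * racah q h c1 c2 c3 N (a + 1) x =
      fPlus q c3 c2 c1 N x * racah q h c1 c2 c3 (N + 1) a x := by
  have hq := g.q_ne
  lift N to ℕ using by omega
  lift a to ℕ using ha
  lift x to ℕ using hx
  have hR : ∀ b : ℕ, b ≤ N → racah q h c1 c2 c3 N b x =
      Omega q h c1 c2 c3 N b * rSeries q c1 c2 c3 N x b := by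
    intro b hb
    rw [racah_eq hb (by omega) (by omega), rSeries_comm hq c3 c2 c1]
  have key := rSeries_minus (h := h) g (a := x) a hxN
  have hW : q ^ (N : ℤ) ≠ 0 := zpow_ne_zero _ hq
  have m1 : 1 - c1 * c2 * c3 * q ^ 2 * q ^ (N : ℤ) ≠ 0 := g.n123.ne (2 + N)
    (by rw [zpow_add₀ hq, zpow_ofNat]; ring)
  have m2 : 1 - q * q ^ (N : ℤ) ≠ 0 := one_sub_ne g.q_pow ((N : ℤ) + 1) (by omega)
    (by rw [zpow_add_one₀ hq, mul_comm])
  have hh0 := g.h_ne hh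
  have hc3 := g.c3_ne
  have e0 : PhiPlus q h c1 c2 c3 N 0 a * racah q h c1 c2 c3 N a x *
      (c3 * h * (1 - q * q ^ (N : ℤ))) =
      Omega q h c1 c2 c3 (N + 1) a * PhiMinus q h c2 c3 (N + 1) 0 a *
      (1 - c1 * c2 * c3 * q ^ 2 * q ^ (N : ℤ)) * rSeries q c1 c2 c3 N x a := by
    rcases eq_or_ne a (N + 1) with rfl | hne
    · rw [racah_eq_zero (by omega)]
      push_cast
      rw [PhiMinus_zero_self g]
      ring
    · rw [hR _ (by omega), zpow_natCast]
      linear_combination rSeries q c1 c2 c3 N x a * Omega_mul_PhiPlus_zero g hh (by omega : a ≤ N)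
  have e1 : PhiPlus q h c1 c2 c3 N (-1) (a - 1) * racah q h c1 c2 c3 N (a - 1) x *
      (c3 * h * (1 - q * q ^ (N : ℤ))) =
      Omega q h c1 c2 c3 (N + 1) a * PhiMinus q h c2 c3 (N + 1) 1 a *
      (1 - c1 * c2 * c3 * q ^ 2 * q ^ (N : ℤ)) * rSeries q c1 c2 c3 N x (a - 1) := by
    rcases a with _ | b
    · simp [PhiMinus_one_zero, racah_eq_zero (a := (-1 : ℤ))]
    · have e : ((b + 1 : ℕ) : ℤ) - 1 = b := by push_cast; ring
      rw [e, hR b (by omega), zpow_natCast]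
      push_cast
      linear_combination rSeries q c1 c2 c3 N x b *
        Omega_mul_PhiPlus_neg_one g hh (by omega : b ≤ N)
  have e2 : PhiPlus q h c1 c2 c3 N 1 (a + 1) * racah q h c1 c2 c3 N (a + 1) x *
      (c3 * h * (1 - q * q ^ (N : ℤ))) =
      Omega q h c1 c2 c3 (N + 1) a * PhiMinus q h c2 c3 (N + 1) (-1) a *
      (1 - c1 * c2 * c3 * q ^ 2 * q ^ (N : ℤ)) * rSeries q c1 c2 c3 N x (a + 1) := by
    by_cases hlt : a + 1 ≤ N
    · have e : (a : ℤ) + 1 = (a + 1 : ℕ) := by push_cast; ring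
      rw [e, hR _ hlt, zpow_natCast]
      push_cast
      linear_combination rSeries q c1 c2 c3 N x (a + 1) * Omega_mul_PhiPlus_one g hh hlt
    · rw [racah_eq_zero (by omega)]
      obtain h' | h' : (a : ℤ) = N ∨ (a : ℤ) = N + 1 := by omega
      · rw [h', PhiMinus_neg_one_pred]; ring
      · rw [h', PhiMinus_neg_one_self]; ring
  have hP : racah q h c1 c2 c3 (N + 1) a x =
      Omega q h c1 c2 c3 (N + 1) a * rSeries q c1 c2 c3 (N + 1) x a := by
    rw [show (N : ℤ) + 1 = (N + 1 : ℕ) by push_cast; rfl, racah_eq (by omega) (by omega)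
      (by omega), rSeries_comm hq c3 c2 c1]
  refine mul_right_cancel₀ (mul_ne_zero (mul_ne_zero hc3 hh0) m2) ?_
  rw [add_mul, add_mul, e0, e1, e2, hP, fPlus_eq hq]
  rw [show ∀ o m p1 p0 pm s1 s0 sm : ℂ, o * p1 * m * s1 + o * p0 * m * s0 + o * pm * m * sm =
    o * m * (p1 * s1 + p0 * s0 + pm * sm) by intros; ring, key,
    show c3 * c2 * c1 * q ^ 2 * q ^ (N : ℤ) * q ^ (x : ℤ) =
      c1 * c2 * c3 * q ^ 2 * q ^ (N : ℤ) * q ^ (x : ℤ) by ring]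
  clear key e0 e1 e2 hP hR
  generalize q ^ (N : ℤ) = W at *
  generalize q ^ (x : ℤ) = X at *
  generalize 1 - c1 * c2 * c3 * q ^ 2 * W = M at *
  field_simp
  ring

/-! ### Genericity and permutations of the five parameters. -/

/-- Genericity of the parameters of a bivariate Griffiths polynomial. -/
structure Generic5 (q c0 c1 c2 c3 c4 : ℂ) (N : ℤ) : Prop where
  q_ne : q ≠ 0
  q_pow : ∀ k : ℤ, k ≠ 0 → 1 - q ^ k ≠ 0
  rel : q ^ (2 * N + 3) * (c0 * c1 * c2 * c3 * c4) = 1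
  n0 : NotPow q c0
  n1 : NotPow q c1
  n2 : NotPow q c2
  n3 : NotPow q c3
  n4 : NotPow q c4
  n01 : NotPow q (c0 * c1)
  n02 : NotPow q (c0 * c2)
  n03 : NotPow q (c0 * c3)
  n04 : NotPow q (c0 * c4)
  n12 : NotPow q (c1 * c2)
  n13 : NotPow q (c1 * c3)
  n14 : NotPow q (c1 * c4)
  n23 : NotPow q (c2 * c3)
  n24 : NotPow q (c2 * c4)
  n34 : NotPow q (c3 * c4)

namespace Generic5

variable {q c0 c1 c2 c3 c4 : ℂ} {N : ℤ}

theorem c0_ne (g : Generic5 q c0 c1 c2 c3 c4 N) : c0 ≠ 0 := by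
  rintro rfl; simpa using g.rel

theorem swap01 (g : Generic5 q c0 c1 c2 c3 c4 N) : Generic5 q c1 c0 c2 c3 c4 N where
  q_ne := g.q_ne
  q_pow := g.q_pow
  rel := by rw [mul_comm c1]; exact g.rel
  n0 := g.n1
  n1 := g.n0
  n2 := g.n2
  n3 := g.n3
  n4 := g.n4
  n01 := mul_comm c0 c1 ▸ g.n01
  n02 := g.n12
  n03 := g.n13
  n04 := g.n14
  n12 := g.n02
  n13 := g.n03
  n14 := g.n04
  n23 := g.n23
  n24 := g.n24
  n34 := g.n34

/-- Cyclic permutation of the parameters. -/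
theorem rotate (g : Generic5 q c0 c1 c2 c3 c4 N) : Generic5 q c1 c2 c3 c4 c0 N where
  q_ne := g.q_ne
  q_pow := g.q_pow
  rel := by rw [← g.rel]; ring
  n0 := g.n1
  n1 := g.n2
  n2 := g.n3
  n3 := g.n4
  n4 := g.n0
  n01 := g.n12
  n02 := g.n13
  n03 := g.n14
  n04 := mul_comm c0 c1 ▸ g.n01
  n12 := g.n23
  n13 := g.n24
  n14 := mul_comm c0 c2 ▸ g.n02
  n23 := g.n34
  n24 := mul_comm c0 c3 ▸ g.n03
  n34 := mul_comm c0 c4 ▸ g.n04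

theorem generic3 (g : Generic5 q c0 c1 c2 c3 c4 N) : Generic3 q c1 c2 c3 where
  q_ne := g.q_ne
  q_pow := g.q_pow
  c1_ne := g.rotate.c0_ne
  c2_ne := g.rotate.rotate.c0_ne
  c3_ne := g.rotate.rotate.rotate.c0_ne
  n1 := g.n1
  n2 := g.n2
  n3 := g.n3
  n12 := g.n12
  n23 := g.n23
  n123 := by
    -- The relation says that `c₁c₂c₃q^k` and `c₀c₄q^{2N+3-k}` are inverse to each other, so a
    -- triple product inherits genericity from the complementary pair.
    intro k hk
    refine g.n04 (2 * N + 3 - k) ?_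
    have h := g.rel
    rw [show 2 * N + 3 = 2 * N + 3 - k + k by ring, zpow_add₀ g.q_ne] at h
    linear_combination -(c0 * c4 * q ^ (2 * N + 3 - k)) * hk - h

/-- Adjacent transpositions are conjugates of `swap01` under rotation, so every order of the
parameters is reachable. -/
theorem swap12 (g : Generic5 q c0 c1 c2 c3 c4 N) : Generic5 q c0 c2 c1 c3 c4 N :=
  g.rotate.swap01.rotate.rotate.rotate.rotate

theorem swap23 (g : Generic5 q c0 c1 c2 c3 c4 N) : Generic5 q c0 c1 c3 c2 c4 N :=
  g.rotate.swap12.rotate.rotate.rotate.rotate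

theorem swap34 (g : Generic5 q c0 c1 c2 c3 c4 N) : Generic5 q c0 c1 c2 c4 c3 N :=
  g.rotate.swap23.rotate.rotate.rotate.rotate

end Generic5

/-! ### The coefficients `A` as transfer of an operator between two univariate factors. -/

theorem FPlus_closed {q c4 c0 : ℂ} (hq : q ≠ 0) (y : ℤ) :
    FPlus q c4 c0 y = c4 * c0 ^ 2 * q * q ^ y * (1 - c4 * q ^ y) * (1 - q ^ y) /
      ((1 - c0 * c4 * (q ^ y * q ^ y)) * (1 - c0 * c4 * (q ^ y * q ^ y * q))) := by
  simp only [FPlus, two_mul, zpow_add₀ hq, zpow_one, mul_comm c0 c4]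
  ring

theorem FMinus_closed {q c4 c0 : ℂ} (hq : q ≠ 0) (h : NotPow q (c0 * c4)) (y : ℤ) :
    FMinus q c4 c0 y = c0 * c4 * q * q ^ y * (1 - c0 * (q ^ y * q)) * (1 - c0 * c4 * q * q ^ y) /
      ((1 - c0 * c4 * (q ^ y * q ^ y * q)) * (1 - c0 * c4 * (q ^ y * q ^ y * q ^ 2))) := by
  rw [mul_comm] at h
  simp only [FMinus, redQuot_eq (h _), two_mul, zpow_add₀ hq, zpow_ofNat,
    mul_comm c0 c4]
  rw [div_mul_div_comm]
  ring

section coeffA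

variable {q h c0 c1 c2 c3 c4 : ℂ} {N : ℤ}

theorem coeffA_minus (q h c0 c1 c2 c3 c4 : ℂ) (N ε i j : ℤ) :
    coeffA q h c0 c1 c2 c3 c4 N ε (-1) i j =
      -c3 * q ^ (N + 1) * FMinus q c4 c0 j * PhiMinus q h c2 c3 (N - j) ε i := by
  simp [coeffA]

/-- For generic parameters the factor that `coeffA` cancels against the denominator of `F^+` is
nonzero and can be restored, which exposes the product of `F^+` with a contiguity coefficient. -/
theorem coeffA_plus (g : Generic5 q c0 c1 c2 c3 c4 N) {ε : ℤ} (hε : ε = 1 ∨ ε = 0 ∨ ε = -1)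
    (i j : ℤ) :
    coeffA q h c0 c1 c2 c3 c4 N ε 1 i j =
      -c3 * q ^ (N + 1) * FPlus q c4 c0 j * PhiPlus q h c1 c2 c3 (N - j) ε i := by
  obtain ⟨hX, hF⟩ := FPlus_eq (c0 := c0) (c1 := c1) (c2 := c2) (c3 := c3) (c4 := c4) (j := j)
    g.q_ne g.rel (by rw [mul_comm c4]; exact g.n04 _)
  rcases hε with rfl | rfl | rfl
  · simp [coeffA]
  · simp only [coeffA, redQuot_eq hX, hF]
    simp [PhiPlus]
    ring
  · simp only [coeffA, redQuot_eq hX, hF]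
    simp [PhiPlus]
    ring

/-- The term present only for `ε = 0` is the deviation of `A^{0,0}` from the pattern of `A^{±1,0}`.
It turns the eigenvalue in `a` into the diagonal coefficient of the operator in `y`, see
`coeffA_eigen`. -/
theorem coeffA_zero (g : Generic5 q c0 c1 c2 c3 c4 N) {ε : ℤ} (hε : ε = 1 ∨ ε = 0 ∨ ε = -1)
    (i j : ℤ) :
    coeffA q h c0 c1 c2 c3 c4 N ε 0 i j =
      c3 * q ^ (N + 1) * (FPlus q c4 c0 j + FMinus q c4 c0 j) * Phi q c1 c2 c3 (N - j) ε i -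
      (if ε = 0 then (1 - c3 * q ^ (N - j + 1)) * (1 - c1 * c2 * c3 * q ^ (N - j + 2)) * q ^ j *
        FPlus q c4 c0 j + c3 * (1 - q ^ (N - j)) * (q ^ (j + 1) - c1 * c2 * q ^ (N + 2)) *
        FMinus q c4 c0 j else 0) := by
  obtain ⟨hX, hF⟩ := FPlus_eq (c0 := c0) (c1 := c1) (c2 := c2) (c3 := c3) (c4 := c4) (j := j)
    g.q_ne g.rel (by rw [mul_comm c4]; exact g.n04 _)
  rcases hε with rfl | rfl | rfl
  · simp [coeffA]
  · simp only [coeffA, redQuot_eq hX, hF]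
    simp [Phi]
    ring
  · simp [coeffA]

/-- The relation makes `c₁c₂c₃q^{N-y+2+a}` inverse to `c₀c₄q^{y+N-a+1}`. Hence the `a`-dependent
factors of `fPlus` at bound `N-y` are, up to a monomial, those of `Φ^+` at bound `N-a`, and `F^+`
supplies the factors in `y` alone. -/
theorem coeffA_fPlus (g : Generic5 q c0 c1 c2 c3 c4 N) (a y : ℤ) :
    -c3 * q ^ (N + 1) * FPlus q c4 c0 y * fPlus q c3 c2 c1 (N - y) a =
      Phi q c3 c0 c4 (N - a) 1 y := by
  have hq := g.q_ne
  have g' := g.swap01.swap23.swap12.swap34.generic3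
  have hr := g.rel
  rw [FPlus_closed hq, fPlus_eq hq, Phi_one g']
  rw [two_mul, zpow_add₀ hq, zpow_add₀ hq, zpow_ofNat] at hr
  simp only [zpow_sub₀ hq, zpow_add₀ hq N, zpow_one]
  have hW : q ^ N ≠ 0 := zpow_ne_zero _ hq
  have hA : q ^ a ≠ 0 := zpow_ne_zero _ hq
  have hY : q ^ y ≠ 0 := zpow_ne_zero _ hq
  have d1 : 1 - c0 * c4 * (q ^ y * q ^ y) ≠ 0 := g.n04.ne (y + y) (by rw [zpow_add₀ hq])
  have d2 : 1 - c0 * c4 * (q ^ y * q ^ y * q) ≠ 0 :=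
    g.n04.ne (y + y + 1) (by rw [zpow_add_one₀ hq, zpow_add₀ hq])
  have h0 := g'.c2_ne
  have h3 := g'.c1_ne
  have h4 := g'.c3_ne
  clear g g'
  generalize q ^ N = W at *
  generalize q ^ a = A at *
  generalize q ^ y = Y at *
  -- Solving the relation for `c₂` leaves independent quantities, so the claim becomes a rational
  -- identity.
  obtain rfl : c2 = 1 / (W * W * q ^ 3 * (c0 * c1 * c3 * c4)) := by
    have : W * W * q ^ 3 * (c0 * c1 * c3 * c4) ≠ 0 := by
      intro h; apply one_ne_zero (α := ℂ); rw [← hr]; linear_combination c2 * h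
    rw [eq_div_iff this, ← hr]; ring
  have h1 : c1 ≠ 0 := by rintro rfl; simp at hr
  clear hr
  generalize 1 - c0 * c4 * (Y * Y) = D1 at *
  generalize 1 - c0 * c4 * (Y * Y * q) = D2 at *
  field_simp
  ring

theorem coeffA_fMinus (g : Generic5 q c0 c1 c2 c3 c4 N) (a y : ℤ) :
    -c3 * q ^ (N + 1) * FMinus q c4 c0 y * fMinus q (c2 * c1) (N - y) a =
      Phi q c3 c0 c4 (N - a) (-1) y := by
  have hq := g.q_ne
  have g' := g.swap01.swap23.swap12.swap34.generic3
  have hr := g.rel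
  rw [FMinus_closed hq g.n04, show N - y = N - y - 1 + 1 by ring, fMinus_eq hq, Phi_neg_one g']
  rw [two_mul, zpow_add₀ hq, zpow_add₀ hq, zpow_ofNat] at hr
  simp only [zpow_sub₀ hq, zpow_add₀ hq N, zpow_one]
  have hW : q ^ N ≠ 0 := zpow_ne_zero _ hq
  have hA : q ^ a ≠ 0 := zpow_ne_zero _ hq
  have hY : q ^ y ≠ 0 := zpow_ne_zero _ hq
  have d1 : 1 - c0 * c4 * (q ^ y * q ^ y * q) ≠ 0 :=
    g.n04.ne (y + y + 1) (by rw [zpow_add_one₀ hq, zpow_add₀ hq])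
  have d2 : 1 - c0 * c4 * (q ^ y * q ^ y * q ^ 2) ≠ 0 :=
    g.n04.ne (y + y + 2) (by rw [zpow_add₀ hq, zpow_add₀ hq, zpow_ofNat])
  have h0 := g'.c2_ne
  have h3 := g'.c1_ne
  have h4 := g'.c3_ne
  clear g g'
  generalize q ^ N = W at *
  generalize q ^ a = A at *
  generalize q ^ y = Y at *
  obtain rfl : c2 = 1 / (W * W * q ^ 3 * (c0 * c1 * c3 * c4)) := by
    have : W * W * q ^ 3 * (c0 * c1 * c3 * c4) ≠ 0 := by
      intro h; apply one_ne_zero (α := ℂ); rw [← hr]; linear_combination c2 * h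
    rw [eq_div_iff this, ← hr]; ring
  have h1 : c1 ≠ 0 := by rintro rfl; simp at hr
  clear hr
  generalize 1 - c0 * c4 * (Y * Y * q) = D1 at *
  generalize 1 - c0 * c4 * (Y * Y * q ^ 2) = D2 at *
  field_simp
  ring

/-- As `Φ^0 = -Φ^+ - Φ^-`, the two preceding lemmas reduce the claim to an identity linear in `F^+`
and `F^-`, whose coefficients match separately and without further use of the relation. -/
theorem coeffA_eigen (g : Generic5 q c0 c1 c2 c3 c4 N) (a y : ℤ) :
    c3 * q ^ (N + 1) * (FPlus q c4 c0 y + FMinus q c4 c0 y) * eigen q (c2 * c1) a -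
      ((1 - c3 * q ^ (N - y + 1)) * (1 - c1 * c2 * c3 * q ^ (N - y + 2)) * q ^ y *
        FPlus q c4 c0 y + c3 * (1 - q ^ (N - y)) * (q ^ (y + 1) - c1 * c2 * q ^ (N + 2)) *
        FMinus q c4 c0 y) =
      Phi q c3 c0 c4 (N - a) 0 y := by
  have hq := g.q_ne
  have h3 := g.rotate.rotate.rotate.c0_ne
  rw [Phi_zero, ← coeffA_fPlus g, ← coeffA_fMinus g]
  simp only [fPlus, fMinus, eigen, zpow_neg, zpow_sub₀ hq, zpow_add₀ hq, zpow_ofNat]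
  have hW : q ^ N ≠ 0 := zpow_ne_zero _ hq
  have hA : q ^ a ≠ 0 := zpow_ne_zero _ hq
  have hY : q ^ y ≠ 0 := zpow_ne_zero _ hq
  field_simp
  ring

/-- The coefficients `coeffA` transfer a difference operator in `y` from the inner univariate
polynomial to the outer one. -/
theorem coeffA_op (g : Generic5 q c0 c1 c2 c3 c4 N) (hh : h ^ 2 = q * c2) (a : ℤ) {x y ε' : ℤ}
    (hε' : ε' = 1 ∨ ε' = 0 ∨ ε' = -1) (hx : 0 ≤ x) (hxN : x ≤ N - y) :
    coeffA q h c0 c1 c2 c3 c4 N 1 ε' x y * racah q h c3 c2 c1 (N - (y - ε')) a (x - 1) +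
      coeffA q h c0 c1 c2 c3 c4 N 0 ε' x y * racah q h c3 c2 c1 (N - (y - ε')) a x +
      coeffA q h c0 c1 c2 c3 c4 N (-1) ε' x y * racah q h c3 c2 c1 (N - (y - ε')) a (x + 1) =
      Phi q c3 c0 c4 (N - a) ε' y * racah q h c3 c2 c1 (N - y) a x := by
  have g3 := g.generic3.swap
  rcases hε' with rfl | rfl | rfl
  · rw [← coeffA_fPlus g, coeffA_plus g (by simp), coeffA_plus g (by simp),
      coeffA_plus g (by simp), show N - (y - 1) = N - y + 1 by ring]
    linear_combination -c3 * q ^ (N + 1) * FPlus q c4 c0 y * racah_plus g3 hh a hx hxN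
  · rw [← coeffA_eigen g, coeffA_zero g (by simp), coeffA_zero g (by simp),
      coeffA_zero g (by simp), sub_zero]
    norm_num
    linear_combination c3 * q ^ (N + 1) * (FPlus q c4 c0 y + FMinus q c4 c0 y) *
      racah_diff (h := h) g3 (a := a) hx hxN
  -- The lowering relation is stated from bound `M` to `M + 1`, hence the bound `N - y` is written
  -- as a successor.
  · obtain ⟨M, hM⟩ : ∃ M, N - y = M + 1 := ⟨N - y - 1, by ring⟩
    rw [← coeffA_fMinus g, coeffA_minus, coeffA_minus, coeffA_minus, hM,
      show N - (y - -1) = M by linarith]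
    rw [hM] at hxN
    linear_combination -c3 * q ^ (N + 1) * FMinus q c4 c0 y * racah_minus g3 hh a hx hxN

end coeffA

/-! ### The coefficients of the second equation as `q`-commutators. -/

theorem omega_zero (q h : ℂ) : omega q h 0 = 1 := by simp [omega]

theorem omega_one (q h : ℂ) : omega q h 1 = -h * q := by simp [omega]

theorem omega_neg_one (q h : ℂ) : omega q h (-1) = -h⁻¹ := by simp [omega]

theorem omega_add_one {q h : ℂ} (hq : q ≠ 0) (hh : h ≠ 0) (a : ℤ) :
    omega q h (a + 1) = omega q h a * (-h * q ^ (a + 1)) := by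
  have e : (a + 1) * (a + 1 + 1) / 2 = a * (a + 1) / 2 + (a + 1) := by
    rw [show (a + 1) * (a + 1 + 1) = a * (a + 1) + (a + 1) * 2 by ring,
      Int.add_mul_ediv_right _ _ (by norm_num)]
  rw [omega, omega, e, zpow_add₀ hq, zpow_add_one₀ hh, zpow_add_one₀ (by norm_num)]
  ring

/-- The eigenvalue `q^{-x} + c q^{x+1}`. -/
def xEig (q c : ℂ) (x : ℤ) : ℂ := q ^ (-x) + c * q ^ (x + 1)

theorem eigen_eq {q : ℂ} (hq : q ≠ 0) (c : ℂ) (x : ℤ) : eigen q c x = xEig q c x - (1 + c * q) := by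
  have hX : q ^ x ≠ 0 := zpow_ne_zero _ hq
  simp only [eigen, xEig, zpow_neg, zpow_add_one₀ hq]
  field_simp
  ring

section weights

variable (q c0 c1 c2 c3 c4 h : ℂ) (M y : ℤ)

/-- The coefficient of `F^+_y` after cancellation of its common factor. -/
def bPlus : ℂ := (1 - q ^ y) * (1 - c3 * q ^ y) /
  ((1 - c0 * c3 * (q ^ y * q ^ y)) * (1 - c0 * c3 * (q ^ y * q ^ y * q)))

/-- The counterpart for `F^-`: for generic parameters `F^+_y(c₃,c₀) = c₃c₀²q^{y+1} bPlus` and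
`F^-_y(c₃,c₀) = c₀c₃q^{y+1} bMinus`. -/
def bMinus : ℂ := (1 - c0 * (q ^ y * q)) * (1 - c0 * c3 * q * q ^ y) /
  ((1 - c0 * c3 * (q ^ y * q ^ y * q)) * (1 - c0 * c3 * (q ^ y * q ^ y * q ^ 2)))

/-- Weight of the `q`-commutator. The denominator `1 - q²` cancels the factor of `ξ(x) - qξ(x∓1)`,
where `ξ` is `xEig`. -/
def alphaPlus : ℂ :=
  -c3 ^ 2 * c0 ^ 2 * (q ^ y * q ^ y * q ^ y * q ^ M * q ^ 2) * bPlus q c0 c3 y / (1 - q ^ 2)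

def alphaMinus : ℂ := -c3 * (q ^ M * q ^ y * q) * bMinus q c0 c3 y / (1 - q ^ 2)

/-- Weight of the correction to the `q`-commutator: it multiplies the scalar `fPlus` in the variable
picture and the adjoint contiguity operator in the degree picture. -/
def deltaPlus : ℂ := -(1 - q) * alphaPlus q c0 c3 M y * c1 * c2 * q * (1 + c4) / (c4 * h)

def deltaMinus : ℂ := -(1 - q) * alphaMinus q c0 c3 M y * h * (1 + c4)

def kappa : ℂ := c0 ^ 2 * c3 * q * (q ^ y * q ^ y) * bPlus q c0 c3 y + bMinus q c0 c3 y - 1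

def alphaZero : ℂ := kappa q c0 c3 y * c3 * q * (q ^ M * q ^ y) / (1 - q ^ 2)

/-- Independent of both the variable `x` and the degree, hence it acts as the same scalar in both
pictures. -/
def etaZero : ℂ :=
  c3 * q * q ^ y * (1 + c2) * (c0 * bPlus q c0 c3 y + bMinus q c0 c3 y) - c2 * c3 * q - 1 -
    (1 - q) * alphaZero q c0 c3 M y *
      (c1 * c2 * q * (1 + 1 / (c1 * q * q ^ M) + c2 * c4 * q * q ^ M + c4) + 1 / q ^ M +
        c1 * c2 * c4 * q ^ 2 * q ^ M + c2 * q + c2 * c4 * q)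

end weights

section coefficients

variable {q c0 c1 c2 c3 c4 h0 h2 g gy g1 : ℂ} {N y : ℤ}

/-- The right side is the coefficient at shift `ε` of `α(ξT - qTξ)` plus a diagonal term, where `T`
has coefficients `PhiPlus` and `ξ` is multiplication by `xEig q (c2 * c4)`. For `ε = ±1` the
difference `ξ(x) - qξ(x-ε)` is the monomial in `q^x` produced by `ω_{-ε}`; for `ε = 0` a multiple of
`fPlus` remains. -/
theorem reflected_plus (G : Generic5 q c0 c1 c2 c3 c4 N) (e0 : h0 ^ 2 = q * c0)
    (e2 : h2 ^ 2 = q * c2) (eg : g * h0 * q ^ (N + 1) * c3 = 1)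
    (ey : gy * h2 * q ^ (N + 1) * c4 = 1) {ε : ℤ} (hε : ε = 1 ∨ ε = 0 ∨ ε = -1) (x : ℤ) :
    omega q (q ^ x * g) (-ε) / omega q (q ^ y * gy) (-1) *
      coeffA q h0 c2 c1 c0 c3 c4 N 1 ε y x =
      alphaPlus q c0 c3 (N - y) y * (xEig q (c2 * c4) x - q * xEig q (c2 * c4) (x - ε)) *
        PhiPlus q h2 c1 c2 c4 (N - y) ε x +
      if ε = 0 then deltaPlus q c0 c1 c2 c3 c4 h2 (N - y) y * fPlus q c1 c2 c4 (N - y) x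
      else 0 := by
  have hq := G.q_ne
  have hr := G.rel
  have h0' : c0 ≠ 0 := G.c0_ne
  have h2' : c2 ≠ 0 := G.rotate.rotate.c0_ne
  have h3' : c3 ≠ 0 := G.rotate.rotate.rotate.c0_ne
  have h4' : c4 ≠ 0 := G.rotate.rotate.rotate.rotate.c0_ne
  have hV : q ^ N ≠ 0 := zpow_ne_zero _ hq
  have hX : q ^ x ≠ 0 := zpow_ne_zero _ hq
  have hY : q ^ y ≠ 0 := zpow_ne_zero _ hq
  have d0 : 1 - c2 * c4 * (q ^ x * q ^ x) ≠ 0 := G.n24.ne (x + x) (by rw [zpow_add₀ hq])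
  have d1 : 1 - c2 * c4 * (q ^ x * q ^ x * q) ≠ 0 :=
    G.n24.ne (x + x + 1) (by rw [zpow_add_one₀ hq, zpow_add₀ hq])
  have d2 : 1 - c2 * c4 * (q ^ x * q ^ x * q ^ 2) ≠ 0 :=
    G.n24.ne (x + x + 2) (by rw [zpow_add₀ hq, zpow_add₀ hq, zpow_ofNat])
  have b0 : 1 - c0 * c3 * (q ^ y * q ^ y) ≠ 0 := G.n03.ne (y + y) (by rw [zpow_add₀ hq])
  have b1 : 1 - c0 * c3 * (q ^ y * q ^ y * q) ≠ 0 :=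
    G.n03.ne (y + y + 1) (by rw [zpow_add_one₀ hq, zpow_add₀ hq])
  have q2 : 1 - q ^ 2 ≠ 0 := one_sub_ne G.q_pow 2 (by norm_num) (by norm_cast)
  have hh0 : h0 ≠ 0 := by rintro rfl; simp at eg
  have hh2 : h2 ≠ 0 := by rintro rfl; simp at ey
  -- `g`, `gy` and `c₁` are determined by the remaining quantities, which become independent after
  -- these substitutions.
  obtain rfl : g = 1 / (h0 * q ^ (N + 1) * c3) := by
    rw [eq_div_iff (by positivity), ← eg]; ring
  obtain rfl : gy = 1 / (h2 * q ^ (N + 1) * c4) := by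
    rw [eq_div_iff (by positivity), ← ey]; ring
  obtain rfl : c1 = 1 / (q ^ (2 * N + 3) * (c0 * c2 * c3 * c4)) := by
    rw [eq_div_iff (by positivity), ← hr]; ring
  have G' := G.swap01.swap12.swap01
  have G34 := G.swap34.generic3
  clear hr eg ey
  rcases hε with rfl | rfl | rfl
  · rw [coeffA_plus G' (by simp), FPlus_closed hq, PhiPlus_one G'.generic3 e0,
      PhiPlus_one G34 e2, omega_neg_one, omega_neg_one]
    simp only [alphaPlus, bPlus, xEig, zpow_neg, zpow_sub₀ hq, zpow_add_one₀ hq,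
      two_mul, zpow_add₀ hq, zpow_ofNat, one_ne_zero, if_false]
    clear G G' G34 e0 e2
    generalize q ^ N = V at *
    generalize q ^ x = X at *
    generalize q ^ y = Y at *
    generalize 1 - c0 * c3 * (Y * Y) = B0 at *
    generalize 1 - c0 * c3 * (Y * Y * q) = B1 at *
    generalize 1 - c2 * c4 * (X * X) = D0 at *
    generalize 1 - c2 * c4 * (X * X * q) = D1 at *
    field_simp
    ring
  · rw [coeffA_zero G' (by simp), FPlus_closed hq, FMinus_closed hq (mul_comm c2 c4 ▸ G.n24),
      Phi_one G'.generic3, PhiPlus_zero hq, PhiPlus_one G34 e2, PhiPlus_neg_one G34 e2, neg_zero,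
      omega_zero, omega_neg_one, fPlus_eq hq]
    simp only [alphaPlus, deltaPlus, bPlus, xEig, zpow_neg, zpow_sub₀ hq, zpow_add_one₀ hq,
      two_mul, zpow_add₀ hq, zpow_ofNat, one_ne_zero, if_false, if_true, sub_zero]
    clear G G' G34 e0 e2
    generalize q ^ N = V at *
    generalize q ^ x = X at *
    generalize q ^ y = Y at *
    generalize 1 - c0 * c3 * (Y * Y) = B0 at *
    generalize 1 - c0 * c3 * (Y * Y * q) = B1 at *
    generalize hD0 : 1 - c2 * c4 * (X * X) = D0 at *
    generalize hD1 : 1 - c2 * c4 * (X * X * q) = D1 at *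
    generalize hD2 : 1 - c2 * c4 * (X * X * q ^ 2) = D2 at *
    field_simp
    subst hD0 hD1 hD2
    ring
  · rw [coeffA_minus, FMinus_closed hq G.n24, neg_neg, omega_one, omega_neg_one,
      PhiPlus_neg_one G34 e2, show N - x = N - x - 1 + 1 by ring, PhiMinus_one G'.generic3]
    simp only [alphaPlus, bPlus, xEig, zpow_neg, zpow_sub₀ hq, zpow_add_one₀ hq,
      two_mul, zpow_add₀ hq, zpow_ofNat, sub_neg_eq_add]
    norm_num
    clear G G' G34 e2
    generalize q ^ N = V at *
    generalize q ^ x = X at *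
    generalize q ^ y = Y at *
    generalize 1 - c0 * c3 * (Y * Y) = B0 at *
    generalize 1 - c0 * c3 * (Y * Y * q) = B1 at *
    generalize 1 - c2 * c4 * (X * X * q) = D1 at *
    generalize 1 - c2 * c4 * (X * X * q ^ 2) = D2 at *
    field_simp
    ring

end coefficients

section coefficients

variable {q c0 c1 c2 c3 c4 h0 h2 g gy g1 : ℂ} {N y : ℤ}

/-- Same decomposition with `T` the operator of `PhiMinus`. -/
theorem reflected_minus (G : Generic5 q c0 c1 c2 c3 c4 N) (e0 : h0 ^ 2 = q * c0)
    (e2 : h2 ^ 2 = q * c2) (eg : g * h0 * q ^ (N + 1) * c3 = 1)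
    (ey : gy * h2 * q ^ (N + 1) * c4 = 1) {ε : ℤ} (hε : ε = 1 ∨ ε = 0 ∨ ε = -1) (x : ℤ) :
    omega q (q ^ x * g) (-ε) / omega q (q ^ y * gy) 1 *
      coeffA q h0 c2 c1 c0 c3 c4 N (-1) ε y x =
      alphaMinus q c0 c3 (N - y) y * (xEig q (c2 * c4) x - q * xEig q (c2 * c4) (x - ε)) *
        PhiMinus q h2 c2 c4 (N - y) ε x +
      if ε = 0 then deltaMinus q c0 c3 c4 h2 (N - y) y * fMinus q (c2 * c4) (N - y) x
      else 0 := by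
  have hq := G.q_ne
  have hr := G.rel
  have h0' : c0 ≠ 0 := G.c0_ne
  have h2' : c2 ≠ 0 := G.rotate.rotate.c0_ne
  have h3' : c3 ≠ 0 := G.rotate.rotate.rotate.c0_ne
  have h4' : c4 ≠ 0 := G.rotate.rotate.rotate.rotate.c0_ne
  have hV : q ^ N ≠ 0 := zpow_ne_zero _ hq
  have hX : q ^ x ≠ 0 := zpow_ne_zero _ hq
  have hY : q ^ y ≠ 0 := zpow_ne_zero _ hq
  have d0 : 1 - c2 * c4 * (q ^ x * q ^ x) ≠ 0 := G.n24.ne (x + x) (by rw [zpow_add₀ hq])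
  have d1 : 1 - c2 * c4 * (q ^ x * q ^ x * q) ≠ 0 :=
    G.n24.ne (x + x + 1) (by rw [zpow_add_one₀ hq, zpow_add₀ hq])
  have d2 : 1 - c2 * c4 * (q ^ x * q ^ x * q ^ 2) ≠ 0 :=
    G.n24.ne (x + x + 2) (by rw [zpow_add₀ hq, zpow_add₀ hq, zpow_ofNat])
  have b1 : 1 - c0 * c3 * (q ^ y * q ^ y * q) ≠ 0 :=
    G.n03.ne (y + y + 1) (by rw [zpow_add_one₀ hq, zpow_add₀ hq])
  have b2 : 1 - c0 * c3 * (q ^ y * q ^ y * q ^ 2) ≠ 0 :=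
    G.n03.ne (y + y + 2) (by rw [zpow_add₀ hq, zpow_add₀ hq, zpow_ofNat])
  have q2 : 1 - q ^ 2 ≠ 0 := one_sub_ne G.q_pow 2 (by norm_num) (by norm_cast)
  have hh0 : h0 ≠ 0 := by rintro rfl; simp at eg
  have hh2 : h2 ≠ 0 := by rintro rfl; simp at ey
  obtain rfl : g = 1 / (h0 * q ^ (N + 1) * c3) := by
    rw [eq_div_iff (by positivity), ← eg]; ring
  obtain rfl : gy = 1 / (h2 * q ^ (N + 1) * c4) := by
    rw [eq_div_iff (by positivity), ← ey]; ring
  obtain rfl : c1 = 1 / (q ^ (2 * N + 3) * (c0 * c2 * c3 * c4)) := by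
    rw [eq_div_iff (by positivity), ← hr]; ring
  have G' := G.swap01.swap12.swap01
  have G34 := G.swap34.generic3
  clear hr eg ey
  have eM : N - y = N - y - 1 + 1 := by ring
  rcases hε with rfl | rfl | rfl
  · rw [coeffA_plus G' (by simp), FPlus_closed hq, PhiPlus_neg_one G'.generic3 e0,
      eM, PhiMinus_one G34, omega_one, omega_neg_one]
    simp only [alphaMinus, bMinus, xEig, zpow_neg, zpow_sub₀ hq, zpow_add_one₀ hq,
      two_mul, zpow_add₀ hq, zpow_ofNat, one_ne_zero, if_false]
    clear G G' G34 e0 e2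
    generalize q ^ N = V at *
    generalize q ^ x = X at *
    generalize q ^ y = Y at *
    generalize 1 - c0 * c3 * (Y * Y * q) = B1 at *
    generalize 1 - c0 * c3 * (Y * Y * q ^ 2) = B2 at *
    generalize 1 - c2 * c4 * (X * X) = D0 at *
    generalize 1 - c2 * c4 * (X * X * q) = D1 at *
    field_simp
    ring
  · rw [coeffA_zero G' (by simp), FPlus_closed hq, FMinus_closed hq (mul_comm c2 c4 ▸ G.n24),
      Phi_neg_one G'.generic3, eM, PhiMinus_zero hq, PhiMinus_one G34, PhiMinus_neg_one G34,
      neg_zero, omega_zero, omega_one, fMinus_eq hq]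
    simp only [alphaMinus, deltaMinus, bMinus, xEig, zpow_neg, zpow_sub₀ hq, zpow_add_one₀ hq,
      two_mul, zpow_add₀ hq, zpow_ofNat, if_true, sub_zero, neg_eq_zero, one_ne_zero, if_false]
    clear G G' G34 e0 e2
    generalize q ^ N = V at *
    generalize q ^ x = X at *
    generalize q ^ y = Y at *
    generalize 1 - c0 * c3 * (Y * Y * q) = B1 at *
    generalize 1 - c0 * c3 * (Y * Y * q ^ 2) = B2 at *
    generalize hD0 : 1 - c2 * c4 * (X * X) = D0 at *
    generalize hD1 : 1 - c2 * c4 * (X * X * q) = D1 at *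
    generalize hD2 : 1 - c2 * c4 * (X * X * q ^ 2) = D2 at *
    field_simp
    subst hD0 hD1 hD2
    ring
  · rw [coeffA_minus, FMinus_closed hq G.n24, neg_neg, omega_one, omega_one, eM,
      PhiMinus_neg_one G34, show N - x = N - x - 1 + 1 by ring, PhiMinus_neg_one G'.generic3]
    simp only [alphaMinus, bMinus, xEig, zpow_neg, zpow_sub₀ hq, zpow_add_one₀ hq,
      zpow_ofNat, sub_neg_eq_add]
    norm_num
    clear G G' G34 e0 e2
    generalize q ^ N = V at *
    generalize q ^ x = X at *
    generalize q ^ y = Y at *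
    generalize 1 - c0 * c3 * (Y * Y * q) = B1 at *
    generalize 1 - c0 * c3 * (Y * Y * q ^ 2) = B2 at *
    generalize 1 - c2 * c4 * (X * X * q) = D1 at *
    generalize 1 - c2 * c4 * (X * X * q ^ 2) = D2 at *
    field_simp
    ring

end coefficients

section coefficients

variable {q c0 c1 c2 c3 c4 h0 h2 g gy g1 : ℂ} {N y : ℤ}

/-- Here `T` is the difference operator, shifted by `1 + c₁c₂q` so that its eigenvalue is `xEig`
rather than `eigen`; the correction is a scalar. -/
theorem reflected_zero (G : Generic5 q c0 c1 c2 c3 c4 N) (e0 : h0 ^ 2 = q * c0)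
    (eg : g * h0 * q ^ (N + 1) * c3 = 1)
    {ε : ℤ} (hε : ε = 1 ∨ ε = 0 ∨ ε = -1) (x : ℤ) :
    omega q (q ^ x * g) (-ε) *
      coeffA q h0 c2 c1 c0 c3 c4 N 0 ε y x =
      alphaZero q c0 c3 (N - y) y * (xEig q (c2 * c4) x - q * xEig q (c2 * c4) (x - ε)) *
        (Phi q c1 c2 c4 (N - y) ε x + if ε = 0 then 1 + c1 * c2 * q else 0) +
      if ε = 0 then etaZero q c0 c1 c2 c3 c4 (N - y) y
      else 0 := by
  have hq := G.q_ne
  have hr := G.rel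
  have h0' : c0 ≠ 0 := G.c0_ne
  have h2' : c2 ≠ 0 := G.rotate.rotate.c0_ne
  have h3' : c3 ≠ 0 := G.rotate.rotate.rotate.c0_ne
  have h4' : c4 ≠ 0 := G.rotate.rotate.rotate.rotate.c0_ne
  have hV : q ^ N ≠ 0 := zpow_ne_zero _ hq
  have hX : q ^ x ≠ 0 := zpow_ne_zero _ hq
  have hY : q ^ y ≠ 0 := zpow_ne_zero _ hq
  have d0 : 1 - c2 * c4 * (q ^ x * q ^ x) ≠ 0 := G.n24.ne (x + x) (by rw [zpow_add₀ hq])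
  have d1 : 1 - c2 * c4 * (q ^ x * q ^ x * q) ≠ 0 :=
    G.n24.ne (x + x + 1) (by rw [zpow_add_one₀ hq, zpow_add₀ hq])
  have d2 : 1 - c2 * c4 * (q ^ x * q ^ x * q ^ 2) ≠ 0 :=
    G.n24.ne (x + x + 2) (by rw [zpow_add₀ hq, zpow_add₀ hq, zpow_ofNat])
  have b0 : 1 - c0 * c3 * (q ^ y * q ^ y) ≠ 0 := G.n03.ne (y + y) (by rw [zpow_add₀ hq])
  have b1 : 1 - c0 * c3 * (q ^ y * q ^ y * q) ≠ 0 :=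
    G.n03.ne (y + y + 1) (by rw [zpow_add_one₀ hq, zpow_add₀ hq])
  have b2 : 1 - c0 * c3 * (q ^ y * q ^ y * q ^ 2) ≠ 0 :=
    G.n03.ne (y + y + 2) (by rw [zpow_add₀ hq, zpow_add₀ hq, zpow_ofNat])
  have q2 : 1 - q ^ 2 ≠ 0 := one_sub_ne G.q_pow 2 (by norm_num) (by norm_cast)
  have hh0 : h0 ≠ 0 := by rintro rfl; simp at eg
  obtain rfl : g = 1 / (h0 * q ^ (N + 1) * c3) := by
    rw [eq_div_iff (by positivity), ← eg]; ring
  obtain rfl : c1 = 1 / (q ^ (2 * N + 3) * (c0 * c2 * c3 * c4)) := by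
    rw [eq_div_iff (by positivity), ← hr]; ring
  have G' := G.swap01.swap12.swap01
  have G34 := G.swap34.generic3
  clear hr eg
  rcases hε with rfl | rfl | rfl
  · rw [coeffA_plus G' (by simp), FPlus_closed hq, PhiPlus_zero hq, PhiPlus_one G'.generic3 e0,
      PhiPlus_neg_one G'.generic3 e0, Phi_one G34, omega_neg_one]
    simp only [alphaZero, kappa, bPlus, bMinus, xEig, zpow_neg, zpow_sub₀ hq, zpow_add_one₀ hq,
      zpow_add₀ hq, two_mul, zpow_ofNat, one_ne_zero, if_false]
    clear G G' G34 e0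
    generalize q ^ N = V at *
    generalize q ^ x = X at *
    generalize q ^ y = Y at *
    generalize hB0 : 1 - c0 * c3 * (Y * Y) = B0 at *
    generalize hB1 : 1 - c0 * c3 * (Y * Y * q) = B1 at *
    generalize hB2 : 1 - c0 * c3 * (Y * Y * q ^ 2) = B2 at *
    generalize 1 - c2 * c4 * (X * X) = D0 at *
    generalize 1 - c2 * c4 * (X * X * q) = D1 at *
    field_simp
    subst hB0 hB1 hB2
    ring
  · rw [coeffA_zero G' (by simp), FPlus_closed hq, FMinus_closed hq (mul_comm c2 c4 ▸ G.n24),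
      Phi_zero, Phi_zero, Phi_one G'.generic3, Phi_neg_one G'.generic3, Phi_one G34,
      Phi_neg_one G34, neg_zero, omega_zero]
    simp only [alphaZero, etaZero, kappa, bPlus, bMinus, xEig, zpow_neg, zpow_sub₀ hq, zpow_add_one₀ hq,
      zpow_add₀ hq, two_mul, zpow_ofNat, zpow_one, sub_neg_eq_add, neg_eq_zero, one_ne_zero, if_true, sub_zero]
    clear G G' G34 e0
    generalize q ^ N = V at *
    generalize q ^ x = X at *
    generalize q ^ y = Y at *
    generalize hB0 : 1 - c0 * c3 * (Y * Y) = B0 at *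
    generalize hB1 : 1 - c0 * c3 * (Y * Y * q) = B1 at *
    generalize hB2 : 1 - c0 * c3 * (Y * Y * q ^ 2) = B2 at *
    generalize hD0 : 1 - c2 * c4 * (X * X) = D0 at *
    generalize hD1 : 1 - c2 * c4 * (X * X * q) = D1 at *
    generalize hD2 : 1 - c2 * c4 * (X * X * q ^ 2) = D2 at *
    field_simp
    subst hB0 hB1 hB2 hD0 hD1 hD2
    ring
  · rw [coeffA_minus, FMinus_closed hq G.n24, neg_neg, omega_one, 
      Phi_neg_one G34, show N - x = N - x - 1 + 1 by ring, PhiMinus_zero hq,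
      PhiMinus_one G'.generic3, PhiMinus_neg_one G'.generic3]
    simp only [alphaZero, kappa, bPlus, bMinus, xEig, zpow_neg, zpow_sub₀ hq, zpow_add_one₀ hq,
      zpow_add₀ hq, two_mul, zpow_ofNat, zpow_one, sub_neg_eq_add, neg_eq_zero, one_ne_zero, if_false]
    clear G G' G34 e0
    generalize q ^ N = V at *
    generalize q ^ x = X at *
    generalize q ^ y = Y at *
    generalize hB0 : 1 - c0 * c3 * (Y * Y) = B0 at *
    generalize hB1 : 1 - c0 * c3 * (Y * Y * q) = B1 at *
    generalize hB2 : 1 - c0 * c3 * (Y * Y * q ^ 2) = B2 at *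
    generalize 1 - c2 * c4 * (X * X * q) = D1 at *
    generalize 1 - c2 * c4 * (X * X * q ^ 2) = D2 at *
    field_simp
    subst hB0 hB1 hB2
    ring

end coefficients

section coefficients

variable {q c0 c1 c2 c3 c4 h0 h2 g gy g1 : ℂ} {N y : ℤ}

/-- The `q`-commutator of `reflected_plus` seen on the degree: `T` multiplies by `fPlus` and passes
from bound `N-y+1` to `N-y`, while `ξ` acts by the recurrence. The recurrence is therefore taken at
bound `N-y` in `ξT` and at `N-y+1` in `Tξ`. The added `1 + c₂c₄q` turns `eigen` into `xEig`. -/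
theorem dual_plus (G : Generic5 q c0 c1 c2 c3 c4 N) (e0 : h0 ^ 2 = q * c0)
    (e2 : h2 ^ 2 = q * c2) (eg : g1 * h0 * q ^ (N + 1) * c4 = 1) {e : ℤ} (he : e = 1 ∨ e = 0 ∨ e = -1) (b : ℤ) :
    omega q g1 b * coeffA q h0 c2 c4 c0 c3 c1 N 1 e y b =
      omega q g1 (b - e) * (alphaPlus q c0 c3 (N - y) y *
        (fPlus q c4 c2 c1 (N - y) (b - e) *
          (Phi q c4 c2 c1 (N - y) e b + if e = 0 then 1 + c2 * c4 * q else 0) -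
        q * fPlus q c4 c2 c1 (N - y) b *
          (Phi q c4 c2 c1 (N - y + 1) e b + if e = 0 then 1 + c2 * c4 * q else 0)) +
        deltaPlus q c0 c1 c2 c3 c4 h2 (N - y) y * PhiPlus q h2 c4 c2 c1 (N - y) e b) := by
  have hq := G.q_ne
  have hr := G.rel
  have h0' : c0 ≠ 0 := G.c0_ne
  have h1' : c1 ≠ 0 := G.rotate.c0_ne
  have h2' : c2 ≠ 0 := G.rotate.rotate.c0_ne
  have h3' : c3 ≠ 0 := G.rotate.rotate.rotate.c0_ne
  have h4' : c4 ≠ 0 := G.rotate.rotate.rotate.rotate.c0_ne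
  have hV : q ^ N ≠ 0 := zpow_ne_zero _ hq
  have hX : q ^ b ≠ 0 := zpow_ne_zero _ hq
  have hY : q ^ y ≠ 0 := zpow_ne_zero _ hq
  have n21 : NotPow q (c2 * c1) := mul_comm c1 c2 ▸ G.n12
  have d0 : 1 - c2 * c1 * (q ^ b * q ^ b) ≠ 0 := n21.ne (b + b) (by rw [zpow_add₀ hq])
  have d1 : 1 - c2 * c1 * (q ^ b * q ^ b * q) ≠ 0 :=
    n21.ne (b + b + 1) (by rw [zpow_add_one₀ hq, zpow_add₀ hq])
  have d2 : 1 - c2 * c1 * (q ^ b * q ^ b * q ^ 2) ≠ 0 :=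
    n21.ne (b + b + 2) (by rw [zpow_add₀ hq, zpow_add₀ hq, zpow_ofNat])
  have b0 : 1 - c0 * c3 * (q ^ y * q ^ y) ≠ 0 := G.n03.ne (y + y) (by rw [zpow_add₀ hq])
  have b1 : 1 - c0 * c3 * (q ^ y * q ^ y * q) ≠ 0 :=
    G.n03.ne (y + y + 1) (by rw [zpow_add_one₀ hq, zpow_add₀ hq])
  have hh2 : h2 ≠ 0 := G.generic3.h_ne e2
  have q2 : 1 - q ^ 2 ≠ 0 := one_sub_ne G.q_pow 2 (by norm_num) (by norm_cast)
  have hh0 : h0 ≠ 0 := by rintro rfl; simp at eg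
  have hg1 : g1 ≠ 0 := by rintro rfl; simp at eg
  -- The ratio of neighbouring factors `ω` is a monomial, so the common `ω` splits off and a
  -- rational identity remains.
  have hs : omega q g1 b = omega q g1 (b - 1) * (-g1 * q ^ b) := by
    simpa using omega_add_one hq hg1 (b - 1)
  have hs' := omega_add_one hq hg1 b
  obtain rfl : g1 = 1 / (h0 * q ^ (N + 1) * c4) := by
    rw [eq_div_iff (by positivity), ← eg]; ring
  clear eg hg1
  have G' := G.swap12.swap01.swap23.swap34.swap23.swap12
  have G3 := G'.generic3
  have G421 := G.swap34.swap23.swap12.swap23.generic3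
  rcases he with rfl | rfl | rfl
  · rw [hs, mul_assoc (omega _ _ _)]
    congr 1
    rw [coeffA_plus G' (by simp), FPlus_closed hq, PhiPlus_one G3 e0, Phi_one G421,
      Phi_one G421, PhiPlus_one G421 e2]
    simp only [alphaPlus, deltaPlus, bPlus, fPlus_eq hq, zpow_sub₀ hq, zpow_add_one₀ hq,
      zpow_add₀ hq, zpow_ofNat, one_ne_zero, if_false, add_zero]
    rw [two_mul, zpow_add₀ hq, zpow_add₀ hq, zpow_ofNat] at hr
    clear G G' G3 G421 hs hs'
    generalize q ^ N = V at *
    generalize q ^ b = X at *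
    generalize q ^ y = Y at *
    generalize 1 - c0 * c3 * (Y * Y) = B0 at *
    generalize 1 - c0 * c3 * (Y * Y * q) = B1 at *
    obtain rfl : c0 = 1 / (V * V * q ^ 3 * (c1 * c2 * c3 * c4)) := by
      rw [eq_div_iff (by positivity), ← hr]; ring
    clear hr h0'
    generalize 1 - c2 * c1 * (X * X) = D0 at *
    generalize 1 - c2 * c1 * (X * X * q) = D1 at *
    field_simp
    rw [e2, e0]
    field_simp
    ring
  · rw [sub_zero]
    congr 1
    rw [coeffA_zero G' (by simp), FPlus_closed hq, FMinus_closed hq n21, Phi_zero, Phi_zero, Phi_one G3, Phi_one G421,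
      Phi_one G421, Phi_neg_one G421, Phi_neg_one G421, PhiPlus_zero hq, PhiPlus_one G421 e2,
      PhiPlus_neg_one G421 e2]
    simp only [alphaPlus, deltaPlus, bPlus, fPlus_eq hq, zpow_sub₀ hq, zpow_add_one₀ hq,
      zpow_add₀ hq, zpow_ofNat, one_ne_zero, if_false, if_true, sub_zero]
    rw [two_mul, zpow_add₀ hq, zpow_add₀ hq, zpow_ofNat] at hr
    clear G G' G3 G421 hs hs'
    generalize q ^ N = V at *
    generalize q ^ b = X at *
    generalize q ^ y = Y at *
    generalize 1 - c0 * c3 * (Y * Y) = B0 at *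
    generalize 1 - c0 * c3 * (Y * Y * q) = B1 at *
    obtain rfl : c0 = 1 / (V * V * q ^ 3 * (c1 * c2 * c3 * c4)) := by
      rw [eq_div_iff (by positivity), ← hr]; ring
    clear hr h0'
    generalize hD0 : 1 - c2 * c1 * (X * X) = D0 at *
    generalize hD1 : 1 - c2 * c1 * (X * X * q) = D1 at *
    generalize hD2 : 1 - c2 * c1 * (X * X * q ^ 2) = D2 at *
    field_simp
    rw [e2]
    subst hD0 hD1 hD2
    ring
  · rw [sub_neg_eq_add, hs', mul_assoc (omega _ _ _)]
    congr 1
    rw [coeffA_minus, FMinus_closed hq n21, show N - b = N - b - 1 + 1 by ring, PhiMinus_one G3,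
      Phi_neg_one G421, Phi_neg_one G421, PhiPlus_neg_one G421 e2]
    simp only [alphaPlus, deltaPlus, bPlus, fPlus_eq hq, zpow_sub₀ hq, zpow_add_one₀ hq,
      zpow_add₀ hq, zpow_ofNat, sub_neg_eq_add, neg_eq_zero, one_ne_zero, if_false, add_zero]
    rw [two_mul, zpow_add₀ hq, zpow_add₀ hq, zpow_ofNat] at hr
    clear G G' G3 G421 hs hs'
    generalize q ^ N = V at *
    generalize q ^ b = X at *
    generalize q ^ y = Y at *
    generalize 1 - c0 * c3 * (Y * Y) = B0 at *
    generalize 1 - c0 * c3 * (Y * Y * q) = B1 at *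
    obtain rfl : c0 = 1 / (V * V * q ^ 3 * (c1 * c2 * c3 * c4)) := by
      rw [eq_div_iff (by positivity), ← hr]; ring
    clear hr h0'
    generalize 1 - c2 * c1 * (X * X * q) = D1 at *
    generalize 1 - c2 * c1 * (X * X * q ^ 2) = D2 at *
    field_simp
    rw [e2, e0]
    field_simp
    ring

end coefficients

section coefficients

variable {q c0 c1 c2 c3 c4 h0 h2 g gy g1 : ℂ} {N y : ℤ}

/-- Degree picture of `reflected_minus`; `T` now raises the bound from `N-y-1` to `N-y`, so the
second recurrence has bound `N-y-1`. -/
theorem dual_minus (G : Generic5 q c0 c1 c2 c3 c4 N) (e0 : h0 ^ 2 = q * c0)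
    (e2 : h2 ^ 2 = q * c2) (eg : g1 * h0 * q ^ (N + 1) * c4 = 1) {e : ℤ} (he : e = 1 ∨ e = 0 ∨ e = -1) (b : ℤ) :
    omega q g1 b * coeffA q h0 c2 c4 c0 c3 c1 N (-1) e y b =
      omega q g1 (b - e) * (alphaMinus q c0 c3 (N - y) y *
        (fMinus q (c2 * c1) (N - y) (b - e) *
          (Phi q c4 c2 c1 (N - y) e b + if e = 0 then 1 + c2 * c4 * q else 0) -
        q * fMinus q (c2 * c1) (N - y) b *
          (Phi q c4 c2 c1 (N - y - 1) e b + if e = 0 then 1 + c2 * c4 * q else 0)) +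
        deltaMinus q c0 c3 c4 h2 (N - y) y * PhiMinus q h2 c2 c1 (N - y) e b) := by
  have hq := G.q_ne
  have hr := G.rel
  have h0' : c0 ≠ 0 := G.c0_ne
  have h1' : c1 ≠ 0 := G.rotate.c0_ne
  have h2' : c2 ≠ 0 := G.rotate.rotate.c0_ne
  have h3' : c3 ≠ 0 := G.rotate.rotate.rotate.c0_ne
  have h4' : c4 ≠ 0 := G.rotate.rotate.rotate.rotate.c0_ne
  have hV : q ^ N ≠ 0 := zpow_ne_zero _ hq
  have hX : q ^ b ≠ 0 := zpow_ne_zero _ hq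
  have hY : q ^ y ≠ 0 := zpow_ne_zero _ hq
  have n21 : NotPow q (c2 * c1) := mul_comm c1 c2 ▸ G.n12
  have d0 : 1 - c2 * c1 * (q ^ b * q ^ b) ≠ 0 := n21.ne (b + b) (by rw [zpow_add₀ hq])
  have d1 : 1 - c2 * c1 * (q ^ b * q ^ b * q) ≠ 0 :=
    n21.ne (b + b + 1) (by rw [zpow_add_one₀ hq, zpow_add₀ hq])
  have d2 : 1 - c2 * c1 * (q ^ b * q ^ b * q ^ 2) ≠ 0 :=
    n21.ne (b + b + 2) (by rw [zpow_add₀ hq, zpow_add₀ hq, zpow_ofNat])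
  have b1 : 1 - c0 * c3 * (q ^ y * q ^ y * q) ≠ 0 :=
    G.n03.ne (y + y + 1) (by rw [zpow_add_one₀ hq, zpow_add₀ hq])
  have b2 : 1 - c0 * c3 * (q ^ y * q ^ y * q ^ 2) ≠ 0 :=
    G.n03.ne (y + y + 2) (by rw [zpow_add₀ hq, zpow_add₀ hq, zpow_ofNat])
  have hh2 : h2 ≠ 0 := G.generic3.h_ne e2
  have q2 : 1 - q ^ 2 ≠ 0 := one_sub_ne G.q_pow 2 (by norm_num) (by norm_cast)
  have hh0 : h0 ≠ 0 := by rintro rfl; simp at eg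
  have hg1 : g1 ≠ 0 := by rintro rfl; simp at eg
  have hs : omega q g1 b = omega q g1 (b - 1) * (-g1 * q ^ b) := by
    simpa using omega_add_one hq hg1 (b - 1)
  have hs' := omega_add_one hq hg1 b
  obtain rfl : g1 = 1 / (h0 * q ^ (N + 1) * c4) := by
    rw [eq_div_iff (by positivity), ← eg]; ring
  clear eg hg1
  have G' := G.swap12.swap01.swap23.swap34.swap23.swap12
  have G3 := G'.generic3
  have G421 := G.swap34.swap23.swap12.swap23.generic3
  -- The closed forms of `PhiMinus` and `fMinus` are at successor bounds, hence `N - y = M + 1`.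
  obtain ⟨M, rfl⟩ : ∃ M, N = y + M + 1 := ⟨N - y - 1, by ring⟩
  rw [show y + M + 1 - y = M + 1 by ring, add_sub_cancel_right]
  rcases he with rfl | rfl | rfl
  · rw [hs, mul_assoc (omega _ _ _)]
    congr 1
    rw [coeffA_plus G' (by simp), FPlus_closed hq, PhiPlus_neg_one G3 e0, Phi_one G421,
      Phi_one G421, PhiMinus_one G421]
    simp only [alphaMinus, deltaMinus, bMinus, fMinus_eq hq, zpow_sub₀ hq, zpow_add_one₀ hq,
      zpow_add₀ hq, zpow_ofNat, one_ne_zero, if_false, add_zero]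
    rw [two_mul, zpow_add₀ hq, zpow_add₀ hq, zpow_ofNat] at hr
    simp only [zpow_add_one₀ hq, zpow_add₀ hq] at hr
    clear hV G G' G3 G421 hs hs'
    have hW : q ^ M ≠ 0 := zpow_ne_zero _ hq
    generalize q ^ M = W at *
    generalize q ^ b = X at *
    generalize q ^ y = Y at *
    generalize 1 - c0 * c3 * (Y * Y * q) = B1 at *
    generalize 1 - c0 * c3 * (Y * Y * q ^ 2) = B2 at *
    obtain rfl : c0 = 1 / (Y * Y * (W * W) * q ^ 5 * (c1 * c2 * c3 * c4)) := by
      rw [eq_div_iff (by positivity), ← hr]; ring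
    clear hr h0'
    generalize 1 - c2 * c1 * (X * X) = D0 at *
    generalize 1 - c2 * c1 * (X * X * q) = D1 at *
    field_simp
    rw [e2, e0]
    field_simp
    ring
  · rw [sub_zero]
    congr 1
    rw [coeffA_zero G' (by simp), FPlus_closed hq, FMinus_closed hq n21, Phi_zero, Phi_zero, Phi_neg_one G3, Phi_one G421,
      Phi_one G421, Phi_neg_one G421, Phi_neg_one G421, PhiMinus_zero hq, PhiMinus_one G421,
      PhiMinus_neg_one G421]
    simp only [alphaMinus, deltaMinus, bMinus, fMinus_eq hq, zpow_sub₀ hq, zpow_add_one₀ hq,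
      zpow_add₀ hq, zpow_ofNat, neg_eq_zero, one_ne_zero, if_false, if_true, sub_zero]
    rw [two_mul, zpow_add₀ hq, zpow_add₀ hq, zpow_ofNat] at hr
    simp only [zpow_add_one₀ hq, zpow_add₀ hq] at hr
    clear hV G G' G3 G421 hs hs'
    have hW : q ^ M ≠ 0 := zpow_ne_zero _ hq
    generalize q ^ M = W at *
    generalize q ^ b = X at *
    generalize q ^ y = Y at *
    generalize 1 - c0 * c3 * (Y * Y * q) = B1 at *
    generalize 1 - c0 * c3 * (Y * Y * q ^ 2) = B2 at *
    obtain rfl : c0 = 1 / (Y * Y * (W * W) * q ^ 5 * (c1 * c2 * c3 * c4)) := by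
      rw [eq_div_iff (by positivity), ← hr]; ring
    clear hr h0'
    generalize hD0 : 1 - c2 * c1 * (X * X) = D0 at *
    generalize hD1 : 1 - c2 * c1 * (X * X * q) = D1 at *
    generalize hD2 : 1 - c2 * c1 * (X * X * q ^ 2) = D2 at *
    field_simp
    rw [e2]
    subst hD0 hD1 hD2
    ring
  · rw [sub_neg_eq_add, hs', mul_assoc (omega _ _ _)]
    congr 1
    rw [coeffA_minus, FMinus_closed hq n21, show y + M + 1 - b = y + M - b + 1 by ring, PhiMinus_neg_one G3,
      Phi_neg_one G421, Phi_neg_one G421, PhiMinus_neg_one G421]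
    simp only [alphaMinus, deltaMinus, bMinus, fMinus_eq hq, zpow_sub₀ hq, zpow_add_one₀ hq,
      zpow_add₀ hq, zpow_ofNat, sub_neg_eq_add, neg_eq_zero, one_ne_zero, if_false, add_zero]
    rw [two_mul, zpow_add₀ hq, zpow_add₀ hq, zpow_ofNat] at hr
    simp only [zpow_add_one₀ hq, zpow_add₀ hq] at hr
    clear hV G G' G3 G421 hs hs'
    have hW : q ^ M ≠ 0 := zpow_ne_zero _ hq
    generalize q ^ M = W at *
    generalize q ^ b = X at *
    generalize q ^ y = Y at *
    generalize 1 - c0 * c3 * (Y * Y * q) = B1 at *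
    generalize 1 - c0 * c3 * (Y * Y * q ^ 2) = B2 at *
    obtain rfl : c0 = 1 / (Y * Y * (W * W) * q ^ 5 * (c1 * c2 * c3 * c4)) := by
      rw [eq_div_iff (by positivity), ← hr]; ring
    clear hr h0'
    generalize 1 - c2 * c1 * (X * X * q) = D1 at *
    generalize 1 - c2 * c1 * (X * X * q ^ 2) = D2 at *
    field_simp
    rw [e2, e0]
    field_simp
    ring

end coefficients

section coefficients

variable {q c0 c1 c2 c3 c4 h0 h2 g gy g1 : ℂ} {N y : ℤ}

/-- Degree picture of `reflected_zero`: `T` is diagonal with entries `xEig q (c2 * c1)` and the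
bound does not change. -/
theorem dual_zero (G : Generic5 q c0 c1 c2 c3 c4 N) (e0 : h0 ^ 2 = q * c0)
    (eg : g1 * h0 * q ^ (N + 1) * c4 = 1) {e : ℤ} (he : e = 1 ∨ e = 0 ∨ e = -1) (b : ℤ) :
    omega q g1 b * coeffA q h0 c2 c4 c0 c3 c1 N 0 e y b =
      omega q g1 (b - e) * (alphaZero q c0 c3 (N - y) y *
        (xEig q (c2 * c1) (b - e) - q * xEig q (c2 * c1) b) *
          (Phi q c4 c2 c1 (N - y) e b + if e = 0 then 1 + c2 * c4 * q else 0) +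
        if e = 0 then etaZero q c0 c1 c2 c3 c4 (N - y) y else 0) := by
  have hq := G.q_ne
  have hr := G.rel
  have h0' : c0 ≠ 0 := G.c0_ne
  have h1' : c1 ≠ 0 := G.rotate.c0_ne
  have h2' : c2 ≠ 0 := G.rotate.rotate.c0_ne
  have h3' : c3 ≠ 0 := G.rotate.rotate.rotate.c0_ne
  have h4' : c4 ≠ 0 := G.rotate.rotate.rotate.rotate.c0_ne
  have hV : q ^ N ≠ 0 := zpow_ne_zero _ hq
  have hX : q ^ b ≠ 0 := zpow_ne_zero _ hq
  have hY : q ^ y ≠ 0 := zpow_ne_zero _ hq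
  have n21 : NotPow q (c2 * c1) := mul_comm c1 c2 ▸ G.n12
  have d0 : 1 - c2 * c1 * (q ^ b * q ^ b) ≠ 0 := n21.ne (b + b) (by rw [zpow_add₀ hq])
  have d1 : 1 - c2 * c1 * (q ^ b * q ^ b * q) ≠ 0 :=
    n21.ne (b + b + 1) (by rw [zpow_add_one₀ hq, zpow_add₀ hq])
  have d2 : 1 - c2 * c1 * (q ^ b * q ^ b * q ^ 2) ≠ 0 :=
    n21.ne (b + b + 2) (by rw [zpow_add₀ hq, zpow_add₀ hq, zpow_ofNat])
  have b0 : 1 - c0 * c3 * (q ^ y * q ^ y) ≠ 0 := G.n03.ne (y + y) (by rw [zpow_add₀ hq])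
  have b1 : 1 - c0 * c3 * (q ^ y * q ^ y * q) ≠ 0 :=
    G.n03.ne (y + y + 1) (by rw [zpow_add_one₀ hq, zpow_add₀ hq])
  have b2 : 1 - c0 * c3 * (q ^ y * q ^ y * q ^ 2) ≠ 0 :=
    G.n03.ne (y + y + 2) (by rw [zpow_add₀ hq, zpow_add₀ hq, zpow_ofNat])
  have q2 : 1 - q ^ 2 ≠ 0 := one_sub_ne G.q_pow 2 (by norm_num) (by norm_cast)
  have hh0 : h0 ≠ 0 := by rintro rfl; simp at eg
  have hg1 : g1 ≠ 0 := by rintro rfl; simp at eg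
  have hs : omega q g1 b = omega q g1 (b - 1) * (-g1 * q ^ b) := by
    simpa using omega_add_one hq hg1 (b - 1)
  have hs' := omega_add_one hq hg1 b
  obtain rfl : g1 = 1 / (h0 * q ^ (N + 1) * c4) := by
    rw [eq_div_iff (by positivity), ← eg]; ring
  obtain rfl : c4 = 1 / (q ^ (2 * N + 3) * (c0 * c1 * c2 * c3)) := by
    rw [eq_div_iff (by positivity), ← hr]; ring
  clear hr eg hg1 h4'
  have G' := G.swap12.swap01.swap23.swap34.swap23.swap12
  have G3 := G'.generic3
  have G421 := G.swap34.swap23.swap12.swap23.generic3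
  rcases he with rfl | rfl | rfl
  · rw [hs, mul_assoc (omega _ _ _)]
    congr 1
    rw [coeffA_plus G' (by simp), FPlus_closed hq, PhiPlus_zero hq, PhiPlus_one G3 e0, PhiPlus_neg_one G3 e0,
      Phi_one G421]
    simp only [alphaZero, kappa, bPlus, bMinus, xEig, zpow_neg, zpow_sub₀ hq, zpow_add_one₀ hq, two_mul,
      zpow_add₀ hq, zpow_ofNat, one_ne_zero, if_false, add_zero]
    clear G G' G3 G421 hs hs'
    generalize q ^ N = V at *
    generalize q ^ b = X at *
    generalize q ^ y = Y at *
    generalize hB0 : 1 - c0 * c3 * (Y * Y) = B0 at *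
    generalize hB1 : 1 - c0 * c3 * (Y * Y * q) = B1 at *
    generalize hB2 : 1 - c0 * c3 * (Y * Y * q ^ 2) = B2 at *
    generalize 1 - c2 * c1 * (X * X) = D0 at *
    generalize 1 - c2 * c1 * (X * X * q) = D1 at *
    field_simp
    rw [e0]
    field_simp
    subst hB0 hB1 hB2
    ring
  · rw [sub_zero]
    congr 1
    rw [coeffA_zero G' (by simp), FPlus_closed hq, FMinus_closed hq n21, Phi_zero, Phi_zero, Phi_one G3, Phi_neg_one G3,
      Phi_one G421, Phi_neg_one G421]
    simp only [alphaZero, kappa, bPlus, bMinus, xEig, etaZero, zpow_neg, zpow_sub₀ hq, zpow_add_one₀ hq, two_mul,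
      zpow_add₀ hq, zpow_ofNat, if_true, sub_zero]
    clear G G' G3 G421 hs hs'
    generalize q ^ N = V at *
    generalize q ^ b = X at *
    generalize q ^ y = Y at *
    generalize hB0 : 1 - c0 * c3 * (Y * Y) = B0 at *
    generalize hB1 : 1 - c0 * c3 * (Y * Y * q) = B1 at *
    generalize hB2 : 1 - c0 * c3 * (Y * Y * q ^ 2) = B2 at *
    generalize hD0 : 1 - c2 * c1 * (X * X) = D0 at *
    generalize hD1 : 1 - c2 * c1 * (X * X * q) = D1 at *
    generalize hD2 : 1 - c2 * c1 * (X * X * q ^ 2) = D2 at *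
    field_simp
    subst hB0 hB1 hB2 hD0 hD1 hD2
    ring
  · rw [sub_neg_eq_add, hs', mul_assoc (omega _ _ _)]
    congr 1
    rw [coeffA_minus, FMinus_closed hq n21, show N - b = N - b - 1 + 1 by ring, PhiMinus_zero hq, PhiMinus_one G3,
      PhiMinus_neg_one G3, Phi_neg_one G421]
    simp only [alphaZero, kappa, bPlus, bMinus, xEig, zpow_neg, zpow_sub₀ hq, zpow_add_one₀ hq, two_mul,
      zpow_add₀ hq, zpow_ofNat, sub_neg_eq_add, neg_eq_zero, one_ne_zero, if_false, add_zero]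
    clear G G' G3 G421 hs hs'
    generalize q ^ N = V at *
    generalize q ^ b = X at *
    generalize q ^ y = Y at *
    generalize hB0 : 1 - c0 * c3 * (Y * Y) = B0 at *
    generalize hB1 : 1 - c0 * c3 * (Y * Y * q) = B1 at *
    generalize hB2 : 1 - c0 * c3 * (Y * Y * q ^ 2) = B2 at *
    generalize 1 - c2 * c1 * (X * X * q) = D1 at *
    generalize 1 - c2 * c1 * (X * X * q ^ 2) = D2 at *
    field_simp
    rw [e0]
    field_simp
    subst hB0 hB1 hB2
    ring

end coefficients

/-! ### Exchange of operators in the degree for operators in the variable. -/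

theorem sum_neg_one_zero_one (f : ℤ → ℂ) :
    ∑ ε ∈ ({-1, 0, 1} : Finset ℤ), f ε = f 1 + f 0 + f (-1) := by
  rw [Finset.sum_insert (by decide), Finset.sum_insert (by decide), Finset.sum_singleton]
  ring

section exchange

variable {q c0 c1 c2 c3 c4 h0 h2 g gy g1 : ℂ} {N : ℤ}

/-- Both sides are `α(ξT - qTξ)` plus the `δ`-correction applied to the polynomials of bound
`N-y+1`: expanded over degrees on the left, over shifts of `x` on the right. -/
theorem coeffA_exchange_plus (G : Generic5 q c0 c1 c2 c3 c4 N) (e0 : h0 ^ 2 = q * c0)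
    (e2 : h2 ^ 2 = q * c2) (eg : g * h0 * q ^ (N + 1) * c3 = 1)
    (ey : gy * h2 * q ^ (N + 1) * c4 = 1) (e1 : g1 * h0 * q ^ (N + 1) * c4 = 1)
    {a x y : ℤ} (ha : 0 ≤ a) (haM : a ≤ N - (y - 1)) (hx : 0 ≤ x) (hxM : x ≤ N - y) :
    ∑ e ∈ ({-1, 0, 1} : Finset ℤ), omega q g1 (a + e) *
        coeffA q h0 c2 c4 c0 c3 c1 N 1 e y (a + e) * racah q h2 c4 c2 c1 (N - y) (a + e) x =
      omega q g1 a * ∑ ε ∈ ({-1, 0, 1} : Finset ℤ),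
        omega q (q ^ x * g) (-ε) / omega q (q ^ y * gy) (-1) *
          coeffA q h0 c2 c1 c0 c3 c4 N 1 ε y x * racah q h2 c4 c2 c1 (N - (y - 1)) a (x - ε) := by
  have hq := G.q_ne
  have g3 : Generic3 q c4 c2 c1 := G.swap34.swap23.swap12.swap23.generic3
  rw [sum_neg_one_zero_one, sum_neg_one_zero_one,
    dual_plus G e0 e2 e1 (by simp), dual_plus G e0 e2 e1 (by simp), dual_plus G e0 e2 e1 (by simp),
    reflected_plus G e0 e2 eg ey (by simp), reflected_plus G e0 e2 eg ey (by simp),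
    reflected_plus G e0 e2 eg ey (by simp)]
  have R0 := racah_rec g3 e2 (N := N - y) x ha (by omega)
  have R1 := fun x => racah_rec g3 e2 (N := N - y + 1) x ha (by omega)
  have D := racah_dual_plus g3 e2 (N := N - y) ha (by omega) hx hxM
  have C := fun b => racah_plus g3 e2 (N := N - y) b hx hxM
  simp only [eigen_eq hq, mul_comm c4 c2] at R0 R1
  rw [show N - (y - 1) = N - y + 1 by ring]
  norm_num
  simp only [← sub_eq_add_neg]
  set α := alphaPlus q c0 c3 (N - y) y
  -- `R0` evaluates `ξT` and `R1` evaluates `Tξ` through the recurrence, `C` replaces `T` by its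
  -- scalar in each degree, and `D` handles the `δ`-correction.
  linear_combination omega q g1 a * (α * fPlus q c4 c2 c1 (N - y) a * R0 +
    deltaPlus q c0 c1 c2 c3 c4 h2 (N - y) y * D +
    q * α * (Phi q c4 c2 c1 (N - y + 1) (-1) (a - 1) * C (a - 1) +
      (Phi q c4 c2 c1 (N - y + 1) 0 a + (1 + c2 * c4 * q)) * C a +
      Phi q c4 c2 c1 (N - y + 1) 1 (a + 1) * C (a + 1)) -
    q * α * (PhiPlus q h2 c1 c2 c4 (N - y) 1 x * R1 (x - 1) +
      PhiPlus q h2 c1 c2 c4 (N - y) 0 x * R1 x +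
      PhiPlus q h2 c1 c2 c4 (N - y) (-1) x * R1 (x + 1)) -
    α * xEig q (c2 * c4) x * C a)

theorem coeffA_exchange_minus (G : Generic5 q c0 c1 c2 c3 c4 N) (e0 : h0 ^ 2 = q * c0)
    (e2 : h2 ^ 2 = q * c2) (eg : g * h0 * q ^ (N + 1) * c3 = 1)
    (ey : gy * h2 * q ^ (N + 1) * c4 = 1) (e1 : g1 * h0 * q ^ (N + 1) * c4 = 1)
    {a x y : ℤ} (ha : 0 ≤ a) (haM : a ≤ N - (y - -1)) (hx : 0 ≤ x) (hxM : x ≤ N - y) :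
    ∑ e ∈ ({-1, 0, 1} : Finset ℤ), omega q g1 (a + e) *
        coeffA q h0 c2 c4 c0 c3 c1 N (-1) e y (a + e) * racah q h2 c4 c2 c1 (N - y) (a + e) x =
      omega q g1 a * ∑ ε ∈ ({-1, 0, 1} : Finset ℤ),
        omega q (q ^ x * g) (-ε) / omega q (q ^ y * gy) (- -1) *
          coeffA q h0 c2 c1 c0 c3 c4 N (-1) ε y x *
          racah q h2 c4 c2 c1 (N - (y - -1)) a (x - ε) := by
  have hq := G.q_ne
  have g3 : Generic3 q c4 c2 c1 := G.swap34.swap23.swap12.swap23.generic3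
  have F := reflected_minus G e0 e2 eg ey (y := y) (ε := -1) (by simp) x
  rw [neg_neg] at F
  rw [sum_neg_one_zero_one, sum_neg_one_zero_one, neg_neg,
    dual_minus G e0 e2 e1 (by simp), dual_minus G e0 e2 e1 (by simp),
    dual_minus G e0 e2 e1 (by simp),
    reflected_minus G e0 e2 eg ey (by simp), reflected_minus G e0 e2 eg ey (by simp), F]
  have R0 := racah_rec g3 e2 (N := N - y) x ha (by omega)
  have R1 := fun x => racah_rec g3 e2 (N := N - y - 1) x ha (by omega)
  have D := racah_dual_minus g3 e2 (N := N - y - 1) ha (by omega) hx (by omega)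
  have C := fun b => racah_minus g3 e2 (N := N - y - 1) b hx (by omega)
  simp only [eigen_eq hq, mul_comm c4 c2, sub_add_cancel] at R0 R1 D C
  rw [show N - (y - -1) = N - y - 1 by ring]
  norm_num
  simp only [← sub_eq_add_neg]
  set α := alphaMinus q c0 c3 (N - y) y
  linear_combination omega q g1 a * (α * fMinus q (c2 * c1) (N - y) a * R0 +
    deltaMinus q c0 c3 c4 h2 (N - y) y * D +
    q * α * (Phi q c4 c2 c1 (N - y - 1) (-1) (a - 1) * C (a - 1) +
      (Phi q c4 c2 c1 (N - y - 1) 0 a + (1 + c2 * c4 * q)) * C a +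
      Phi q c4 c2 c1 (N - y - 1) 1 (a + 1) * C (a + 1)) -
    q * α * (PhiMinus q h2 c2 c4 (N - y) 1 x * R1 (x - 1) +
      PhiMinus q h2 c2 c4 (N - y) 0 x * R1 x +
      PhiMinus q h2 c2 c4 (N - y) (-1) x * R1 (x + 1)) -
    α * xEig q (c2 * c4) x * C a)

/-- The case without change of bound: `T` is the difference operator, so only its eigenvalue
equation and the recurrence are needed, and the scalar `etaZero` cancels. -/
theorem coeffA_exchange_zero (G : Generic5 q c0 c1 c2 c3 c4 N) (e0 : h0 ^ 2 = q * c0)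
    (e2 : h2 ^ 2 = q * c2) (eg : g * h0 * q ^ (N + 1) * c3 = 1)
    (e1 : g1 * h0 * q ^ (N + 1) * c4 = 1)
    {a x y : ℤ} (ha : 0 ≤ a) (haM : a ≤ N - y) (hx : 0 ≤ x) (hxM : x ≤ N - y) :
    ∑ e ∈ ({-1, 0, 1} : Finset ℤ), omega q g1 (a + e) *
        coeffA q h0 c2 c4 c0 c3 c1 N 0 e y (a + e) * racah q h2 c4 c2 c1 (N - y) (a + e) x =
      omega q g1 a * ∑ ε ∈ ({-1, 0, 1} : Finset ℤ), omega q (q ^ x * g) (-ε) *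
          coeffA q h0 c2 c1 c0 c3 c4 N 0 ε y x * racah q h2 c4 c2 c1 (N - y) a (x - ε) := by
  have hq := G.q_ne
  have g3 : Generic3 q c4 c2 c1 := G.swap34.swap23.swap12.swap23.generic3
  rw [sum_neg_one_zero_one, sum_neg_one_zero_one,
    dual_zero G e0 e1 (by simp), dual_zero G e0 e1 (by simp), dual_zero G e0 e1 (by simp),
    reflected_zero G e0 eg (by simp), reflected_zero G e0 eg (by simp),
    reflected_zero G e0 eg (by simp)]
  have R := fun x => racah_rec g3 e2 (N := N - y) x ha (by omega)
  have D := fun b => racah_diff (h := h2) g3 (N := N - y) (a := b) hx hxM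
  simp only [eigen_eq hq, mul_comm c4 c2] at R D
  norm_num
  simp only [← sub_eq_add_neg]
  set α := alphaZero q c0 c3 (N - y) y
  linear_combination omega q g1 a * α * (xEig q (c2 * c1) a * R x +
    q * (Phi q c4 c2 c1 (N - y) (-1) (a - 1) * D (a - 1) +
      (Phi q c4 c2 c1 (N - y) 0 a + (1 + c2 * c4 * q)) * D a +
      Phi q c4 c2 c1 (N - y) 1 (a + 1) * D (a + 1)) -
    q * (Phi q c1 c2 c4 (N - y) 1 x * R (x - 1) +
      (Phi q c1 c2 c4 (N - y) 0 x + (1 + c1 * c2 * q)) * R x +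
      Phi q c1 c2 c4 (N - y) (-1) x * R (x + 1)) -
    xEig q (c2 * c4) x * D a)

end exchange

/-! ### Both equations for generic parameters. -/

section griffiths

variable {r s0 s1 s2 s3 s4 : ℂ} {N i j : ℤ}

/-- The cut-off of the univariate polynomials makes the added terms vanish. A range independent of
`j` and `y`, with one unit of padding at each end, permits comparison of shifted sums. -/
theorem griffiths_eq_sum (hj : 0 ≤ j) (x y : ℤ) :
    griffiths r s0 s1 s2 s3 s4 N i j x y = ∑ a ∈ Finset.Icc (-1) (N + 1),
      omega (r ^ 2) (s1 * s2 * s3 / s4) a *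
        racah (r ^ 2) (r * s2) (s1 ^ 2) (s2 ^ 2) (s3 ^ 2) (N - j) i a *
        racah (r ^ 2) (r * s0) (s3 ^ 2) (s0 ^ 2) (s4 ^ 2) (N - a) j y *
        racah (r ^ 2) (r * s2) (s4 ^ 2) (s2 ^ 2) (s1 ^ 2) (N - y) a x := by
  refine Finset.sum_subset ?_ ?_
  · intro a ha
    simp only [Finset.mem_Icc, le_min_iff] at ha ⊢
    omega
  · intro a _ ha
    simp only [Finset.mem_Icc, le_min_iff] at ha
    by_cases h : a ≤ N - j
    · rw [racah_eq_zero (N := N - y) (by omega), mul_zero]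
    · rw [racah_eq_zero (N := N - j) (by omega)]
      ring

theorem griffiths_diff (G : Generic5 (r ^ 2) (s0 ^ 2) (s1 ^ 2) (s2 ^ 2) (s3 ^ 2) (s4 ^ 2) N)
    (hj : 0 ≤ j) {x y : ℤ} (hx : 0 ≤ x) (hy : 0 ≤ y) (hxy : x + y ≤ N) :
    eigen (r ^ 2) (s0 ^ 2 * s4 ^ 2) j * griffiths r s0 s1 s2 s3 s4 N i j x y =
      ∑ ε ∈ ({-1, 0, 1} : Finset ℤ), ∑ ε' ∈ ({-1, 0, 1} : Finset ℤ),
        coeffA (r ^ 2) (r * s2) (s0 ^ 2) (s1 ^ 2) (s2 ^ 2) (s4 ^ 2) (s3 ^ 2) N ε ε' x y *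
          griffiths r s0 s1 s2 s3 s4 N i j (x - ε) (y - ε') := by
  simp only [griffiths_eq_sum hj, Finset.mul_sum, sum_neg_one_zero_one, ← Finset.sum_add_distrib]
  refine Finset.sum_congr rfl fun a _ => ?_
  have H := fun ε' h => coeffA_op (h := r * s2) G.swap34 (mul_pow r s2 2) a (x := x) (y := y)
    (ε' := ε') h hx (by omega)
  have H1 := H 1 (by simp)
  have H0 := H 0 (by simp)
  have Hm := H (-1) (by simp)
  have D : eigen (r ^ 2) (s0 ^ 2 * s4 ^ 2) j *
      racah (r ^ 2) (r * s0) (s3 ^ 2) (s0 ^ 2) (s4 ^ 2) (N - a) j y *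
      racah (r ^ 2) (r * s2) (s4 ^ 2) (s2 ^ 2) (s1 ^ 2) (N - y) a x =
      (Phi (r ^ 2) (s4 ^ 2) (s0 ^ 2) (s3 ^ 2) (N - a) 1 y *
        racah (r ^ 2) (r * s0) (s3 ^ 2) (s0 ^ 2) (s4 ^ 2) (N - a) j (y - 1) +
      Phi (r ^ 2) (s4 ^ 2) (s0 ^ 2) (s3 ^ 2) (N - a) 0 y *
        racah (r ^ 2) (r * s0) (s3 ^ 2) (s0 ^ 2) (s4 ^ 2) (N - a) j y +
      Phi (r ^ 2) (s4 ^ 2) (s0 ^ 2) (s3 ^ 2) (N - a) (-1) y *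
        racah (r ^ 2) (r * s0) (s3 ^ 2) (s0 ^ 2) (s4 ^ 2) (N - a) j (y + 1)) *
      racah (r ^ 2) (r * s2) (s4 ^ 2) (s2 ^ 2) (s1 ^ 2) (N - y) a x := by
    -- The difference equation in `y` needs `y ≤ N - a`; otherwise `a > N - y` and the third factor
    -- is zero.
    by_cases ha : y ≤ N - a
    · rw [racah_diff (q := r ^ 2) G.swap01.swap23.swap12.swap34.generic3 hy ha]
    · rw [racah_eq_zero (N := N - y) (by omega)]
      ring
  simp only [sub_zero, sub_neg_eq_add] at H1 H0 Hm ⊢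
  set w := omega (r ^ 2) (s1 * s2 * s3 / s4) a *
    racah (r ^ 2) (r * s2) (s1 ^ 2) (s2 ^ 2) (s3 ^ 2) (N - j) i a
  set J := fun y => racah (r ^ 2) (r * s0) (s3 ^ 2) (s0 ^ 2) (s4 ^ 2) (N - a) j y
  linear_combination w * D - w * (J (y - 1) * H1 + J y * H0 + J (y + 1) * Hm)

theorem sum_Icc_shift {N e : ℤ} (he : e = 1 ∨ e = 0 ∨ e = -1) (F : ℤ → ℂ)
    (hF : ∀ a, ¬(0 ≤ a ∧ a ≤ N) → F a = 0) :
    ∑ a ∈ Finset.Icc (-1) (N + 1), F a = ∑ b ∈ Finset.Icc (-1) (N + 1), F (b + e) := by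
  have h1 : ∑ a ∈ Finset.Icc (-1) (N + 1), F a = ∑ a ∈ Finset.Icc 0 N, F a := by
    symm
    refine Finset.sum_subset (fun a ha => ?_) fun a _ ha => hF a (by simpa using ha)
    simp only [Finset.mem_Icc] at ha ⊢
    omega
  have h2 : ∑ b ∈ Finset.Icc (-1) (N + 1), F (b + e) =
      ∑ b ∈ Finset.Icc (0 - e) (N - e), F (b + e) := by
    symm
    refine Finset.sum_subset (fun a ha => ?_) fun a _ ha => hF _ ?_
    · simp only [Finset.mem_Icc] at ha ⊢
      omega
    · simp only [Finset.mem_Icc] at ha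
      omega
  rw [h1, h2]
  refine Finset.sum_bij' (fun a _ => a - e) (fun b _ => b + e) ?_ ?_ ?_ ?_ ?_
  · intro a ha
    simp only [Finset.mem_Icc] at ha ⊢
    omega
  · intro b hb
    simp only [Finset.mem_Icc] at hb ⊢
    omega
  all_goals simp

theorem griffiths_dual_diff (G : Generic5 (r ^ 2) (s0 ^ 2) (s1 ^ 2) (s2 ^ 2) (s3 ^ 2) (s4 ^ 2) N)
    (hprod : r ^ (2 * N + 3) * (s0 * s1 * s2 * s3 * s4) = 1)
    (hj : 0 ≤ j) {x y : ℤ} (hx : 0 ≤ x) (hy : 0 ≤ y) (hxy : x + y ≤ N) :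
    eigen (r ^ 2) (s2 ^ 2 * s3 ^ 2) i * griffiths r s0 s1 s2 s3 s4 N i j x y =
      ∑ ε ∈ ({-1, 0, 1} : Finset ℤ), ∑ ε' ∈ ({-1, 0, 1} : Finset ℤ),
        omega (r ^ 2) ((r ^ 2) ^ x * (s1 * s2 * s4 / s3)) (-ε) /
            omega (r ^ 2) ((r ^ 2) ^ y * (s1 * s0 * s3 / s4)) (-ε') *
          coeffA (r ^ 2) (r * s0) (s2 ^ 2) (s1 ^ 2) (s0 ^ 2) (s3 ^ 2) (s4 ^ 2) N ε' ε y x *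
          griffiths r s0 s1 s2 s3 s4 N i j (x - ε) (y - ε') := by
  have hr0 : r ≠ 0 := by
    rintro rfl
    exact G.q_ne (by norm_num)
  have n3 : s3 ≠ 0 := by rintro rfl; simp at hprod
  have n4 : s4 ≠ 0 := by rintro rfl; simp at hprod
  have hp : r * (r ^ 2) ^ (N + 1) * (s0 * s1 * s2 * s3 * s4) = 1 := by
    rw [← hprod, ← zpow_natCast r 2, ← zpow_mul, ← zpow_one_add₀ hr0]
    congr 2
    push_cast
    ring
  -- These three equations carry the choice of signs: the prescribed product of the square roots
  -- ties the roots inside `ω` to the roots of `qc₀` and `qc₂`.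
  have eg : s1 * s2 * s4 / s3 * (r * s0) * (r ^ 2) ^ (N + 1) * s3 ^ 2 = 1 := by
    rw [← hp]; field_simp
  have ey : s1 * s0 * s3 / s4 * (r * s2) * (r ^ 2) ^ (N + 1) * s4 ^ 2 = 1 := by
    rw [← hp]; field_simp
  have e1 : s1 * s2 * s3 / s4 * (r * s0) * (r ^ 2) ^ (N + 1) * s4 ^ 2 = 1 := by
    rw [← hp]; field_simp
  have e0 : (r * s0) ^ 2 = r ^ 2 * s0 ^ 2 := mul_pow r s0 2
  have e2 : (r * s2) ^ 2 = r ^ 2 * s2 ^ 2 := mul_pow r s2 2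
  simp only [griffiths_eq_sum hj]
  generalize s1 * s2 * s3 / s4 = g1 at *
  generalize s1 * s2 * s4 / s3 = g at *
  generalize s1 * s0 * s3 / s4 = gy at *
  generalize r * s0 = h0 at *
  generalize r * s2 = h2 at *
  generalize r ^ 2 = q at *
  generalize s0 ^ 2 = c0 at *
  generalize s1 ^ 2 = c1 at *
  generalize s2 ^ 2 = c2 at *
  generalize s3 ^ 2 = c3 at *
  generalize s4 ^ 2 = c4 at *
  set I := fun a => racah q h2 c1 c2 c3 (N - j) i a with hI
  set J := fun a y => racah q h0 c3 c0 c4 (N - a) j y with hJ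
  set P := fun y a x => racah q h2 c4 c2 c1 (N - y) a x with hP
  -- The part of the operator on `a` with shift `e`, after its coefficient has been spread over
  -- shifts of `y` by `coeffA_op`.
  set F : ℤ → ℤ → ℂ := fun e a => omega q g1 a * I (a - e) *
    (∑ ε' ∈ ({-1, 0, 1} : Finset ℤ),
      coeffA q h0 c2 c4 c0 c3 c1 N ε' e y a * J (a - e) (y - ε')) * P y a x with hF
  have step1 : ∀ a, eigen q (c2 * c3) i * (omega q g1 a * I a * J a y * P y a x) =
      ∑ e ∈ ({-1, 0, 1} : Finset ℤ), F e a := by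
    intro a
    by_cases ha : 0 ≤ a ∧ a ≤ N - y
    · have H := fun e h => coeffA_op (h := h0) (ε' := e) (a := j) (x := y) (y := a)
        G.swap12.swap01.swap23.swap34.swap23.swap12 e0 h hy (by omega)
      have H1 := H 1 (by simp)
      have H0 := H 0 (by simp)
      have Hm := H (-1) (by simp)
      -- For `a > N - j` the difference equation in `a` is not available, but then the degree `j`
      -- exceeds the bound `N - a` and both sides vanish.
      by_cases haj : a ≤ N - j
      · have D := racah_diff (h := h2) G.generic3 (a := i) ha.1 haj
        simp only [sum_neg_one_zero_one, hF, sub_zero, sub_neg_eq_add] at *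
        linear_combination -omega q g1 a * P y a x * (J a y * D + I (a - 1) * H1 + I a * H0 +
          I (a + 1) * Hm)
      · have hz : J a y = 0 := racah_eq_zero (by omega)
        simp only [sum_neg_one_zero_one, hF, sub_zero, sub_neg_eq_add] at *
        linear_combination omega q g1 a * P y a x * ((eigen q (c2 * c3) i * I a -
          I (a - 1) * Phi q c3 c2 c1 (N - j) 1 a - I a * Phi q c3 c2 c1 (N - j) 0 a -
          I (a + 1) * Phi q c3 c2 c1 (N - j) (-1) a) * hz - I (a - 1) * H1 - I a * H0 - I (a + 1) * Hm)
    · have hz : P y a x = 0 := racah_eq_zero (by omega)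
      simp [hF, hz]
  -- With `b = a - e` the first two factors no longer depend on `e`, so the sum over `e` acts only
  -- on the degree of the third, where the exchange lemmas apply.
  have step2 : ∀ b, ∑ e ∈ ({-1, 0, 1} : Finset ℤ), F e (b + e) =
      omega q g1 b * I b * ∑ ε' ∈ ({-1, 0, 1} : Finset ℤ), J b (y - ε') *
        ∑ ε ∈ ({-1, 0, 1} : Finset ℤ),
          omega q (q ^ x * g) (-ε) / omega q (q ^ y * gy) (-ε') *
          coeffA q h0 c2 c1 c0 c3 c4 N ε' ε y x * P (y - ε') b (x - ε) := by
    intro b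
    by_cases hb : 0 ≤ b
    swap
    · have hz : I b = 0 := racah_eq_zero (by omega)
      simp [hF, hz]
    have E : ∀ ε', ε' = 1 ∨ ε' = 0 ∨ ε' = -1 → J b (y - ε') *
        ∑ e ∈ ({-1, 0, 1} : Finset ℤ), omega q g1 (b + e) *
          coeffA q h0 c2 c4 c0 c3 c1 N ε' e y (b + e) * P y (b + e) x =
        J b (y - ε') * (omega q g1 b * ∑ ε ∈ ({-1, 0, 1} : Finset ℤ),
          omega q (q ^ x * g) (-ε) / omega q (q ^ y * gy) (-ε') *
          coeffA q h0 c2 c1 c0 c3 c4 N ε' ε y x * P (y - ε') b (x - ε)) := by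
      intro ε' hε'
      -- Beyond this range the second factor vanishes, since its variable `y - ε'` exceeds the bound
      -- `N - b`.
      by_cases hbM : b ≤ N - (y - ε')
      · congr 1
        rcases hε' with rfl | rfl | rfl
        · exact coeffA_exchange_plus G e0 e2 eg ey e1 hb hbM hx (by omega)
        · rw [hP]
          simp only [neg_zero, omega_zero, div_one, sub_zero]
          exact coeffA_exchange_zero G e0 e2 eg e1 hb (by omega) hx (by omega)
        · exact coeffA_exchange_minus G e0 e2 eg ey e1 hb hbM hx (by omega)
      · have hz : J b (y - ε') = 0 := racah_eq_zero (by omega)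
        rw [hz, zero_mul, zero_mul]
    have E1 := E 1 (by simp)
    have E0 := E 0 (by simp)
    have Em := E (-1) (by simp)
    simp only [sum_neg_one_zero_one, hF, add_sub_cancel_right] at *
    linear_combination I b * (E1 + E0 + Em)
  have hz : ∀ e a, ¬(0 ≤ a ∧ a ≤ N) → F e a = 0 := by
    intro e a ha
    have hz : P y a x = 0 := racah_eq_zero (by omega)
    simp [hF, hz]
  calc _ = ∑ a ∈ Finset.Icc (-1) (N + 1), ∑ e ∈ ({-1, 0, 1} : Finset ℤ), F e a := by
        rw [Finset.mul_sum]
        exact Finset.sum_congr rfl fun a _ => step1 a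
    _ = ∑ b ∈ Finset.Icc (-1) (N + 1), ∑ e ∈ ({-1, 0, 1} : Finset ℤ), F e (b + e) := by
        rw [Finset.sum_comm, Finset.sum_comm (s := Finset.Icc (-1) (N + 1))]
        refine Finset.sum_congr rfl fun e he => sum_Icc_shift ?_ (F e) (hz e)
        simp only [Finset.mem_insert, Finset.mem_singleton] at he
        omega
    _ = _ := by
        simp only [step2, Finset.mul_sum, sum_neg_one_zero_one, ← Finset.sum_add_distrib]
        refine Finset.sum_congr rfl fun b _ => ?_
        ring

end griffiths

/-! ### Continuity of the coefficients and polynomials at admissible parameters. -/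

open Filter Topology
section continuity

variable {X : Type*} [TopologicalSpace X] {p : X} {q h c c0 c1 c2 c3 c4 : X → ℂ} {N L i j : ℤ}

/-- `c` avoids the powers `q^{-k}`, `2 ≤ k ≤ 2N`. -/
def PairReg (q c : ℂ) (N : ℤ) : Prop := ∀ k : ℤ, 2 ≤ k → k ≤ 2 * N → 1 - c * q ^ k ≠ 0

theorem continuousAt_redQuot (hq : ContinuousAt q p) (q0 : q p ≠ 0) (hc : ContinuousAt c p)
    {m k : ℤ} (H : m = k ∨ 1 - c p * q p ^ k ≠ 0) :
    ContinuousAt (fun u => redQuot (q u) (c u) m k) p := by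
  unfold redQuot
  split_ifs with hm
  · exact continuousAt_const
  · have := H.resolve_left hm
    fun_prop (disch := with_reducible first | exact Or.inl q0 | assumption)

/-- The two exponents outside the controlled range are harmless: at `i = 0` the coefficient is
identically zero, and at `i = L` the reduced quotient is the constant `1`. -/
theorem continuousAt_Phi_one (hq : ContinuousAt q p) (q0 : q p ≠ 0) (h1 : ContinuousAt c1 p)
    (h2 : ContinuousAt c2 p) (h3 : ContinuousAt c3 p) (hi : 0 ≤ i) (hiL : i ≤ L)
    (H : PairReg (q p) (c2 p * c3 p) L) :
    ContinuousAt (fun u => Phi (q u) (c1 u) (c2 u) (c3 u) L 1 i) p := by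
  rcases hi.eq_or_lt with rfl | hi
  · simp [Phi_one_zero, continuousAt_const]
  have d := H (2 * i) (by omega) (by omega)
  have R := continuousAt_redQuot (m := i + L + 1) (k := 2 * i + 1) hq q0 (h2.mul h3)
    (or_iff_not_imp_left.2 fun _ => H _ (by omega) (by omega))
  simp only [Phi, if_true]
  refine ContinuousAt.mul ?_ R
  fun_prop (disch := with_reducible first | exact Or.inl q0 | assumption)

/-- Here the coefficient is identically zero at `i = L`, and the reduced quotient is `1` at `i = 0`.
-/
theorem continuousAt_Phi_neg_one (hq : ContinuousAt q p) (q0 : q p ≠ 0) (h1 : ContinuousAt c1 p)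
    (h2 : ContinuousAt c2 p) (h3 : ContinuousAt c3 p) (hi : 0 ≤ i) (hiL : i ≤ L)
    (H : PairReg (q p) (c2 p * c3 p) L) :
    ContinuousAt (fun u => Phi (q u) (c1 u) (c2 u) (c3 u) L (-1) i) p := by
  rcases hiL.eq_or_lt with rfl | hiL
  · simp [Phi_neg_one_self, continuousAt_const]
  have d := H (2 * i + 2) (by omega) (by omega)
  have R := continuousAt_redQuot (m := i + 1) (k := 2 * i + 1) hq q0 (h2.mul h3)
    (or_iff_not_imp_left.2 fun _ => H _ (by omega) (by omega))
  simp only [Phi]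
  norm_num
  refine ContinuousAt.mul ?_ R
  fun_prop (disch := with_reducible first | exact Or.inl q0 | assumption)

theorem continuousAt_Phi (hq : ContinuousAt q p) (q0 : q p ≠ 0) (h1 : ContinuousAt c1 p)
    (h2 : ContinuousAt c2 p) (h3 : ContinuousAt c3 p) (hi : 0 ≤ i) (hiL : i ≤ L)
    (H : PairReg (q p) (c2 p * c3 p) L) {ε : ℤ} (hε : ε = 1 ∨ ε = 0 ∨ ε = -1) :
    ContinuousAt (fun u => Phi (q u) (c1 u) (c2 u) (c3 u) L ε i) p := by
  have P := continuousAt_Phi_one hq q0 h1 h2 h3 hi hiL H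
  have M := continuousAt_Phi_neg_one hq q0 h1 h2 h3 hi hiL H
  rcases hε with rfl | rfl | rfl
  · exact P
  · simp only [Phi_zero]
    fun_prop
  · exact M

theorem continuousAt_PhiMinus_one (hq : ContinuousAt q p) (q0 : q p ≠ 0) (hh : ContinuousAt h p)
    (h2 : ContinuousAt c2 p) (h3 : ContinuousAt c3 p) (hi : 0 ≤ i) (hiL : i ≤ L)
    (H : PairReg (q p) (c2 p * c3 p) L) :
    ContinuousAt (fun u => PhiMinus (q u) (h u) (c2 u) (c3 u) L 1 i) p := by
  rcases hi.eq_or_lt with rfl | hi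
  · simp [PhiMinus_one_zero, continuousAt_const]
  have d := H (2 * i) (by omega) (by omega)
  have d' : q p ^ L * (1 - c2 p * c3 p * q p ^ (2 * i)) ≠ 0 := mul_ne_zero (zpow_ne_zero _ q0) d
  have R := continuousAt_redQuot (m := i + L + 1) (k := 2 * i + 1) hq q0 (h2.mul h3)
    (or_iff_not_imp_left.2 fun _ => H _ (by omega) (by omega))
  simp only [PhiMinus, if_true]
  refine ContinuousAt.mul ?_ R
  fun_prop (disch := with_reducible first | exact Or.inl q0 | assumption)

theorem continuousAt_PhiMinus_neg_one (hq : ContinuousAt q p) (q0 : q p ≠ 0)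
    (hh : ContinuousAt h p) (h2 : ContinuousAt c2 p) (h3 : ContinuousAt c3 p) (hi : 0 ≤ i)
    (hiL : i ≤ L) (H : PairReg (q p) (c2 p * c3 p) L) :
    ContinuousAt (fun u => PhiMinus (q u) (h u) (c2 u) (c3 u) L (-1) i) p := by
  rcases hiL.eq_or_lt with rfl | hiL
  · simp [PhiMinus_neg_one_self, continuousAt_const]
  have d := H (2 * i + 2) (by omega) (by omega)
  have R := continuousAt_redQuot (m := i + 1) (k := 2 * i + 1) hq q0 (h2.mul h3)
    (or_iff_not_imp_left.2 fun _ => H _ (by omega) (by omega))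
  simp only [PhiMinus]
  norm_num
  refine ContinuousAt.mul ?_ R
  fun_prop (disch := with_reducible first | exact Or.inl q0 | assumption)

theorem continuousAt_PhiMinus (hq : ContinuousAt q p) (q0 : q p ≠ 0) (hh : ContinuousAt h p)
    (h2 : ContinuousAt c2 p) (h3 : ContinuousAt c3 p) (hi : 0 ≤ i) (hiL : i ≤ L)
    (H : PairReg (q p) (c2 p * c3 p) L) {ε : ℤ} (hε : ε = 1 ∨ ε = 0 ∨ ε = -1) :
    ContinuousAt (fun u => PhiMinus (q u) (h u) (c2 u) (c3 u) L ε i) p := by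
  have P := continuousAt_PhiMinus_one hq q0 hh h2 h3 hi hiL H
  have M := continuousAt_PhiMinus_neg_one hq q0 hh h2 h3 hi hiL H
  rcases hε with rfl | rfl | rfl
  · exact P
  · have e : ∀ u, PhiMinus (q u) (h u) (c2 u) (c3 u) L 0 i =
        -PhiMinus (q u) (h u) (c2 u) (c3 u) L 1 i - PhiMinus (q u) (h u) (c2 u) (c3 u) L (-1) i -
        h u * (1 - c3 u * q u ^ L) * (q u ^ (-L) - 1) := by
      intro u
      simp [PhiMinus]
    simp only [e]
    fun_prop (disch := with_reducible first | exact Or.inl q0 | assumption)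
  · exact M

theorem continuousAt_PhiPlus_one (hq : ContinuousAt q p) (q0 : q p ≠ 0) (hh : ContinuousAt h p)
    (h1 : ContinuousAt c1 p) (h2 : ContinuousAt c2 p) (h3 : ContinuousAt c3 p) (hi : 0 ≤ i)
    (hiN : i < N) (H : PairReg (q p) (c2 p * c3 p) N) :
    ContinuousAt (fun u => PhiPlus (q u) (h u) (c1 u) (c2 u) (c3 u) L 1 i) p := by
  rcases hi.eq_or_lt with rfl | hi
  · simp [PhiPlus_one_zero, continuousAt_const]
  have d := mul_ne_zero (H (2 * i) (by omega) (by omega)) (H (2 * i + 1) (by omega) (by omega))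
  simp only [PhiPlus, if_true]
  fun_prop (disch := with_reducible first | exact Or.inl q0 | assumption)

theorem continuousAt_FPlus (hq : ContinuousAt q p) (q0 : q p ≠ 0) (h4 : ContinuousAt c4 p)
    (h0 : ContinuousAt c0 p) (hj : 0 ≤ j) (hjN : j < N) (H : PairReg (q p) (c4 p * c0 p) N) :
    ContinuousAt (fun u => FPlus (q u) (c4 u) (c0 u) j) p := by
  rcases hj.eq_or_lt with rfl | hj
  · simp [FPlus, continuousAt_const]
  have d := mul_ne_zero (H (2 * j) (by omega) (by omega)) (H (2 * j + 1) (by omega) (by omega))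
  unfold FPlus
  fun_prop (disch := with_reducible first | exact Or.inl q0 | assumption)

theorem continuousAt_FMinus (hq : ContinuousAt q p) (q0 : q p ≠ 0) (h4 : ContinuousAt c4 p)
    (h0 : ContinuousAt c0 p) (hj : 0 ≤ j) (hjN : j < N) (H : PairReg (q p) (c4 p * c0 p) N) :
    ContinuousAt (fun u => FMinus (q u) (c4 u) (c0 u) j) p := by
  have d := H (2 * j + 2) (by omega) (by omega)
  have R := continuousAt_redQuot (m := j + 1) (k := 2 * j + 1) hq q0 (h4.mul h0)
    (or_iff_not_imp_left.2 fun _ => H _ (by omega) (by omega))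
  unfold FMinus
  refine ContinuousAt.mul ?_ R
  fun_prop (disch := with_reducible first | exact Or.inl q0 | assumption)

theorem FPlusNum_zero (q c0 c1 c2 c3 c4 : ℂ) (N : ℤ) : FPlusNum q c0 c1 c2 c3 c4 N 0 = 0 := by
  simp [FPlusNum]

theorem continuousAt_FPlusNum (hq : ContinuousAt q p) (q0 : q p ≠ 0) (h0 : ContinuousAt c0 p)
    (h1 : ContinuousAt c1 p) (h2 : ContinuousAt c2 p) (h3 : ContinuousAt c3 p)
    (h4 : ContinuousAt c4 p) (hj : 0 ≤ j) (hjN : j ≤ N) (H : PairReg (q p) (c4 p * c0 p) N) :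
    ContinuousAt (fun u => FPlusNum (q u) (c0 u) (c1 u) (c2 u) (c3 u) (c4 u) N j) p := by
  rcases hj.eq_or_lt with rfl | hj
  · simp [FPlusNum_zero, continuousAt_const]
  have d := H (2 * j) (by omega) (by omega)
  rw [mul_comm (c4 p)] at d
  unfold FPlusNum
  fun_prop (disch := with_reducible first | exact Or.inl q0 | assumption)

/-- The pole of the quotient has exponent `2(N-j)+2`. For `j = 0` it is outside the controlled range
but the numerator vanishes identically; for `j = N` the quotient is `1`. -/
theorem continuousAt_FPlusNum_redQuot (hq : ContinuousAt q p) (q0 : q p ≠ 0)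
    (h0 : ContinuousAt c0 p) (h1 : ContinuousAt c1 p) (h2 : ContinuousAt c2 p)
    (h3 : ContinuousAt c3 p) (h4 : ContinuousAt c4 p) (hj : 0 ≤ j) (hjN : j ≤ N)
    (H40 : PairReg (q p) (c4 p * c0 p) N)
    (HK : ∀ k : ℤ, 3 ≤ k → k ≤ 2 * N + 1 → 1 - c1 p * c2 p * c3 p * q p ^ k ≠ 0) :
    ContinuousAt (fun u => FPlusNum (q u) (c0 u) (c1 u) (c2 u) (c3 u) (c4 u) N j *
      redQuot (q u) (c1 u * c2 u * c3 u) (N - j + 2) (2 * (N - j) + 2)) p := by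
  rcases hj.eq_or_lt with rfl | hj'
  · simp [FPlusNum_zero, continuousAt_const]
  · exact (continuousAt_FPlusNum hq q0 h0 h1 h2 h3 h4 hj hjN H40).mul
      (continuousAt_redQuot hq q0 ((h1.mul h2).mul h3)
        (or_iff_not_imp_left.2 fun _ => HK _ (by omega) (by omega)))

theorem continuousAt_coeffA_plus (hq : ContinuousAt q p) (q0 : q p ≠ 0) (hh : ContinuousAt h p)
    (hh0 : h p ≠ 0) (h0 : ContinuousAt c0 p)
    (h1 : ContinuousAt c1 p) (h2 : ContinuousAt c2 p) (h3 : ContinuousAt c3 p) (h30 : c3 p ≠ 0)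
    (h4 : ContinuousAt c4 p) (hi : 0 ≤ i) (hj : 0 ≤ j) (hij : i + j ≤ N)
    (H23 : PairReg (q p) (c2 p * c3 p) N) (H40 : PairReg (q p) (c4 p * c0 p) N)
    (HK : ∀ k : ℤ, 3 ≤ k → k ≤ 2 * N + 1 → 1 - c1 p * c2 p * c3 p * q p ^ k ≠ 0)
    {ε : ℤ} (hε : ε = 1 ∨ ε = 0 ∨ ε = -1) :
    ContinuousAt (fun u => coeffA (q u) (h u) (c0 u) (c1 u) (c2 u) (c3 u) (c4 u) N ε 1 i j)
      p := by
  have B := continuousAt_FPlusNum (N := N) (j := j) hq q0 h0 h1 h2 h3 h4 hj (by omega) H40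
  have BL := continuousAt_FPlusNum_redQuot hq q0 h0 h1 h2 h3 h4 hj (by omega : j ≤ N) H40 HK
  have P0 : ContinuousAt (fun u => -c3 u * q u ^ (N + 1) * FPlus (q u) (c4 u) (c0 u) j *
      PhiPlus (q u) (h u) (c1 u) (c2 u) (c3 u) (N - j) 1 i) p := by
    rcases hj.eq_or_lt with rfl | hj'
    · simp [FPlus, continuousAt_const]
    rcases hi.eq_or_lt with rfl | hi'
    · simp [PhiPlus_one_zero, continuousAt_const]
    have := continuousAt_PhiPlus_one (L := N - j) hq q0 hh h1 h2 h3 hi (by omega) H23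
    have := continuousAt_FPlus hq q0 h4 h0 hj (by omega) H40
    fun_prop (disch := with_reducible first | exact Or.inl q0 | assumption)
  have M0 : ContinuousAt (fun u => c3 u * q u ^ (N + 1) *
      FPlusNum (q u) (c0 u) (c1 u) (c2 u) (c3 u) (c4 u) N j *
      ((1 - c1 u * c2 u * c3 u * q u ^ (i + (N - j) + 3)) * (1 - c2 u * q u ^ (i + 1)) /
      (c3 u * q u ^ (N - j + 1) * h u * (1 - c2 u * c3 u * q u ^ (2 * i + 2)))) *
      redQuot (q u) (c2 u * c3 u) (i + 1) (2 * i + 1) *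
      redQuot (q u) (c1 u * c2 u * c3 u) (i + (N - j) + 2) (2 * (N - j) + 2)) p := by
    rcases hj.eq_or_lt with rfl | hj'
    · simp [FPlusNum_zero, continuousAt_const]
    have d := H23 (2 * i + 2) (by omega) (by omega)
    have d' : c3 p * q p ^ (N - j + 1) * h p * (1 - c2 p * c3 p * q p ^ (2 * i + 2)) ≠ 0 :=
      mul_ne_zero (mul_ne_zero (mul_ne_zero h30 (zpow_ne_zero _ q0)) hh0) d
    have R := continuousAt_redQuot (m := i + 1) (k := 2 * i + 1) hq q0 (h2.mul h3)
      (or_iff_not_imp_left.2 fun _ => H23 _ (by omega) (by omega))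
    have R' := continuousAt_redQuot (m := i + (N - j) + 2) (k := 2 * (N - j) + 2) hq q0
      ((h1.mul h2).mul h3) (or_iff_not_imp_left.2 fun _ => HK _ (by omega) (by omega))
    refine ContinuousAt.mul (ContinuousAt.mul ?_ R) R'
    fun_prop (disch := with_reducible first | exact Or.inl q0 | assumption)
  rcases hε with rfl | rfl | rfl
  · simpa [coeffA] using P0
  · have d : c3 p * q p ^ (N - j + 1) * h p ≠ 0 :=
      mul_ne_zero (mul_ne_zero h30 (zpow_ne_zero _ q0)) hh0
    have G : ContinuousAt (fun u => c3 u * q u ^ (N + 1) *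
        ((1 - c1 u * c2 u * q u ^ (N - j + 2)) / (c3 u * q u ^ (N - j + 1) * h u))) p := by
      fun_prop (disch := with_reducible first | exact Or.inl q0 | assumption)
    refine ((P0.neg.sub M0).add (G.mul BL)).congr (.of_forall fun u => ?_)
    simp [coeffA]
    ring
  · simpa [coeffA] using M0

theorem continuousAt_coeffA_zero (hq : ContinuousAt q p) (q0 : q p ≠ 0) (h0 : ContinuousAt c0 p)
    (h1 : ContinuousAt c1 p) (h2 : ContinuousAt c2 p) (h3 : ContinuousAt c3 p)
    (h4 : ContinuousAt c4 p) (hi : 0 ≤ i) (hj : 0 ≤ j) (hij : i + j ≤ N)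
    (H23 : PairReg (q p) (c2 p * c3 p) N) (H40 : PairReg (q p) (c4 p * c0 p) N)
    (HK : ∀ k : ℤ, 3 ≤ k → k ≤ 2 * N + 1 → 1 - c1 p * c2 p * c3 p * q p ^ k ≠ 0)
    {ε : ℤ} (hε : ε = 1 ∨ ε = 0 ∨ ε = -1) :
    ContinuousAt (fun u => coeffA (q u) (h u) (c0 u) (c1 u) (c2 u) (c3 u) (c4 u) N ε 0 i j)
      p := by
  have H23' : PairReg (q p) (c2 p * c3 p) (N - j) := fun k h h' => H23 k h (by omega)
  have BL := continuousAt_FPlusNum_redQuot hq q0 h0 h1 h2 h3 h4 hj (by omega : j ≤ N) H40 HK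
  have Z : ∀ e : ℤ, e = 1 ∨ e = -1 → ContinuousAt (fun u => c3 u * q u ^ (N + 1) *
      (FPlus (q u) (c4 u) (c0 u) j + FMinus (q u) (c4 u) (c0 u) j) *
      Phi (q u) (c1 u) (c2 u) (c3 u) (N - j) e i) p := by
    intro e he
    -- `j = N` forces `i = 0` and bound `0`, where `Φ^±` vanish identically; the uncontrolled
    -- denominators of `F^±` then do not matter.
    by_cases hjN : j = N
    · obtain rfl : i = 0 := by omega
      rcases he with rfl | rfl
      · simp [Phi_one_zero, continuousAt_const]
      · simp [hjN, Phi_neg_one_self, continuousAt_const]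
    · have := continuousAt_Phi hq q0 h1 h2 h3 hi (by omega) H23' (ε := e) (by omega)
      have := continuousAt_FPlus hq q0 h4 h0 hj (by omega) H40
      have := continuousAt_FMinus hq q0 h4 h0 hj (by omega) H40
      fun_prop (disch := with_reducible first | exact Or.inl q0 | assumption)
  have Z1 := Z 1 (by simp)
  have Z2 := Z (-1) (by simp)
  rcases hε with rfl | rfl | rfl
  · simpa [coeffA] using Z1
  · have G : ContinuousAt (fun u => -(1 - c3 u * q u ^ (N - j + 1)) * q u ^ j) p := by
      fun_prop (disch := with_reducible first | exact Or.inl q0 | assumption)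
    have Y : ContinuousAt (fun u => c3 u * (1 - q u ^ (N - j)) *
        (q u ^ (j + 1) - c1 u * c2 u * q u ^ (N + 2)) * FMinus (q u) (c4 u) (c0 u) j) p := by
      by_cases hjN : j = N
      · simp [hjN, continuousAt_const]
      · have := continuousAt_FMinus hq q0 h4 h0 hj (by omega) H40
        fun_prop (disch := with_reducible first | exact Or.inl q0 | assumption)
    refine (((G.mul BL).sub Y).sub (Z1.add Z2)).congr (.of_forall fun u => ?_)
    simp [coeffA]
    ring
  · simpa [coeffA] using Z2

/-- The functions `coeffA` are continuous at admissible parameters. -/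
theorem continuousAt_coeffA (hq : ContinuousAt q p) (q0 : q p ≠ 0) (hh : ContinuousAt h p)
    (hh0 : h p ≠ 0) (h0 : ContinuousAt c0 p)
    (h1 : ContinuousAt c1 p) (h2 : ContinuousAt c2 p) (h3 : ContinuousAt c3 p) (h30 : c3 p ≠ 0)
    (h4 : ContinuousAt c4 p) (hi : 0 ≤ i) (hj : 0 ≤ j) (hij : i + j ≤ N)
    (H23 : PairReg (q p) (c2 p * c3 p) N) (H40 : PairReg (q p) (c4 p * c0 p) N)
    (HK : ∀ k : ℤ, 3 ≤ k → k ≤ 2 * N + 1 → 1 - c1 p * c2 p * c3 p * q p ^ k ≠ 0)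
    {ε ε' : ℤ} (hε : ε = 1 ∨ ε = 0 ∨ ε = -1) (hε' : ε' = 1 ∨ ε' = 0 ∨ ε' = -1) :
    ContinuousAt (fun u => coeffA (q u) (h u) (c0 u) (c1 u) (c2 u) (c3 u) (c4 u) N ε ε' i j) p := by
  have H23' : PairReg (q p) (c2 p * c3 p) (N - j) := fun k h h' => H23 k h (by omega)
  rcases hε' with rfl | rfl | rfl
  · exact continuousAt_coeffA_plus hq q0 hh hh0 h0 h1 h2 h3 h30 h4 hi hj hij H23 H40 HK hε
  · exact continuousAt_coeffA_zero hq q0 h0 h1 h2 h3 h4 hi hj hij H23 H40 HK hε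
  · simp only [coeffA_minus]
    by_cases hjN : j = N
    · obtain rfl : i = 0 := by omega
      subst hjN
      rcases hε with rfl | rfl | rfl <;> simp [PhiMinus, continuousAt_const]
    · have := continuousAt_PhiMinus hq q0 hh h2 h3 hi (by omega) H23' hε
      have := continuousAt_FMinus hq q0 h4 h0 hj (by omega) H40
      fun_prop (disch := with_reducible first | exact Or.inl q0 | assumption)

end continuity

section continuity

open Filter Topology

variable {X : Type*} [TopologicalSpace X] {p : X} {q h a c0 c1 c2 c3 c4 : X → ℂ} {N M n x : ℕ}

theorem continuousAt_qPoch (ha : ContinuousAt a p) (hq : ContinuousAt q p) (k : ℕ) :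
    ContinuousAt (fun u => qPoch (a u) (q u) k) p := by
  unfold qPoch
  fun_prop

/-- Regularity of the parameters of the univariate polynomials of degree bound at most `N`. -/
structure RacahReg (q c1 c2 c3 : ℂ) (N : ℕ) : Prop where
  q_ne : q ≠ 0
  c2_ne : c2 ≠ 0
  q_pow : ∀ k : ℤ, 1 ≤ k → k ≤ N → 1 - q ^ k ≠ 0
  n2 : ∀ k : ℤ, 1 ≤ k → k ≤ N → 1 - c2 * q ^ k ≠ 0
  n3 : ∀ k : ℤ, 1 ≤ k → k ≤ N → 1 - c3 * q ^ k ≠ 0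
  n23 : PairReg q (c2 * c3) N
  n123 : ∀ k : ℤ, 3 ≤ k → k ≤ 2 * N + 1 → 1 - c1 * c2 * c3 * q ^ k ≠ 0

theorem continuousAt_Omega (hq : ContinuousAt q p) (hh : ContinuousAt h p)
    (h1 : ContinuousAt c1 p) (h2 : ContinuousAt c2 p) (h3 : ContinuousAt c3 p)
    (hh0 : h p ≠ 0) (R : RacahReg (q p) (c1 p) (c2 p) (c3 p) N) (hM : M ≤ N) (hn : n ≤ M) :
    ContinuousAt (fun u => Omega (q u) (h u) (c1 u) (c2 u) (c3 u) M n) p := by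
  have P : ∀ k ≤ N, qPoch (q p) (q p) k ≠ 0 := fun k hk => qPoch_ne_zero fun l hl => by
    have := R.q_pow (l + 1) (by omega) (by omega)
    rwa [zpow_add_one₀ R.q_ne, zpow_natCast, mul_comm] at this
  have P3 : qPoch (q p * c3 p) (q p) n ≠ 0 := qPoch_ne_zero fun l hl => by
    have := R.n3 (l + 1) (by omega) (by omega)
    rwa [zpow_add_one₀ R.q_ne, zpow_natCast, mul_comm (q p ^ l), ← mul_assoc,
      mul_comm (c3 p)] at this
  -- Dropping `l = n` removes the exponent `1` when `n = 0` and `2M + 1` when `n = M`, the only ones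
  -- that could leave the controlled range.
  have E : ∏ l ∈ (Finset.range (M + 1)).erase n,
      (1 - c2 p * c3 p * q p ^ (n + 1) * q p ^ l) ≠ 0 := by
    refine Finset.prod_ne_zero_iff.2 fun l hl => ?_
    simp only [Finset.mem_erase, Finset.mem_range] at hl
    have := R.n23 (n + 1 + l : ℕ) (by omega) (by omega)
    rwa [zpow_natCast, pow_add, ← mul_assoc] at this
  have d1 : qPoch (q p) (q p) n * qPoch (q p) (q p) (M - n) ≠ 0 :=
    mul_ne_zero (P n (by omega)) (P (M - n) (by omega))
  have d3 : h p ^ M ≠ 0 := pow_ne_zero _ hh0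
  have d2 : (q p * c2 p) ^ n / h p ^ M *
      (∏ l ∈ (Finset.range (M + 1)).erase n, (1 - c2 p * c3 p * q p ^ (n + 1) * q p ^ l)) *
      qPoch (q p * c3 p) (q p) n ≠ 0 :=
    mul_ne_zero (mul_ne_zero (div_ne_zero (pow_ne_zero _ (mul_ne_zero R.q_ne R.c2_ne)) d3) E) P3
  unfold Omega qBinom
  refine ContinuousAt.div₀ (ContinuousAt.mul (ContinuousAt.div₀ ?_ ?_ d1) ?_) ?_ d2
  · exact continuousAt_qPoch hq hq M
  · exact (continuousAt_qPoch hq hq _).mul (continuousAt_qPoch hq hq _)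
  · exact ((continuousAt_qPoch (hq.mul h2) hq _).mul (continuousAt_qPoch
      (((h1.mul h2).mul h3).mul (hq.pow _)) hq _)).mul (continuousAt_qPoch (hq.mul h1) hq _)
  · refine ContinuousAt.mul ?_ (continuousAt_qPoch (hq.mul h3) hq _)
    fun_prop (disch := assumption)

theorem continuousAt_racah (hq : ContinuousAt q p) (hh : ContinuousAt h p)
    (h1 : ContinuousAt c1 p) (h2 : ContinuousAt c2 p) (h3 : ContinuousAt c3 p)
    (hh0 : h p ≠ 0) (R : RacahReg (q p) (c1 p) (c2 p) (c3 p) N) {M : ℤ} (hM : M ≤ N) (n x : ℤ) :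
    ContinuousAt (fun u => racah (q u) (h u) (c1 u) (c2 u) (c3 u) M n x) p := by
  by_cases H : 0 ≤ n ∧ n ≤ M ∧ 0 ≤ x ∧ x ≤ M
  swap
  · simp only [racah_eq_zero H]
    exact continuousAt_const
  simp only [racah, if_pos H]
  lift n to ℕ using H.1
  lift M to ℕ using by omega
  have q0 := R.q_ne
  refine ContinuousAt.mul
    (continuousAt_Omega hq hh h1 h2 h3 hh0 R (by omega) (by omega)) ?_
  unfold phi43
  refine tendsto_finsetSum _ fun k hk => ?_
  rw [Int.toNat_natCast, Finset.mem_range] at hk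
  have P : qPoch (q p) (q p) k ≠ 0 := qPoch_ne_zero fun l hl => by
    have := R.q_pow (l + 1) (by omega) (by omega)
    rwa [zpow_add_one₀ R.q_ne, zpow_natCast, mul_comm] at this
  have P2 : qPoch (q p * c2 p) (q p) k ≠ 0 := qPoch_ne_zero fun l hl => by
    have := R.n2 (l + 1) (by omega) (by omega)
    rwa [zpow_add_one₀ R.q_ne, zpow_natCast, mul_comm (q p ^ l), ← mul_assoc,
      mul_comm (c2 p)] at this
  have P123 : qPoch (c1 p * c2 p * c3 p * q p ^ ((M : ℤ) + 2)) (q p) k ≠ 0 :=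
    qPoch_ne_zero fun l hl => by
      have := R.n123 ((M : ℤ) + 2 + l) (by omega) (by omega)
      rwa [zpow_add₀ R.q_ne _ (l : ℤ), zpow_natCast, ← mul_assoc] at this
  have PN : qPoch (q p ^ (-(M : ℤ))) (q p) k ≠ 0 := qPoch_ne_zero fun l hl => by
    have := R.q_pow ((M : ℤ) - l) (by omega) (by omega)
    contrapose! this
    rw [sub_eq_zero, zpow_neg, eq_comm, inv_mul_eq_one₀ (zpow_ne_zero _ R.q_ne)] at this
    rw [zpow_sub₀ R.q_ne, this, zpow_natCast, div_self (pow_ne_zero _ R.q_ne), sub_self]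
  have hz : ∀ m : ℤ, ContinuousAt (fun u => q u ^ m) p := fun m => hq.zpow₀ m (Or.inl R.q_ne)
  refine ContinuousAt.mul (ContinuousAt.div₀ ?_ ?_
    (mul_ne_zero (mul_ne_zero P2 P123) PN)) (ContinuousAt.div₀ (hq.pow k) ?_ P)
  · exact (((continuousAt_qPoch (hz _) hq _).mul (continuousAt_qPoch ((h2.mul h3).mul (hz _)) hq
      _)).mul (continuousAt_qPoch (hz _) hq _)).mul
      (continuousAt_qPoch ((h1.mul h2).mul (hz _)) hq _)
  · exact ((continuousAt_qPoch (hq.mul h2) hq _).mul (continuousAt_qPoch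
      (((h1.mul h2).mul h3).mul (hz _)) hq _)).mul (continuousAt_qPoch (hz _) hq _)
  · exact continuousAt_qPoch hq hq _

theorem continuousAt_omega (hq : ContinuousAt q p) (hh : ContinuousAt h p) (q0 : q p ≠ 0)
    (hh0 : h p ≠ 0) (m : ℤ) : ContinuousAt (fun u => omega (q u) (h u) m) p := by
  unfold omega
  fun_prop (disch := first | exact Or.inl q0 | exact Or.inl hh0)

theorem omega_ne_zero {q h : ℂ} (hq : q ≠ 0) (hh : h ≠ 0) (m : ℤ) : omega q h m ≠ 0 :=
  mul_ne_zero (mul_ne_zero (zpow_ne_zero _ (by norm_num)) (zpow_ne_zero _ hh)) (zpow_ne_zero _ hq)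

theorem continuousAt_eigen (hq : ContinuousAt q p) (h1 : ContinuousAt c1 p) (q0 : q p ≠ 0)
    (m : ℤ) : ContinuousAt (fun u => eigen (q u) (c1 u) m) p := by
  unfold eigen
  fun_prop (disch := exact Or.inl q0)

theorem continuousAt_griffiths {r s0 s1 s2 s3 s4 : X → ℂ} (hr : ContinuousAt r p)
    (h0 : ContinuousAt s0 p) (h1 : ContinuousAt s1 p) (h2 : ContinuousAt s2 p)
    (h3 : ContinuousAt s3 p) (h4 : ContinuousAt s4 p) (n1 : s1 p ≠ 0) (n3 : s3 p ≠ 0)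
    (n4 : s4 p ≠ 0)
    (R123 : RacahReg (r p ^ 2) (s1 p ^ 2) (s2 p ^ 2) (s3 p ^ 2) N)
    (R304 : RacahReg (r p ^ 2) (s3 p ^ 2) (s0 p ^ 2) (s4 p ^ 2) N)
    (R421 : RacahReg (r p ^ 2) (s4 p ^ 2) (s2 p ^ 2) (s1 p ^ 2) N)
    (i : ℤ) {j : ℤ} (hj : 0 ≤ j) (x y : ℤ) :
    ContinuousAt (fun u => griffiths (r u) (s0 u) (s1 u) (s2 u) (s3 u) (s4 u) N i j x y) p := by
  unfold griffiths
  refine tendsto_finsetSum _ fun a ha => ?_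
  simp only [Finset.mem_Icc, le_min_iff] at ha
  have r0 : r p ≠ 0 := fun h => R123.q_ne (by simp [h])
  have n2 : s2 p ≠ 0 := fun h => R123.c2_ne (by simp [h])
  have n0 : s0 p ≠ 0 := fun h => R304.c2_ne (by simp [h])
  have hq := hr.pow 2
  by_cases hy : 0 ≤ y
  · refine ContinuousAt.mul (ContinuousAt.mul (ContinuousAt.mul (continuousAt_omega hq
      (((h1.mul h2).mul h3).div₀ h4 n4) R123.q_ne
      (div_ne_zero (mul_ne_zero (mul_ne_zero n1 n2) n3) n4) a) ?_) ?_) ?_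
    · exact continuousAt_racah hq (hr.mul h2) (h1.pow 2) (h2.pow 2) (h3.pow 2)
        (mul_ne_zero r0 n2) R123 (by omega) i a
    · exact continuousAt_racah hq (hr.mul h0) (h3.pow 2) (h0.pow 2) (h4.pow 2)
        (mul_ne_zero r0 n0) R304 (by omega) j y
    · exact continuousAt_racah hq (hr.mul h2) (h4.pow 2) (h2.pow 2) (h1.pow 2)
        (mul_ne_zero r0 n2) R421 (by omega) a x
  -- For `y < 0` the bound `N - y` exceeds `N`, beyond the regularity hypotheses, but the second
  -- factor is identically zero.
  · have e : ∀ u, racah (r u ^ 2) (r u * s0 u) (s3 u ^ 2) (s0 u ^ 2) (s4 u ^ 2) (N - a) j y = 0 :=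
      fun u => racah_eq_zero (by omega)
    simp only [e, mul_zero, zero_mul]
    exact continuousAt_const

end continuity

/-! ### A curve of generic parameters through a given point. -/

section density

open Filter Topology

instance countableInterFilter_cocountable :
    CountableInterFilter (cocountable : Filter ℝ) where
  countable_sInter_mem S hS h := by
    rw [mem_cocountable, Set.compl_sInter]
    refine (hS.image _).sUnion ?_
    rintro _ ⟨t, ht, rfl⟩
    exact mem_cocountable.1 (h t ht)

/-- A countable set of reals has dense complement, so two functions continuous at `p` that agree off
it have the same limit there. -/
theorem eq_of_eventually_cocountable {f g : ℝ → ℂ} {p : ℝ} (hf : ContinuousAt f p)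
    (hg : ContinuousAt g p) (H : ∀ᶠ u in cocountable, f u = g u) : f p = g p := by
  have hd : Dense {u | f u = g u} := by
    have := (mem_cocountable.1 H).dense_compl ℝ
    rwa [compl_compl] at this
  have hn : (𝓝[{u | f u = g u}] p).NeBot := mem_closure_iff_nhdsWithin_neBot.1 (hd p)
  refine tendsto_nhds_unique_of_eventuallyEq (l := 𝓝[{u | f u = g u}] p) (hf.tendsto.mono_left nhdsWithin_le_nhds)
    (hg.tendsto.mono_left nhdsWithin_le_nhds) ?_
  exact eventually_mem_nhdsWithin

/-- The real exponential `e^{tu}` as a complex number. -/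
def expC (t u : ℝ) : ℂ := (Real.exp (t * u) : ℝ)

theorem expC_zero (t : ℝ) : expC t 0 = 1 := by simp [expC]

theorem expC_add (s t u : ℝ) : expC (s + t) u = expC s u * expC t u := by
  simp only [expC, add_mul, Real.exp_add, Complex.ofReal_mul]

theorem expC_ne_zero (t u : ℝ) : expC t u ≠ 0 := by
  rw [expC]
  exact_mod_cast (Real.exp_pos _).ne'

theorem expC_zpow (t u : ℝ) (k : ℤ) : expC t u ^ k = expC (k * t) u := by
  simp only [expC, mul_assoc, Complex.ofReal_exp, ← Complex.exp_int_mul]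
  push_cast
  rfl

theorem expC_pow (t u : ℝ) (k : ℕ) : expC t u ^ k = expC (k * t) u := by
  rw [← zpow_natCast, expC_zpow]
  norm_cast

theorem continuous_expC (t : ℝ) : Continuous (expC t) := by
  unfold expC
  fun_prop

theorem expC_injective {t : ℝ} (ht : t ≠ 0) : Function.Injective (expC t) := by
  intro u v h
  exact mul_left_cancel₀ ht (Real.exp_injective (Complex.ofReal_injective h))

theorem eventually_one_sub_ne (κ : ℂ) {t : ℝ} (ht : t ≠ 0) :
    ∀ᶠ u in cocountable, 1 - κ * expC t u ≠ 0 := by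
  refine mem_cocountable.2 (Set.Subsingleton.countable fun u hu v hv => ?_)
  simp only [Set.mem_compl_iff, Set.mem_ofPred_eq, not_not, sub_eq_zero] at hu hv
  have hκ : κ ≠ 0 := by
    rintro rfl
    simp at hu
  exact expC_injective ht (mul_left_cancel₀ hκ (hu.symm.trans hv))

/-- Each `k` excludes at most one `u`, because `u ↦ e^{(t+ks)u}` is injective when the rate is
nonzero; only countably many `k` occur. -/
theorem eventually_notPow (ρ κ : ℂ) {s t : ℝ} (h : ∀ k : ℤ, t + k * s ≠ 0) :
    ∀ᶠ u in cocountable, NotPow (ρ * expC s u) (κ * expC t u) := by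
  refine eventually_countable_forall.2 fun k => ?_
  filter_upwards [eventually_one_sub_ne (κ * ρ ^ k) (h k)] with u hu
  convert hu using 2
  rw [mul_zpow, expC_zpow, expC_add]
  ring

theorem int_mul_sqrt_two_add_ne_zero {m : ℤ} (hm : m ≠ 0) (n : ℤ) :
    (m : ℝ) * √2 + n ≠ 0 :=
  ((irrational_sqrt_two.intCast_mul hm).add_intCast n).ne_zero

theorem exists_generic_curve {r s0 s1 s2 s3 s4 : ℂ} {N : ℕ} (hr : r ≠ 0)
    (hprod : r ^ (2 * N + 3) * (s0 * s1 * s2 * s3 * s4) = 1) :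
    ∃ R S0 S1 S2 S3 S4 : ℝ → ℂ, (Continuous R ∧ Continuous S0 ∧ Continuous S1 ∧ Continuous S2 ∧
      Continuous S3 ∧ Continuous S4) ∧
      (R 0 = r ∧ S0 0 = s0 ∧ S1 0 = s1 ∧ S2 0 = s2 ∧ S3 0 = s3 ∧ S4 0 = s4) ∧
      (∀ u, R u ^ (2 * N + 3) * (S0 u * S1 u * S2 u * S3 u * S4 u) = 1) ∧
      ∀ᶠ u in cocountable, Generic5 (R u ^ 2) (S0 u ^ 2) (S1 u ^ 2) (S2 u ^ 2) (S3 u ^ 2)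
        (S4 u ^ 2) N := by
  have hc : ∀ (c : ℂ) (t : ℝ), Continuous fun u => c * expC t u := fun c t =>
    continuous_const.mul (continuous_expC t)
  have hz : ∀ (c : ℂ) (t : ℝ), c * expC t 0 = c := fun c t => by rw [expC_zero, mul_one]
  have hp : ∀ u, (r * expC 1 u) ^ (2 * N + 3) * (s0 * expC (-(4 * √2) - (2 * N + 3)) u *
      (s1 * expC (√2) u) * (s2 * expC (√2) u) * (s3 * expC (√2) u) * (s4 * expC (√2) u)) = 1 := by
    intro u
    rw [mul_pow, expC_pow, ← hprod]
    have : expC ((2 * N + 3 : ℕ) * 1) u * (expC (-(4 * √2) - (2 * N + 3)) u * expC (√2) u *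
        expC (√2) u * expC (√2) u * expC (√2) u) = 1 := by
      simp only [← expC_add]
      rw [expC, Complex.ofReal_eq_one, Real.exp_eq_one_iff]
      push_cast
      ring
    linear_combination r ^ (2 * N + 3) * (s0 * s1 * s2 * s3 * s4) * this
  -- `r` moves at rate `1`, `s₁,…,s₄` at rate `√2`, and `s₀` at the rate that keeps the product
  -- equal to `1`. The rates of the `cᵢ` and of their pairwise products are nonzero integer
  -- multiples of `√2` plus integers, so no power of `q` can compensate them.
  refine ⟨fun u => r * expC 1 u, fun u => s0 * expC (-(4 * √2) - (2 * N + 3)) u,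
    fun u => s1 * expC (√2) u, fun u => s2 * expC (√2) u, fun u => s3 * expC (√2) u,
    fun u => s4 * expC (√2) u, ⟨hc _ _, hc _ _, hc _ _, hc _ _, hc _ _, hc _ _⟩,
    ⟨hz _ _, hz _ _, hz _ _, hz _ _, hz _ _, hz _ _⟩, hp, ?_⟩
  have E : ∀ (κ : ℂ) (t : ℝ) (m n : ℤ), m ≠ 0 → t = m * √2 + n →
      ∀ᶠ u in cocountable, NotPow ((r * expC 1 u) ^ 2) (κ * expC t u) := by
    intro κ t m n hm ht
    filter_upwards [eventually_notPow (r ^ 2) κ (s := 2) (t := t) fun k => by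
      have := int_mul_sqrt_two_add_ne_zero hm (n + k * 2)
      rw [ht]
      push_cast at this
      rwa [add_assoc]] with u hu
    rwa [mul_pow, expC_pow, Nat.cast_ofNat, mul_one]
  have E1 : ∀ (κ : ℂ) (t : ℝ) (m n : ℤ), m ≠ 0 → 2 * t = m * √2 + n →
      ∀ᶠ u in cocountable, NotPow ((r * expC 1 u) ^ 2) ((κ * expC t u) ^ 2) := by
    intro κ t m n hm ht
    filter_upwards [E (κ ^ 2) (2 * t) m n hm ht] with u hu
    rwa [mul_pow κ, expC_pow, Nat.cast_ofNat]
  have E2 : ∀ (κ κ' : ℂ) (t t' : ℝ) (m n : ℤ), m ≠ 0 → 2 * (t + t') = m * √2 + n →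
      ∀ᶠ u in cocountable,
        NotPow ((r * expC 1 u) ^ 2) ((κ * expC t u) ^ 2 * (κ' * expC t' u) ^ 2) := by
    intro κ κ' t t' m n hm ht
    filter_upwards [E1 (κ * κ') (t + t') m n hm ht] with u hu
    rwa [← mul_pow, mul_mul_mul_comm, ← expC_add]
  have Q : ∀ᶠ u in cocountable, ∀ k : ℤ, k ≠ 0 → 1 - ((r * expC 1 u) ^ 2) ^ k ≠ 0 := by
    refine eventually_countable_forall.2 fun k => ?_
    by_cases hk : k = 0
    · simp [hk]
    have hk' : (k : ℝ) * 2 ≠ 0 := by simpa using hk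
    filter_upwards [eventually_one_sub_ne ((r ^ 2) ^ k) hk'] with u hu _
    rwa [mul_pow, mul_zpow, expC_pow, Nat.cast_ofNat, mul_one, expC_zpow]
  have F : ∀ κ : ℂ, _ := fun κ => E1 κ (√2) 2 0 (by norm_num) (by push_cast; ring)
  have F2 : ∀ κ κ' : ℂ, _ := fun κ κ' =>
    E2 κ κ' (√2) (√2) 4 0 (by norm_num) (by push_cast; ring)
  have F02 : ∀ κ κ' : ℂ, _ := fun κ κ' => E2 κ κ' (-(4 * √2) - (2 * N + 3)) (√2) (-6)
    (-(2 * (2 * N + 3))) (by norm_num) (by push_cast; ring)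
  filter_upwards [Q, F s1, F s2, F s3, F s4, E1 s0 (-(4 * √2) - (2 * N + 3)) (-8)
    (-(2 * (2 * N + 3))) (by norm_num) (by push_cast; ring), F02 s0 s1, F02 s0 s2, F02 s0 s3,
    F02 s0 s4, F2 s1 s2, F2 s1 s3, F2 s1 s4, F2 s2 s3, F2 s2 s4, F2 s3 s4] with u
    hQ n1 n2 n3 n4 n0 n01 n02 n03 n04 n12 n13 n14 n23 n24 n34
  refine ⟨pow_ne_zero _ (mul_ne_zero hr (expC_ne_zero _ _)), hQ, ?_, n0, n1, n2, n3, n4, n01, n02,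
    n03, n04, n12, n13, n14, n23, n24, n34⟩
  have := hp u
  rw [show 2 * (N : ℤ) + 3 = (2 * N + 3 : ℕ) by push_cast; ring, zpow_natCast, ← pow_mul,
    mul_comm 2, pow_mul]
  linear_combination ((r * expC 1 u) ^ (2 * N + 3) * (s0 * expC (-(4 * √2) - (2 * N + 3)) u *
      (s1 * expC (√2) u) * (s2 * expC (√2) u) * (s3 * expC (√2) u) * (s4 * expC (√2) u)) + 1) * this

end density

/-! ### Regularity supplied by the admissibility conditions. -/

section admissible

open Filter Topology

variable {q c c0 c1 c2 c3 c4 : ℂ} {N : ℕ}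

theorem one_sub_mul_zpow_ne_zero {k : ℤ} (h : c ≠ q ^ (-k)) : 1 - c * q ^ k ≠ 0 := by
  contrapose! h
  rw [zpow_neg]
  exact eq_inv_of_mul_eq_one_left (by linear_combination -h)

namespace Admissible

theorem pairReg (A : Admissible q c0 c1 c2 c3 c4 N)
    (hc : c ∈ ({c1 * c2, c2 * c3, c0 * c3, c0 * c4, c2 * c4,
      q * c1 * c2 * c3, q * c0 * c3 * c4, q * c1 * c2 * c4} : Set ℂ)) : PairReg q c N := by
  intro k hk hkN
  lift k to ℕ using by omega
  exact one_sub_mul_zpow_ne_zero (A.pair c hc k (by simp; omega))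

theorem one_sub_single_ne (A : Admissible q c0 c1 c2 c3 c4 N)
    (hc : c ∈ ({c0, c1, c2, c3, c4} : Set ℂ)) (k : ℤ) (hk : 1 ≤ k) (hkN : k ≤ N) :
    1 - c * q ^ k ≠ 0 := by
  lift k to ℕ using by omega
  exact one_sub_mul_zpow_ne_zero (A.single c hc k (by simp; omega))

theorem one_sub_zpow_ne (A : Admissible q c0 c1 c2 c3 c4 N) (k : ℤ) (hk : 1 ≤ k) (hkN : k ≤ N) :
    1 - q ^ k ≠ 0 := by
  lift k to ℕ using by omega
  rw [zpow_natCast, sub_ne_zero]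
  exact (A.q_pow k (by simp; omega)).symm

theorem _root_.QGriffiths.PairReg.shift (hq : q ≠ 0) (H : PairReg q (q * c) N) (k : ℤ)
    (hk : 3 ≤ k) (hkN : k ≤ 2 * N + 1) : 1 - c * q ^ k ≠ 0 := by
  have := H (k - 1) (by omega) (by omega)
  rwa [mul_comm q, mul_assoc, ← zpow_one_add₀ hq, add_sub_cancel] at this

theorem reg123 (A : Admissible q c0 c1 c2 c3 c4 N) : RacahReg q c1 c2 c3 N where
  q_ne := A.q_ne
  c2_ne := A.c_ne _ (by simp)
  q_pow := A.one_sub_zpow_ne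
  n2 := A.one_sub_single_ne (by simp)
  n3 := A.one_sub_single_ne (by simp)
  n23 := A.pairReg (by simp)
  n123 := (A.pairReg (c := q * (c1 * c2 * c3)) (by simp [mul_assoc])).shift A.q_ne

theorem reg304 (A : Admissible q c0 c1 c2 c3 c4 N) : RacahReg q c3 c0 c4 N where
  q_ne := A.q_ne
  c2_ne := A.c_ne _ (by simp)
  q_pow := A.one_sub_zpow_ne
  n2 := A.one_sub_single_ne (by simp)
  n3 := A.one_sub_single_ne (by simp)
  n23 := A.pairReg (by simp)
  n123 := (A.pairReg (c := q * (c3 * c0 * c4)) (by simp [mul_assoc, mul_comm c3 c0])).shift A.q_ne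

theorem reg421 (A : Admissible q c0 c1 c2 c3 c4 N) : RacahReg q c4 c2 c1 N where
  q_ne := A.q_ne
  c2_ne := A.c_ne _ (by simp)
  q_pow := A.one_sub_zpow_ne
  n2 := A.one_sub_single_ne (by simp)
  n3 := A.one_sub_single_ne (by simp)
  n23 := A.pairReg (by simp [mul_comm c2 c1])
  n123 := (A.pairReg (c := q * (c4 * c2 * c1)) (by
    rw [show q * (c4 * c2 * c1) = q * c1 * c2 * c4 by ring]; simp)).shift A.q_ne

/-- The product `c₀c₁c₃` is not among the listed conditions; by the relation `c₀c₁c₃q^k` is inverse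
to `c₂c₄q^{2N+3-k}`, and the range `3 ≤ k ≤ 2N+1` is mapped to `2,…,2N`. -/
theorem one_sub_103_ne (A : Admissible q c0 c1 c2 c3 c4 N)
    (hrel : q ^ (2 * N + 3) * (c0 * c1 * c2 * c3 * c4) = 1) (k : ℤ) (hk : 3 ≤ k)
    (hkN : k ≤ 2 * N + 1) : 1 - c1 * c0 * c3 * q ^ k ≠ 0 := by
  intro h
  refine A.pairReg (c := c2 * c4) (by simp) (2 * N + 3 - k) (by omega) (by omega) ?_
  rw [← zpow_natCast] at hrel
  rw [show ((2 * N + 3 : ℕ) : ℤ) = 2 * N + 3 - k + k by push_cast; ring,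
    zpow_add₀ A.q_ne] at hrel
  linear_combination -(c2 * c4 * q ^ (2 * (N : ℤ) + 3 - k)) * h - hrel

end Admissible

end admissible

end QGriffiths

end

/-! ### Passage from generic to admissible parameters. -/

open QGriffiths Filter Topology

theorem mainTheorem8 (N : ℕ) (q c0 c1 c2 c3 c4 r s0 s1 s2 s3 s4 : ℂ)
    (hr : r ^ 2 = q) (hs0 : s0 ^ 2 = c0) (hs1 : s1 ^ 2 = c1) (hs2 : s2 ^ 2 = c2)
    (hs3 : s3 ^ 2 = c3) (hs4 : s4 ^ 2 = c4)
    (hprod : r ^ (2 * N + 3) * (s0 * s1 * s2 * s3 * s4) = 1)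
    (hadm : QGriffiths.Admissible q c0 c1 c2 c3 c4 N)
    (i j x y : ℕ) (hij : i + j ≤ N) (hxy : x + y ≤ N) :
    (QGriffiths.eigen q (c0 * c4) j * QGriffiths.griffiths r s0 s1 s2 s3 s4 N i j x y =
      ∑ ε ∈ ({-1, 0, 1} : Finset ℤ), ∑ ε' ∈ ({-1, 0, 1} : Finset ℤ),
        QGriffiths.coeffA q (r * s2) c0 c1 c2 c4 c3 N ε ε' x y *
          QGriffiths.griffiths r s0 s1 s2 s3 s4 N i j (x - ε) (y - ε')) ∧
    (QGriffiths.eigen q (c2 * c3) i * QGriffiths.griffiths r s0 s1 s2 s3 s4 N i j x y =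
      ∑ ε ∈ ({-1, 0, 1} : Finset ℤ), ∑ ε' ∈ ({-1, 0, 1} : Finset ℤ),
        QGriffiths.omega q (q ^ x * (s1 * s2 * s4 / s3)) (-ε) /
            QGriffiths.omega q (q ^ y * (s1 * s0 * s3 / s4)) (-ε') *
          QGriffiths.coeffA q (r * s0) c2 c1 c0 c3 c4 N ε' ε y x *
          QGriffiths.griffiths r s0 s1 s2 s3 s4 N i j (x - ε) (y - ε')) := by
  subst hr hs0 hs1 hs2 hs3 hs4
  have hr0 : r ≠ 0 := by
    rintro rfl
    simp at hprod
  -- The given parameters become the values at time `0` of the curve, so that each equation is an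
  -- equality of two functions of `u` at `u = 0`.
  obtain ⟨R, S0, S1, S2, S3, S4, ⟨cR, k0, k1, k2, k3, k4⟩, ⟨rfl, rfl, rfl, rfl, rfl, rfl⟩, hp,
    hG⟩ := exists_generic_curve hr0 hprod
  have hz : ∀ {s : ℂ}, s ^ 2 ≠ 0 → s ≠ 0 := fun h h' => h (by simp [h'])
  have n0 := hz (hadm.c_ne (S0 0 ^ 2) (by simp))
  have n1 := hz (hadm.c_ne (S1 0 ^ 2) (by simp))
  have n2 := hz (hadm.c_ne (S2 0 ^ 2) (by simp))
  have n3 := hz (hadm.c_ne (S3 0 ^ 2) (by simp))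
  have n4 := hz (hadm.c_ne (S4 0 ^ 2) (by simp))
  have q0 := hadm.q_ne
  have kq : ContinuousAt (fun u => R u ^ 2) 0 := (cR.pow 2).continuousAt
  have z0 : ContinuousAt (fun u => S0 u ^ 2) 0 := (k0.pow 2).continuousAt
  have z1 : ContinuousAt (fun u => S1 u ^ 2) 0 := (k1.pow 2).continuousAt
  have z2 : ContinuousAt (fun u => S2 u ^ 2) 0 := (k2.pow 2).continuousAt
  have z3 : ContinuousAt (fun u => S3 u ^ 2) 0 := (k3.pow 2).continuousAt
  have z4 : ContinuousAt (fun u => S4 u ^ 2) 0 := (k4.pow 2).continuousAt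
  have cG : ∀ x y : ℤ, ContinuousAt
      (fun u => griffiths (R u) (S0 u) (S1 u) (S2 u) (S3 u) (S4 u) N i j x y) 0 := fun x y =>
    continuousAt_griffiths cR.continuousAt k0.continuousAt k1.continuousAt k2.continuousAt
      k3.continuousAt k4.continuousAt n1 n3 n4 hadm.reg123 hadm.reg304 hadm.reg421 i
      (Int.natCast_nonneg j) x y
  have tri : ∀ {ε : ℤ}, ε ∈ ({-1, 0, 1} : Finset ℤ) → ε = 1 ∨ ε = 0 ∨ ε = -1 := by
    intro ε hε
    simp only [Finset.mem_insert, Finset.mem_singleton] at hε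
    omega
  have hrel : (R 0 ^ 2) ^ (2 * N + 3) *
      (S0 0 ^ 2 * S1 0 ^ 2 * S2 0 ^ 2 * S3 0 ^ 2 * S4 0 ^ 2) = 1 := by
    rw [← pow_mul, mul_comm 2, pow_mul]
    linear_combination (R 0 ^ (2 * N + 3) * (S0 0 * S1 0 * S2 0 * S3 0 * S4 0) + 1) * hprod
  constructor
  · refine eq_of_eventually_cocountable
      (f := fun u => eigen (R u ^ 2) (S0 u ^ 2 * S4 u ^ 2) j *
        griffiths (R u) (S0 u) (S1 u) (S2 u) (S3 u) (S4 u) N i j x y)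
      (g := fun u => ∑ ε ∈ ({-1, 0, 1} : Finset ℤ), ∑ ε' ∈ ({-1, 0, 1} : Finset ℤ),
        coeffA (R u ^ 2) (R u * S2 u) (S0 u ^ 2) (S1 u ^ 2) (S2 u ^ 2) (S4 u ^ 2) (S3 u ^ 2)
          N ε ε' x y *
          griffiths (R u) (S0 u) (S1 u) (S2 u) (S3 u) (S4 u) N i j (x - ε) (y - ε'))
      ((continuousAt_eigen kq (z0.mul z4) q0 j).mul (cG x y)) ?_ ?_
    · refine tendsto_finsetSum _ fun ε hε => tendsto_finsetSum _ fun ε' hε' => ?_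
      refine ContinuousAt.mul ?_ (cG _ _)
      refine continuousAt_coeffA kq q0 (cR.mul k2).continuousAt (mul_ne_zero hr0 n2) z0 z1 z2 z4
        (pow_ne_zero 2 n4) z3 (by omega) (by omega) (by omega) (hadm.pairReg (by simp))
        (hadm.pairReg ?_) ?_ (tri hε) (tri hε')
      · simp [mul_comm (S3 0 ^ 2) (S0 0 ^ 2)]
      · exact (hadm.pairReg (c := R 0 ^ 2 * (S1 0 ^ 2 * S2 0 ^ 2 * S4 0 ^ 2))
          (by simp [mul_assoc])).shift q0
    · filter_upwards [hG] with u hu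
      exact griffiths_diff hu (by omega) (by omega) (by omega) (by omega)
  · refine eq_of_eventually_cocountable
      (f := fun u => eigen (R u ^ 2) (S2 u ^ 2 * S3 u ^ 2) i *
        griffiths (R u) (S0 u) (S1 u) (S2 u) (S3 u) (S4 u) N i j x y)
      (g := fun u => ∑ ε ∈ ({-1, 0, 1} : Finset ℤ), ∑ ε' ∈ ({-1, 0, 1} : Finset ℤ),
        omega (R u ^ 2) ((R u ^ 2) ^ x * (S1 u * S2 u * S4 u / S3 u)) (-ε) /
            omega (R u ^ 2) ((R u ^ 2) ^ y * (S1 u * S0 u * S3 u / S4 u)) (-ε') *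
          coeffA (R u ^ 2) (R u * S0 u) (S2 u ^ 2) (S1 u ^ 2) (S0 u ^ 2) (S3 u ^ 2) (S4 u ^ 2)
            N ε' ε y x *
          griffiths (R u) (S0 u) (S1 u) (S2 u) (S3 u) (S4 u) N i j (x - ε) (y - ε'))
      ((continuousAt_eigen kq (z2.mul z3) q0 i).mul (cG x y)) ?_ ?_
    · refine tendsto_finsetSum _ fun ε hε => tendsto_finsetSum _ fun ε' hε' => ?_
      have w1 : (R 0 ^ 2) ^ x * (S1 0 * S2 0 * S4 0 / S3 0) ≠ 0 := by positivity
      have w2 : (R 0 ^ 2) ^ y * (S1 0 * S0 0 * S3 0 / S4 0) ≠ 0 := by positivity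
      refine ContinuousAt.mul (ContinuousAt.mul (ContinuousAt.div₀ ?_ ?_
        (omega_ne_zero q0 w2 _)) ?_) (cG _ _)
      · exact continuousAt_omega kq ((kq.pow x).mul (((k1.mul k2).mul k4).continuousAt.div₀
          k3.continuousAt n3)) q0 w1 _
      · exact continuousAt_omega kq ((kq.pow y).mul (((k1.mul k0).mul k3).continuousAt.div₀
          k4.continuousAt n4)) q0 w2 _
      · refine continuousAt_coeffA kq q0 (cR.mul k0).continuousAt (mul_ne_zero hr0 n0) z2 z1 z0 z3
          (pow_ne_zero 2 n3) z4 (by omega) (by omega) (by omega) (hadm.pairReg (by simp))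
          (hadm.pairReg ?_) (hadm.one_sub_103_ne hrel) (tri hε') (tri hε)
        simp [mul_comm (S4 0 ^ 2) (S2 0 ^ 2)]
    · filter_upwards [hG] with u hu
      have hp' : R u ^ (2 * (N : ℤ) + 3) * (S0 u * S1 u * S2 u * S3 u * S4 u) = 1 := by
        rw [← hp u]
        norm_cast
      have := griffiths_dual_diff (i := i) (j := j) (x := x) (y := y) hu hp' (by omega) (by omega)
        (by omega) (by omega)
      simpa only [zpow_natCast] using this
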